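/- Let $M$ be a connected, second countable, Hausdorff smooth manifold of dimension at least $2$, $\tau: TM\to M$ its tangent bundle, $\mathring TM$ the set of nonzero tangent vectors. For $v\in T_pM$, $w\in T_pM$ let $\mathbf i(v,w)=\frac{d}{dt}\big|_{0}(v+tw)\in T_vTM$; let $\mathbf j=\tau_*$ on $TTM$, $\mathbf J=\mathbf i\circ\mathbf j$, and let $C(v)=\mathbf i(v,v)$ be the Liouville field. $X^{\mathsf v}$ and $X^{\mathsf c}$ denote the vertical and the complete lift of a vector field $X$ on $M$. A *Finsler function* is a function $\overline F:TM\to\mathbb R$ that is smooth on $\mathring TM$, satisfies $\overline F(\lambda v)=\lambda\overline F(v)$ for $\lambda\ge 0$, and whose metric tensor (the fibrewise Hessian of $\overline E=\frac12\overline F^2$) is nondegenerate at every point of $\mathring TM$. A *spray* is a $C^1$ vector field $S$ on $TM$, smooth on $\mathring TM$, with $\mathbf JS=C$ and $[C,S]=S$. The *canonical spray* of $\overline F$ is the map $S:TM\to TTM$ that vanishes on the zero section $o$ and on $\mathring TM$ is the smooth vector field with $i_S\,d\,d_{\mathbf J}\overline E=-d\overline E$, where $d_{\mathbf J}\overline E=d\overline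 E\circ\mathbf J$. An *Ehresmann connection* is a fibre preserving, fibrewise linear map $\mathcal H:TM\times_MTM\to TTM$ with $\mathbf j\circ\mathcal H=1$, smooth over $\mathring TM\times_M TM$, and with $\mathcal H(o(p),w)=(o_*)_p(w)$. It is *associated* to a spray $S$ if $\mathcal H(v,X(\tau(v)))=\frac12(X^{\mathsf c}+[X^{\mathsf v},S])(v)$ for all vector fields $X$ on $M$ and $v\in \mathring TM$. With $\mathbf v=1-\mathcal H\circ\mathbf j$, it is *homogeneous* if $\mathbf v[\mathcal H\widetilde X,C]=0$, and *torsion-free* if $\mathbf v[\mathcal H\widetilde X,\mathbf i\widetilde Y]-\mathbf v[\mathcal H\widetilde Y,\mathbf i\widetilde X]-\mathbf J[\mathcal H\widetilde X,\mathcal H\widetilde Y]=0$, for all smooth sections $\widetilde X,\widetilde Y$ of $\mathring TM\times_MTM\to \mathring TM$. The *canonical connection* of $\overline F$ is the Ehresmann connection associated to the canonical spray of $\overline F$ (the latter being a spray). The condition $d\overline F\circ\mathcal H=0$ is understood over $\mathring TM$. Let $\overline F$ be a Finsler function on $TM$. 1. (Criterion for Finsler variationality.) Let $S$ be a spray over $M$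 and $\mathcal H$ the Ehresmann connection associated to $S$. Then $S$ is the canonical spray of $(M,\overline F)$ if and only if $d\overline F\circ\mathcal H=0$. 2. (Uniqueness of the canonical connection.) $(M,\overline F)$ has exactly one canonical connection, and an Ehresmann connection $\mathcal H$ over $M$ is the canonical connection of $(M,\overline F)$ if and only if it is torsion-free, homogeneous and satisfies $d\overline F\circ\mathcal H=0$. -/

import Mathlib

open scoped Manifold ContDiff

noncomputable section

namespace SprayFinsler

variable {E : Type*} [NormedAddCommGroup E] [NormedSpace ℝ E]
  {M : Type*} [TopologicalSpace M] [ChartedSpace E M]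

/-! ### The tangent bundle, vector fields on `M` and on `TM` -/

/-- The tangent manifold `TM`. -/
abbrev TM (E : Type*) [NormedAddCommGroup E] [NormedSpace ℝ E]
    (M : Type*) [TopologicalSpace M] [ChartedSpace E M] : Type _ :=
  TangentBundle 𝓘(ℝ, E) M

/-- The tangent space `T_p M`. -/
abbrev T (E : Type*) [NormedAddCommGroup E] [NormedSpace ℝ E]
    {M : Type*} [TopologicalSpace M] [ChartedSpace E M] (p : M) : Type _ :=
  TangentSpace 𝓘(ℝ, E) p

/-- The slit tangent manifold: the set of nonzero tangent vectors. -/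
def slit (E : Type*) [NormedAddCommGroup E] [NormedSpace ℝ E]
    (M : Type*) [TopologicalSpace M] [ChartedSpace E M] : Set (TM E M) :=
  {v | v.2 ≠ 0}

variable [IsManifold 𝓘(ℝ, E) ∞ M]

/-- A smooth vector field on `M`. -/
def IsVectorField (X : ∀ p : M, T E p) : Prop :=
  ContMDiff 𝓘(ℝ, E) 𝓘(ℝ, E).tangent ∞ (fun p => (⟨p, X p⟩ : TM E M))

/-- The tangent space `T_v TM`. -/
abbrev TT (v : TM E M) : Type _ := TangentSpace 𝓘(ℝ, E).tangent v

/-- A vector field on `TM`, of class `C^k` over the set `s`. -/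
def IsVectorFieldOn (k : ℕ∞) (ξ : ∀ v : TM E M, TT v) (s : Set (TM E M)) : Prop :=
  ContMDiffOn 𝓘(ℝ, E).tangent 𝓘(ℝ, E).tangent.tangent k
    (fun v => (⟨v, ξ v⟩ : TangentBundle 𝓘(ℝ, E).tangent (TM E M))) s

/-- A section along the slit tangent bundle projection, that is, a section of the pull-back bundle
`(TM \ o(M)) ×_M TM → TM \ o(M)`: a family `v ↦ X v ∈ T_{τ(v)} M`, smooth on the slit tangent
manifold (its values on the zero section are irrelevant). -/
def IsSectionAlong (X : ∀ v : TM E M, T E v.proj) : Prop :=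
  ContMDiffOn 𝓘(ℝ, E).tangent 𝓘(ℝ, E).tangent ∞
    (fun v => (⟨v.proj, X v⟩ : TM E M)) (slit E M)

/-- The directional derivative `ξ f = df(ξ)` of a function on `TM`. -/
def dirDeriv (f : TM E M → ℝ) (v : TM E M) (ξ : TT v) : ℝ :=
  mfderiv 𝓘(ℝ, E).tangent 𝓘(ℝ, ℝ) f v ξ

/-- The Lie bracket of vector fields on `TM`. -/
def bracket (ξ η : ∀ v : TM E M, TT v) (v : TM E M) : TT v :=
  VectorField.mlieBracket 𝓘(ℝ, E).tangent ξ η v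

/-! ### Canonical constructions on `TM` -/

/-- The canonical map `i(v, w) = ċ(0)`, where `c(t) = v + t w`. -/
def vert (v : TM E M) (w : T E v.proj) : TT v :=
  mfderiv 𝓘(ℝ, ℝ) 𝓘(ℝ, E).tangent (fun t : ℝ => (⟨v.proj, v.2 + t • w⟩ : TM E M)) 0 (1 : ℝ)

/-- The canonical map `j`, i.e. the derivative `τ_* : T_v TM → T_{τ(v)} M`. -/
def proj (v : TM E M) : TT v →L[ℝ] T E v.proj :=
  mfderiv 𝓘(ℝ, E).tangent 𝓘(ℝ, E) (fun u : TM E M => u.proj) v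

/-- The vertical endomorphism `J = i ∘ j`. -/
def vertEndo (v : TM E M) (ξ : TT v) : TT v := vert v (proj v ξ)

/-- The Liouville vector field `C = i δ`, where `δ(v) = (v, v)`. -/
def liouville (v : TM E M) : TT v := vert v v.2

/-- The vertical lift of a vector field on `M`. -/
def vLift (X : ∀ p : M, T E p) (v : TM E M) : TT v := vert v (X v.proj)

/-- The complete lift of a vector field on `M`, as the image of the vector `X_*(v) ∈ T_{X(p)} TM`,
`p = τ(v)`, under the canonical flip of `TTM`. By Mathlib's convention, `T_u TM = E × E` for every
`u` over `p` through the bundle chart of `TM` that is induced by the preferred chart of `M` at `p`.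
In these coordinates `X_*(v) = (v, DX(p) v)`, and the complete lift is `(X(p), DX(p) v)`.
See `dirDeriv_completeLift` for its characteristic property. -/
def completeLift (X : ∀ p : M, T E p) (v : TM E M) : TT v :=
  ((X v.proj,
    (mfderiv 𝓘(ℝ, E) 𝓘(ℝ, E).tangent (fun p => (⟨p, X p⟩ : TM E M)) v.proj v.2 : E × E).2) : E × E)

/-! ### Checks: the coordinate form of `i` and `j`, and the complete lift -/

theorem extChartAt_TM_self (v : TM E M) :
    extChartAt 𝓘(ℝ, E).tangent v v = ((chartAt E v.proj v.proj, v.2) : E × E) := by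
  refine Prod.ext rfl ?_
  exact (tangentBundleCore 𝓘(ℝ, E) M).coordChange_self (achart E v.proj) v.proj
    (mem_chart_source E v.proj) v.2

theorem contMDiff_completeLiftFun (f : M → ℝ) (hf : ContMDiff 𝓘(ℝ, E) 𝓘(ℝ, ℝ) ∞ f) : ContMDiff 𝓘(ℝ, E).tangent 𝓘(ℝ, ℝ) ∞
     (fun u : TM E M => (mfderiv 𝓘(ℝ, E) 𝓘(ℝ, ℝ) f u.proj u.2 : ℝ)) := by
  have h1 := hf.contMDiff_tangentMap (m := ∞) (by simp)
  exact (contMDiff_snd_tangentBundle_modelSpace ℝ 𝓘(ℝ,ℝ)).comp h1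

theorem dirDeriv_completeLiftFun (f : M → ℝ) (hf : ContMDiff 𝓘(ℝ, E) 𝓘(ℝ, ℝ) ∞ f) (v : TM E M) (ξ : TT v) :
   dirDeriv (fun u : TM E M => (mfderiv 𝓘(ℝ, E) 𝓘(ℝ, ℝ) f u.proj u.2 : ℝ)) v ξ =
    fderiv ℝ (fderiv ℝ (f ∘ (chartAt E v.proj).symm)) (chartAt E v.proj v.proj) (ξ : E × E).1 v.2
    + fderiv ℝ (f ∘ (chartAt E v.proj).symm) (chartAt E v.proj v.proj) (ξ : E × E).2 := by
  set g : E → ℝ := f ∘ (chartAt E v.proj).symm with hg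
  have hgs : ContDiffOn ℝ ∞ g (chartAt E v.proj).target := by
    have := hf.comp_contMDiffOn (contMDiffOn_chart_symm (I := 𝓘(ℝ, E)) (n := ∞) (x := v.proj))
    exact this.contDiffOn
  have ht : (chartAt E v.proj).target ∈ nhds (chartAt E v.proj v.proj) :=
    (chartAt E v.proj).open_target.mem_nhds (mem_chart_target E v.proj)
  have hfc : MDifferentiableAt 𝓘(ℝ, E).tangent 𝓘(ℝ, ℝ)
     (fun u : TM E M => (mfderiv 𝓘(ℝ, E) 𝓘(ℝ, ℝ) f u.proj u.2 : ℝ)) v :=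
    (contMDiff_completeLiftFun f hf).mdifferentiable (by simp) v
  have hloc : writtenInExtChartAt 𝓘(ℝ, E).tangent 𝓘(ℝ, ℝ) v
      (fun u : TM E M => (mfderiv 𝓘(ℝ, E) 𝓘(ℝ, ℝ) f u.proj u.2 : ℝ)) =ᶠ[nhds ((chartAt E v.proj v.proj, v.2) : E × E)]
      fun z : E × E => fderiv ℝ g z.1 z.2 := by
    have : ∀ᶠ z : E × E in nhds ((chartAt E v.proj v.proj, v.2) : E × E), z.1 ∈ (chartAt E v.proj).target :=
      continuous_fst.continuousAt.eventually_mem ht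
    filter_upwards [this] with z hz
    have hs : (extChartAt 𝓘(ℝ, E).tangent v).symm z = tangentMap 𝓘(ℝ, E) 𝓘(ℝ, E) (chartAt E v.proj).symm
        (⟨z.1, z.2⟩ : TangentBundle 𝓘(ℝ, E) E) := by
      rw [tangentMap_chart_symm (p := v) (by exact hz)]
      simp only [mfld_simps]
      rfl
    change (mfderiv 𝓘(ℝ, E) 𝓘(ℝ, ℝ) f ((extChartAt 𝓘(ℝ, E).tangent v).symm z).proj
      ((extChartAt 𝓘(ℝ, E).tangent v).symm z).2 : ℝ) = _
    rw [hs]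
    simp only [tangentMap]
    rw [← mfderiv_eq_fderiv, hg, mfderiv_comp (I' := 𝓘(ℝ, E)) z.1 ((hf.mdifferentiable (by simp)) _) (mdifferentiableAt_atlas_symm (chart_mem_atlas _ _) hz)]
    rfl
  unfold dirDeriv
  have h1 : ContDiffAt ℝ ∞ g (chartAt E v.proj v.proj) := hgs.contDiffAt ht
  have h2 : HasFDerivAt (fderiv ℝ g) (fderiv ℝ (fderiv ℝ g) (chartAt E v.proj v.proj)) (chartAt E v.proj v.proj) :=
    ((h1.fderiv_right (m := 1) (by norm_cast)).differentiableAt (by simp)).hasFDerivAt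
  have h3 : HasFDerivAt (fun z : E × E => fderiv ℝ g z.1 z.2) _ ((chartAt E v.proj v.proj, v.2) : E × E) :=
    (HasFDerivAt.comp ((chartAt E v.proj v.proj, v.2) : E × E) (f := Prod.fst) h2 hasFDerivAt_fst).clm_apply hasFDerivAt_snd
  rw [hfc.mfderiv, extChartAt_TM_self]
  rw [ModelWithCorners.range_eq_univ, fderivWithin_univ]
  erw [hloc.fderiv_eq, h3.fderiv]
  exact add_comm _ _

/-- In the preferred coordinates, `j(a, b) = a`. -/
theorem proj_eq_fst (v : TM E M) (ξ : TT v) : proj v ξ = (ξ : E × E).1 := by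
  unfold proj
  have hd : MDifferentiableAt 𝓘(ℝ, E).tangent 𝓘(ℝ, E) (fun u : TM E M => u.proj) v :=
    (Bundle.contMDiff_proj (n := 1) _).mdifferentiable (by simp) v
  rw [hd.mfderiv, extChartAt_TM_self, ModelWithCorners.range_eq_univ, fderivWithin_univ]
  have hloc : writtenInExtChartAt 𝓘(ℝ, E).tangent 𝓘(ℝ, E) v
      (fun u : TM E M => u.proj) =ᶠ[nhds ((chartAt E v.proj v.proj, v.2) : E × E)]
      fun z : E × E => z.1 := by
    have ht : (chartAt E v.proj).target ∈ nhds (chartAt E v.proj v.proj) :=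
      (chartAt E v.proj).open_target.mem_nhds (mem_chart_target E v.proj)
    have : ∀ᶠ z : E × E in nhds ((chartAt E v.proj v.proj, v.2) : E × E), z.1 ∈ (chartAt E v.proj).target :=
      continuous_fst.continuousAt.eventually_mem ht
    filter_upwards [this] with z hz
    simp only [writtenInExtChartAt, Function.comp_apply, mfld_simps]
    exact (chartAt E v.proj).right_inv hz
  erw [hloc.fderiv_eq, fderiv_fst]
  rfl

/-- In the preferred coordinates, `i(v, w) = (0, w)`; in particular `i` is injective. -/
theorem vert_eq_mk (v : TM E M) (w : T E v.proj) : vert v w = ((0, w) : E × E) := by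
  have hd : MDifferentiableAt 𝓘(ℝ, ℝ) 𝓘(ℝ, E).tangent (fun t : ℝ => (⟨v.proj, v.2 + t • w⟩ : TM E M)) 0 := by
    refine ContMDiffAt.mdifferentiableAt (n := 1) ?_ (by simp)
    refine Bundle.contMDiffAt_totalSpace.2 ⟨contMDiffAt_const, ?_⟩
    have hc : ∀ a b : E, ContMDiffAt 𝓘(ℝ, ℝ) 𝓘(ℝ, E) 1 (fun t : ℝ => a + t • b) 0 := fun a b =>
      ContDiffAt.contMDiffAt (by fun_prop)
    refine (hc v.2 w).congr_of_eventuallyEq (Filter.Eventually.of_forall fun t => ?_)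
    exact congrArg Prod.snd (extChartAt_TM_self (⟨v.proj, v.2 + t • w⟩ : TM E M))
  unfold vert
  rw [hd.mfderiv, ModelWithCorners.range_eq_univ, fderivWithin_univ]
  have hw : writtenInExtChartAt 𝓘(ℝ, ℝ) 𝓘(ℝ, E).tangent 0 (fun t : ℝ => (⟨v.proj, v.2 + t • w⟩ : TM E M))
     = fun t : ℝ => ((chartAt E v.proj v.proj, (v.2 + t • w : E)) : E × E) := by
    funext t
    exact extChartAt_TM_self (⟨v.proj, v.2 + t • w⟩ : TM E M)
  have h3 : HasFDerivAt (fun t : ℝ => ((chartAt E v.proj v.proj, (v.2 + t • w : E)) : E × E))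
     (ContinuousLinearMap.toSpanSingleton ℝ ((0, w) : E × E)) 0 := by
    have h4 : HasDerivAt (fun t : ℝ => ((chartAt E v.proj v.proj, (v.2 + t • w : E)) : E × E)) ((0, (1:ℝ) • w) : E × E) 0 :=
      (hasDerivAt_const (0 : ℝ) (chartAt E v.proj v.proj)).prodMk
        (HasDerivAt.const_add (F := E) v.2 (HasDerivAt.smul_const (F := E) (hasDerivAt_id (0 : ℝ)) w))
    rw [one_smul] at h4
    exact h4.hasFDerivAt
  erw [hw, h3.fderiv]
  exact one_smul ℝ ((0, w) : E × E)

/-- The characteristic property `X^c f^c = (X f)^c` of the complete lift of `X`, where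
`f^c : TM → ℝ` is the complete lift `v ↦ v(f)` of a smooth function `f`. -/
theorem dirDeriv_completeLift (X : ∀ p : M, T E p) (hX : IsVectorField X) (f : M → ℝ)
    (hf : ContMDiff 𝓘(ℝ, E) 𝓘(ℝ, ℝ) ∞ f) (v : TM E M) :
    dirDeriv (fun u : TM E M => (mfderiv 𝓘(ℝ, E) 𝓘(ℝ, ℝ) f u.proj u.2 : ℝ)) v (completeLift X v) =
      mfderiv 𝓘(ℝ, E) 𝓘(ℝ, ℝ) (fun p => (mfderiv 𝓘(ℝ, E) 𝓘(ℝ, ℝ) f p (X p) : ℝ)) v.proj v.2 := by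
  set D := mfderiv 𝓘(ℝ, E) 𝓘(ℝ, E).tangent (fun p => (⟨p, X p⟩ : TM E M)) v.proj with hD
  have hXd : MDifferentiableAt 𝓘(ℝ, E) 𝓘(ℝ, E).tangent (fun p => (⟨p, X p⟩ : TM E M)) v.proj :=
    hX.mdifferentiable (by simp) _
  have h1 := mfderiv_comp (I' := 𝓘(ℝ, E).tangent) v.proj
    ((contMDiff_completeLiftFun f hf).mdifferentiable (by simp) (⟨v.proj, X v.proj⟩ : TM E M)) hXd
  have h2 : (mfderiv 𝓘(ℝ, E) 𝓘(ℝ, ℝ) (fun p => (mfderiv 𝓘(ℝ, E) 𝓘(ℝ, ℝ) f p (X p) : ℝ)) v.proj v.2 : ℝ)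
    = dirDeriv (fun u : TM E M => (mfderiv 𝓘(ℝ, E) 𝓘(ℝ, ℝ) f u.proj u.2 : ℝ)) ⟨v.proj, X v.proj⟩ (D v.2) := by
    erw [h1]
    rfl
  have h3 : ((D v.2 : E × E).1 : E) = v.2 := by
    have := mfderiv_comp (I' := 𝓘(ℝ, E).tangent) v.proj (g := fun u : TM E M => u.proj)
      ((Bundle.contMDiff_proj (n := 1) _).mdifferentiable (by simp) (⟨v.proj, X v.proj⟩ : TM E M)) hXd
    have h4 := proj_eq_fst (⟨v.proj, X v.proj⟩ : TM E M) (D v.2)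
    rw [← h4]
    have h5 := congrArg (fun L => L v.2) this
    have h6 : (fun u : TM E M => u.proj) ∘ (fun p => (⟨p, X p⟩ : TM E M)) = id := rfl
    rw [h6, mfderiv_id] at h5
    exact h5.symm
  have hsymm : IsSymmSndFDerivAt ℝ (f ∘ (chartAt E v.proj).symm) (chartAt E v.proj v.proj) := by
    have ht : (chartAt E v.proj).target ∈ nhds (chartAt E v.proj v.proj) :=
      (chartAt E v.proj).open_target.mem_nhds (mem_chart_target E v.proj)
    have := (hf.comp_contMDiffOn (contMDiffOn_chart_symm (I := 𝓘(ℝ, E)) (n := ∞) (x := v.proj))).contDiffOn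
    exact (this.contDiffAt ht).isSymmSndFDerivAt (by
      simp only [minSmoothness_of_isRCLikeNormedField]
      exact WithTop.coe_le_coe.2 (le_top : (2 : ℕ∞) ≤ ⊤))
  rw [h2, dirDeriv_completeLiftFun f hf, dirDeriv_completeLiftFun f hf]
  erw [h3]
  congr 1
  exact hsymm _ _

/-! ### Ehresmann connections -/

/-- The projection `τ : TM → M` as a smooth map. -/
def tau (E : Type*) [NormedAddCommGroup E] [NormedSpace ℝ E]
    (M : Type*) [TopologicalSpace M] [ChartedSpace E M] [IsManifold 𝓘(ℝ, E) ∞ M] :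
    C^∞⟮𝓘(ℝ, E).tangent, TM E M; 𝓘(ℝ, E), M⟯ :=
  ⟨fun v => v.proj, Bundle.contMDiff_proj _⟩

/-- The total manifold `TM ×_M TM` of the pull-back bundle `τ^* TM`. -/
abbrev PullbackTM (E : Type*) [NormedAddCommGroup E] [NormedSpace ℝ E]
    (M : Type*) [TopologicalSpace M] [ChartedSpace E M] [IsManifold 𝓘(ℝ, E) ∞ M] : Type _ :=
  Bundle.TotalSpace E (tau E M *ᵖ (TangentSpace 𝓘(ℝ, E) : M → Type _))

/-- A fibre preserving and fibrewise linear map `TM ×_M TM → TTM`. -/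
abbrev FibreLinearMap (E : Type*) [NormedAddCommGroup E] [NormedSpace ℝ E]
    (M : Type*) [TopologicalSpace M] [ChartedSpace E M] [IsManifold 𝓘(ℝ, E) ∞ M] : Type _ :=
  ∀ v : TM E M, T E v.proj →ₗ[ℝ] TT v

/-- Ehresmann connections over `M`. -/
structure IsEhresmannConnection (H : FibreLinearMap E M) : Prop where
  /-- `j ∘ H = 1`. -/
  splits : ∀ (v : TM E M) (w : T E v.proj), proj v (H v w) = w
  /-- `H` is smooth over `(TM \ o(M)) ×_M TM`. -/
  smooth : ContMDiffOn (𝓘(ℝ, E).tangent.prod 𝓘(ℝ, E)) 𝓘(ℝ, E).tangent.tangent ∞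
    (fun z : PullbackTM E M =>
      (⟨z.proj, H z.proj z.2⟩ : TangentBundle 𝓘(ℝ, E).tangent (TM E M)))
    {z | z.proj ∈ slit E M}
  /-- `H(o(p), w) = (o_*)_p(w)`, where `o` is the zero vector field. -/
  zero_section : ∀ (p : M) (w : T E p),
    H ⟨p, 0⟩ w = mfderiv 𝓘(ℝ, E) 𝓘(ℝ, E).tangent (fun q : M => (⟨q, 0⟩ : TM E M)) p w

/-- The vertical projector `v = 1 - H ∘ j`. -/
def vertProj (H : FibreLinearMap E M) (v : TM E M) (ξ : TT v) : TT v := ξ - H v (proj v ξ)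

/-- `H` is homogeneous: its tension `t(X) = i⁻¹ v [H X, C]` vanishes for all sections `X` along the
slit tangent bundle (as `i` is injective, `i⁻¹` can be omitted). -/
def IsHomogeneous (H : FibreLinearMap E M) : Prop :=
  ∀ X : ∀ v : TM E M, T E v.proj, IsSectionAlong X → ∀ v ∈ slit E M,
    vertProj H v (bracket (fun u => H u (X u)) liouville v) = 0

/-- `H` is torsion-free: the tensor
`i T(X, Y) = v [H X, i Y] - v [H Y, i X] - i j [H X, H Y]`
vanishes for all sections `X`, `Y` along the slit tangent bundle (`i` is injective). -/
def IsTorsionFree (H : FibreLinearMap E M) : Prop :=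
  ∀ X Y : ∀ v : TM E M, T E v.proj, IsSectionAlong X → IsSectionAlong Y → ∀ v ∈ slit E M,
    vertProj H v (bracket (fun u => H u (X u)) (fun u => vert u (Y u)) v)
      - vertProj H v (bracket (fun u => H u (Y u)) (fun u => vert u (X u)) v)
      - vertEndo v (bracket (fun u => H u (X u)) (fun u => H u (Y u)) v) = 0

/-! ### Sprays -/

/-- Sprays over `M`. -/
structure IsSpray (S : ∀ v : TM E M, TT v) : Prop where
  /-- `S` is smooth on the slit tangent manifold. -/
  smooth : IsVectorFieldOn ⊤ S (slit E M)
  /-- `J S = C`. -/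
  semispray : ∀ v, vertEndo v (S v) = liouville v
  /-- `S` is of class `C^1` on `TM`. -/
  contDiff_one : IsVectorFieldOn 1 S Set.univ
  /-- `[C, S] = S`. -/
  homogeneous : ∀ v, bracket liouville S v = S v

/-- `H` is the Ehresmann connection associated to `S`:
`H(X) = (X^c + [X^v, S]) / 2` for all vector fields `X` on `M`.
This is required where `S` is smooth; on the zero section, every Ehresmann connection is
prescribed by definition. -/
structure IsAssociatedConnection (S : ∀ v : TM E M, TT v) (H : FibreLinearMap E M) : Prop where
  isEhresmannConnection : IsEhresmannConnection H
  horizontal_lift : ∀ X : ∀ p : M, T E p, IsVectorField X → ∀ v ∈ slit E M,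
    H v (X v.proj) = (1 / 2 : ℝ) • (completeLift X v + bracket (vLift X) S v)

/-! ### Finsler functions, the canonical spray and the canonical connection -/

/-- The energy function `F² / 2`. -/
def energy (F : TM E M → ℝ) (v : TM E M) : ℝ := F v ^ 2 / 2

/-- The metric tensor `g = ∇^v ∇^v (F² / 2)`: the second derivative of the energy along the fibre,
`g_v(w₁, w₂) = ∂_s ∂_t (F² / 2)(v + s w₁ + t w₂)` at `s = t = 0`. -/
def metricTensor (F : TM E M → ℝ) (v : TM E M) (w₁ w₂ : T E v.proj) : ℝ :=
  lineDeriv ℝ (fun u : T E v.proj =>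
    lineDeriv ℝ (fun u' : T E v.proj => energy F ⟨v.proj, u'⟩) u w₂) v.2 w₁

/-- Finsler functions on `TM`. -/
structure IsFinslerFunction (F : TM E M → ℝ) : Prop where
  smooth : ContMDiffOn 𝓘(ℝ, E).tangent 𝓘(ℝ, ℝ) ∞ F (slit E M)
  homogeneous : ∀ (c : ℝ) (v : TM E M), 0 ≤ c → F ⟨v.proj, c • v.2⟩ = c * F v
  nondegenerate : ∀ v ∈ slit E M, ∀ w₁ : T E v.proj,
    (∀ w₂ : T E v.proj, metricTensor F v w₁ w₂ = 0) → w₁ = 0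

/-- The 1-form `d_J f = df ∘ J` on `TM`. -/
def dJ (f : TM E M → ℝ) (v : TM E M) (ξ : TT v) : ℝ := dirDeriv f v (vertEndo v ξ)

/-- The exterior derivative of a 1-form `α` on `TM`, evaluated on vector fields:
`dα(ξ, η) = ξ(α(η)) - η(α(ξ)) - α([ξ, η])`. -/
def extDerivOneForm (α : ∀ v : TM E M, TT v → ℝ) (ξ η : ∀ v : TM E M, TT v) (v : TM E M) : ℝ :=
  dirDeriv (fun u => α u (η u)) v (ξ v) - dirDeriv (fun u => α u (ξ u)) v (η v)
    - α v (bracket ξ η v)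

/-- `S` is the canonical spray of the Finsler function `F`: it vanishes on the zero section, and on
the slit tangent manifold it is the smooth vector field with `i_S d d_J (F² / 2) = - d (F² / 2)`. -/
structure IsCanonicalSpray (F : TM E M → ℝ) (S : ∀ v : TM E M, TT v) : Prop where
  zero_section : ∀ p : M, S ⟨p, 0⟩ = 0
  smooth : IsVectorFieldOn ⊤ S (slit E M)
  euler_lagrange : ∀ η : ∀ v : TM E M, TT v, IsVectorFieldOn ⊤ η (slit E M) → ∀ v ∈ slit E M,
    extDerivOneForm (dJ (energy F)) S η v = - dirDeriv (energy F) v (η v)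

/-- `H` is the canonical connection of the Finsler function `F`: the Ehresmann connection
associated to the canonical spray of `F`. -/
def IsCanonicalConnection (F : TM E M → ℝ) (H : FibreLinearMap E M) : Prop :=
  ∃ S : ∀ v : TM E M, TT v, IsSpray S ∧ IsCanonicalSpray F S ∧ IsAssociatedConnection S H

/-- `dF ∘ H = 0` (over the slit tangent manifold, where `F` is smooth). -/
def IsConservative (F : TM E M → ℝ) (H : FibreLinearMap E M) : Prop :=
  ∀ v ∈ slit E M, ∀ w : T E v.proj, dirDeriv F v (H v w) = 0

end SprayFinsler

end

noncomputable section

open scoped Topology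
open Set VectorField

set_option linter.unusedSectionVars false

namespace SprayFinsler

/-! In a bundle chart with coordinates `(x, y)`, a semispray is `S = (y, s)`, an Ehresmann
connection is `H(w) = (w, Γ w)`, and `e` denotes the energy. The conditions of the theorem become
equations between vertical derivatives: the connection associated to `S` has `Γ w = ½ ∂_w s`; `[C,
S] = S` says `∂_y s = 2 s`; homogeneity of `H` says `∂_y Γ = Γ`; torsion-freeness says `(∂_a Γ) b =
(∂_b Γ) a`; and `S` solves `i_S d d_J e = -de` iff `D²e(S, (0, w)) = De(w, 0)` for all `w`
(`isEulerLagrangeVector_iff`). Moreover `F` has no zeros off the zero section, since `de ≠ 0` there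
while `de = F dF`. So `dF ∘ H = 0` is equivalent to `De(w, Γ w) = 0`.

Criterion. If `S` is canonical, the equation at `w = y` together with Euler's relation for `e` gives
`De(y, s) = 0`: energy is conserved along `S`. The vertical derivative of this law along `w` is
`D²e(S, (0, w)) + De(w, ∂_w s) = 0`, and the Euler-Lagrange equation turns the first term into
`De(w, 0)`; the sum is `2 De(w, ½ ∂_w s)`. Conversely, if this last expression vanishes for all `w`,
then `w = y` and `∂_y s = 2 s` recover `De(y, s) = 0`, and the same derivative recovers the
Euler-Lagrange equation. See `fderiv_horizontal_eq_zero` and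
`isEulerLagrangeVector_of_fderiv_horizontal_eq_zero`.

Existence. Nondegeneracy lets the Euler-Lagrange equation be solved uniquely for `s`. Uniqueness
makes the solution chart independent and homogeneous of degree two, and such a map extends by zero
to a `C^1` map across the zero section (`contDiffAt_one_of_homogeneous_two`). The connection of the
resulting spray is chart independent because `horizontalPart` is defined by brackets.

Characterization. If `Γ = ½ ∂s`, symmetry of second derivatives gives torsion-freeness, and
differentiating `∂_y s = 2 s` then gives homogeneity. Conversely, for torsion-free and homogeneous
`H` put `S(v) = H(v, v)`, so `s = Γ y`. Then `∂_w s = Γ w + (∂_w Γ) y = Γ w + (∂_y Γ) w = 2 Γ w`, so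
`H` is associated to `S`, and the criterion's argument shows that `S` is canonical when `dF ∘ H =
0`.

Because only vertical derivatives occur, most identities are needed only at the points `center p y`,
on the fibre over `p` in the preferred chart at `p`; there the identification of `T_v TM` with `E ×
E` is the chart itself. -/

section BundleCharts

variable {E : Type*} [NormedAddCommGroup E] [NormedSpace ℝ E]
  {M : Type*} [TopologicalSpace M] [ChartedSpace E M] [IsManifold 𝓘(ℝ, E) ∞ M]

/-! ### Bundle charts of `TM` -/

/-- The parametrization of `TM` induced by the preferred chart of `M` at `p`. -/
def param (p : M) : E × E → TM E M :=
  (extChartAt 𝓘(ℝ, E).tangent (⟨p, 0⟩ : TM E M)).symm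

/-- The coordinates on `TM` induced by the preferred chart of `M` at `p`. -/
def coord (p : M) : TM E M → E × E :=
  extChartAt 𝓘(ℝ, E).tangent (⟨p, 0⟩ : TM E M)

/-- The domain of the parametrization `param p`. -/
def dom (E : Type*) [NormedAddCommGroup E] [NormedSpace ℝ E]
    {M : Type*} [TopologicalSpace M] [ChartedSpace E M] (p : M) : Set (E × E) :=
  {z | z.1 ∈ (chartAt E p).target}

/-- The part of the domain of `param p` that parametrizes nonzero tangent vectors. -/
def slitDom (E : Type*) [NormedAddCommGroup E] [NormedSpace ℝ E]
    {M : Type*} [TopologicalSpace M] [ChartedSpace E M] (p : M) : Set (E × E) :=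
  {z | z.1 ∈ (chartAt E p).target ∧ z.2 ≠ 0}

/-- The coordinates of the tangent vector `⟨p, y⟩` in the chart at `p`. -/
def center (p : M) (y : E) : E × E := (chartAt E p p, y)

/-- The derivative of the inverse of the preferred chart at `p`. -/
def dbase (p : M) (x : E) : E →L[ℝ] T E ((chartAt E p).symm x) :=
  mfderiv 𝓘(ℝ, E) 𝓘(ℝ, E) (chartAt E p).symm x

/-- The derivative of `param p`. -/
def dparam (p : M) (z : E × E) : (E × E) →L[ℝ] TT (param p z) :=
  mfderiv 𝓘(ℝ, E × E) 𝓘(ℝ, E).tangent (param p) z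

theorem isOpen_dom (p : M) : IsOpen (dom E p) :=
  (chartAt E p).open_target.preimage continuous_fst

theorem isOpen_slitDom (p : M) : IsOpen (slitDom E p) :=
  (isOpen_dom p).inter (isOpen_compl_singleton.preimage continuous_snd)

theorem center_mem_dom (p : M) (y : E) : center p y ∈ dom E p := mem_chart_target E p

theorem center_mem_slitDom (p : M) {y : E} (hy : y ≠ 0) : center p y ∈ slitDom E p :=
  ⟨mem_chart_target E p, hy⟩

theorem extChartAt_TM_target (v : TM E M) :
    (extChartAt 𝓘(ℝ, E).tangent v).target = dom E v.proj := by
  ext z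
  rw [extChartAt_target, ModelWithCorners.range_eq_univ, inter_univ]
  exact TangentBundle.mem_chart_target_iff z v

theorem extChartAt_TM_source (v : TM E M) :
    (extChartAt 𝓘(ℝ, E).tangent v).source = {u | u.proj ∈ (chartAt E v.proj).source} := by
  ext z
  simp only [mfld_simps]

theorem param_eq_extChartAt_symm (p : M) (y : E) :
    param p = (extChartAt 𝓘(ℝ, E).tangent (⟨p, y⟩ : TM E M)).symm := rfl

theorem param_eq (p : M) {z : E × E} (hz : z ∈ dom E p) :
    param p z = ⟨(chartAt E p).symm z.1, dbase p z.1 z.2⟩ := by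
  have h := tangentMap_chart_symm (I := 𝓘(ℝ, E)) (p := (⟨p, 0⟩ : TM E M))
    (q := (⟨z.1, z.2⟩ : TangentBundle 𝓘(ℝ, E) E)) hz
  exact h.symm

theorem param_center (p : M) (y : E) : param p (center p y) = (⟨p, y⟩ : TM E M) := by
  rw [param_eq_extChartAt_symm p y]
  have := extChartAt_TM_self (⟨p, y⟩ : TM E M)
  unfold center
  erw [← this]
  exact extChartAt_to_inv _

theorem coord_param (p : M) {z : E × E} (hz : z ∈ dom E p) : coord p (param p z) = z :=
  (extChartAt 𝓘(ℝ, E).tangent (⟨p, 0⟩ : TM E M)).right_inv (by rwa [extChartAt_TM_target])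

theorem param_coord (p : M) {v : TM E M} (hv : v.proj ∈ (chartAt E p).source) :
    param p (coord p v) = v :=
  (extChartAt 𝓘(ℝ, E).tangent (⟨p, 0⟩ : TM E M)).left_inv (by rwa [extChartAt_TM_source])

theorem coord_mem_dom (p : M) {v : TM E M} (hv : v.proj ∈ (chartAt E p).source) :
    coord p v ∈ dom E p := by
  have := (extChartAt 𝓘(ℝ, E).tangent (⟨p, 0⟩ : TM E M)).map_source (x := v)
    (by rwa [extChartAt_TM_source])
  rwa [extChartAt_TM_target] at this

theorem contMDiffAt_param (p : M) {z : E × E} (hz : z ∈ dom E p) :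
    ContMDiffAt 𝓘(ℝ, E × E) 𝓘(ℝ, E).tangent ∞ (param p) z := by
  have h := contMDiffOn_extChartAt_symm (I := 𝓘(ℝ, E).tangent) (n := ∞) (⟨p, 0⟩ : TM E M)
  rw [extChartAt_TM_target] at h
  exact h.contMDiffAt ((isOpen_dom p).mem_nhds hz)

theorem mdifferentiableAt_param (p : M) {z : E × E} (hz : z ∈ dom E p) :
    MDifferentiableAt 𝓘(ℝ, E × E) 𝓘(ℝ, E).tangent (param p) z :=
  (contMDiffAt_param p hz).mdifferentiableAt (by simp)

theorem contMDiffAt_coord (p : M) {v : TM E M} (hv : v.proj ∈ (chartAt E p).source) :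
    ContMDiffAt 𝓘(ℝ, E).tangent 𝓘(ℝ, E × E) ∞ (coord p) v :=
  contMDiffAt_extChartAt' (by simpa only [mfld_simps] using hv)

theorem dparam_isInvertible (p : M) {z : E × E} (hz : z ∈ dom E p) :
    (dparam p z).IsInvertible := by
  have h := isInvertible_mfderivWithin_extChartAt_symm (I := 𝓘(ℝ, E).tangent)
    (x := (⟨p, 0⟩ : TM E M)) (y := z) (by rwa [extChartAt_TM_target])
  rwa [ModelWithCorners.range_eq_univ, mfderivWithin_univ] at h

/-- The model `E × E` of `T_v TM` is defined through the preferred chart at the foot of `v`, so over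
`p` itself the chart at `p` has identity derivative. Pointwise identities can thus be read off at
`center p y` without transition maps. -/
theorem dparam_center (p : M) (y : E) (ζ : E × E) :
    (dparam p (center p y : E × E) ζ : E × E) = ζ := by
  have h := mfderivWithin_range_extChartAt_symm (I := 𝓘(ℝ, E).tangent) (x := (⟨p, y⟩ : TM E M))
  rw [ModelWithCorners.range_eq_univ, mfderivWithin_univ, extChartAt_TM_self] at h
  exact congrArg (fun L : (E × E) →L[ℝ] (E × E) => L ζ) h

theorem dbase_isInvertible (p : M) {x : E} (hx : x ∈ (chartAt E p).target) :
    (dbase p x).IsInvertible := by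
  have h := isInvertible_mfderivWithin_extChartAt_symm (I := 𝓘(ℝ, E))
    (x := p) (y := x) (by simpa only [mfld_simps] using hx)
  rw [ModelWithCorners.range_eq_univ, mfderivWithin_univ] at h
  exact h

theorem dbase_center (p : M) (w : E) : (dbase p (chartAt E p p) w : E) = w := by
  have h := mfderivWithin_range_extChartAt_symm (I := 𝓘(ℝ, E)) (x := p)
  rw [ModelWithCorners.range_eq_univ, mfderivWithin_univ] at h
  exact congrArg (fun L : E →L[ℝ] E => L w) h

theorem param_mem_slit_iff (p : M) {z : E × E} (hz : z ∈ dom E p) :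
    param p z ∈ slit E M ↔ z.2 ≠ 0 := by
  rw [param_eq p hz]
  refine not_congr ⟨fun h => ?_, fun h => ?_⟩
  · exact (dbase_isInvertible p hz).injective (h.trans (map_zero _).symm)
  · change dbase p z.1 z.2 = 0
    rw [h, map_zero]

theorem isOpen_slit : IsOpen (slit E M) := by
  rw [isOpen_iff_mem_nhds]
  rintro v hv
  have h1 : coord v.proj v ∈ slitDom E v.proj :=
    ⟨coord_mem_dom _ (mem_chart_source E _), by
      rw [← param_mem_slit_iff _ (coord_mem_dom _ (mem_chart_source E _)),
        param_coord _ (mem_chart_source E _)]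
      exact hv⟩
  have h2 := (contMDiffAt_coord v.proj (v := v) (mem_chart_source E _)).continuousAt.preimage_mem_nhds
    ((isOpen_slitDom _).mem_nhds h1)
  have h3 : {u : TM E M | u.proj ∈ (chartAt E v.proj).source} ∈ 𝓝 v := by
    rw [← extChartAt_TM_source v]
    exact extChartAt_source_mem_nhds v
  filter_upwards [h2, h3] with u hu hu'
  have := (param_mem_slit_iff _ (coord_mem_dom _ hu')).2 hu.2
  rwa [param_coord _ hu'] at this

/-! ### Canonical objects in coordinates -/

theorem dirDeriv_dparam (p : M) {z : E × E} (hz : z ∈ dom E p) {f : TM E M → ℝ}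
    (hf : MDifferentiableAt 𝓘(ℝ, E).tangent 𝓘(ℝ, ℝ) f (param p z)) (ζ : E × E) :
    dirDeriv f (param p z) (dparam p z ζ) = fderiv ℝ (f ∘ param p) z ζ := by
  rw [← mfderiv_eq_fderiv, mfderiv_comp (I' := 𝓘(ℝ, E).tangent) z hf (mdifferentiableAt_param p hz)]
  rfl

/-- `param p` is linear on fibres, so it carries the line `z.2 + t w` to the line that defines
`vert`. -/
theorem vert_dbase (p : M) {z : E × E} (hz : z ∈ dom E p) (w : E) :
    vert (param p z) (dbase p z.1 w) = dparam p z ((0, w) : E × E) := by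
  have h1 : HasFDerivAt (fun t : ℝ => ((z.1, z.2 + t • w) : E × E))
      (ContinuousLinearMap.toSpanSingleton ℝ ((0, w) : E × E)) 0 := by
    have h4 : HasDerivAt (fun t : ℝ => ((z.1, z.2 + t • w) : E × E)) ((0, (1:ℝ) • w) : E × E) 0 :=
      (hasDerivAt_const (0 : ℝ) z.1).prodMk
        (((hasDerivAt_id (0 : ℝ)).smul_const w).const_add z.2)
    rw [one_smul] at h4
    exact h4.hasFDerivAt
  have h0 : ((z.1, z.2 + (0:ℝ) • w) : E × E) = z := by simp
  have h2 : (fun t : ℝ => (⟨(param p z).proj, (param p z).2 + t • (show T E (param p z).proj from dbase p z.1 w)⟩ : TM E M)) =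
      param p ∘ (fun t : ℝ => ((z.1, z.2 + t • w) : E × E)) := by
    funext t
    simp only [Function.comp_apply]
    rw [param_eq p hz, param_eq p (z := (z.1, z.2 + t • w)) hz]
    exact congrArg (fun a : E => (⟨(chartAt E p).symm z.1, a⟩ : TM E M))
      (((dbase p z.1).map_add z.2 (t • w)).trans (congrArg _ ((dbase p z.1).map_smul t w))).symm
  have h3 : MDifferentiableAt 𝓘(ℝ, E × E) 𝓘(ℝ, E).tangent (param p)
      ((fun t : ℝ => ((z.1, z.2 + t • w) : E × E)) 0) := by
    simp only [h0]
    exact mdifferentiableAt_param p hz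
  have h5 := mfderiv_comp (0 : ℝ) h3 h1.differentiableAt.mdifferentiableAt
  have h6 : vert (param p z) (dbase p z.1 w) =
      (mfderiv 𝓘(ℝ, ℝ) 𝓘(ℝ, E).tangent
        (param p ∘ (fun t : ℝ => ((z.1, z.2 + t • w) : E × E))) 0 (1 : ℝ) : E × E) := by
    rw [← h2]
    rfl
  rw [h6, h5, mfderiv_eq_fderiv, h1.fderiv]
  change (mfderiv 𝓘(ℝ, E × E) 𝓘(ℝ, E).tangent (param p) ((z.1, z.2 + (0:ℝ) • w) : E × E)
    ((1:ℝ) • ((0, w) : E × E)) : E × E) = _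
  rw [h0, one_smul]
  rfl

theorem proj_dparam (p : M) {z : E × E} (hz : z ∈ dom E p) (ζ : E × E) :
    proj (param p z) (dparam p z ζ) = dbase p z.1 ζ.1 := by
  have h1 := mfderiv_comp (I' := 𝓘(ℝ, E).tangent) z (g := fun u : TM E M => u.proj)
    ((Bundle.contMDiff_proj (n := 1) _).mdifferentiable (by simp) (param p z))
    (mdifferentiableAt_param p hz)
  have h2 := mfderiv_comp (I' := 𝓘(ℝ, E)) z (g := ((chartAt E p).symm : E → M)) (f := Prod.fst)
    (mdifferentiableAt_atlas_symm (chart_mem_atlas _ _) hz)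
    (differentiableAt_fst (𝕜 := ℝ)).mdifferentiableAt
  have h4 := congrArg (fun L => L ζ) (h1.symm.trans h2)
  rw [mfderiv_eq_fderiv, fderiv_fst] at h4
  exact h4

/-- The coordinate representation of a vector field on `TM`. -/
def loc (p : M) (ξ : ∀ v : TM E M, TT v) : E × E → E × E :=
  mpullback 𝓘(ℝ, E × E) 𝓘(ℝ, E).tangent (param p) ξ

theorem dparam_loc (p : M) {z : E × E} (hz : z ∈ dom E p) (ξ : ∀ v : TM E M, TT v) :
    dparam p z (loc p ξ z) = ξ (param p z) :=
  (dparam_isInvertible p hz).self_apply_inverse _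

theorem loc_eq_iff (p : M) {z : E × E} (hz : z ∈ dom E p) (ξ : ∀ v : TM E M, TT v) (ζ : E × E) :
    loc p ξ z = ζ ↔ ξ (param p z) = dparam p z ζ := by
  rw [← dparam_loc p hz ξ]
  exact (dparam_isInvertible p hz).injective.eq_iff.symm

theorem loc_center (p : M) (y : E) (ξ : ∀ v : TM E M, TT v) :
    loc p ξ (center p y) = (ξ ⟨p, y⟩ : E × E) := by
  rw [← dparam_center p y (loc p ξ (center p y)), dparam_loc p (center_mem_dom p y)]
  exact congrArg (fun v => (ξ v : E × E)) (param_center p y)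

/-- The coordinate representation of a section along the projection of `TM`. -/
def locSec (p : M) (X : ∀ v : TM E M, T E v.proj) (z : E × E) : E :=
  (dbase p z.1).inverse (X (param p z))

theorem dbase_locSec (p : M) {z : E × E} (hz : z ∈ dom E p) (X : ∀ v : TM E M, T E v.proj) :
    dbase p z.1 (locSec p X z) = X (param p z) :=
  (dbase_isInvertible p hz).self_apply_inverse _

theorem locSec_center (p : M) (y : E) (X : ∀ v : TM E M, T E v.proj) :
    locSec p X (center p y) = (X ⟨p, y⟩ : E) := by
  rw [← dbase_center p (locSec p X (center p y))]
  have h := dbase_locSec p (center_mem_dom p y) X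
  exact h.trans (congrArg (fun v => (X v : E)) (param_center p y))

theorem loc_vert (p : M) {z : E × E} (hz : z ∈ dom E p) (X : ∀ v : TM E M, T E v.proj) :
    loc p (fun u => vert u (X u)) z = (0, locSec p X z) := by
  rw [loc_eq_iff p hz, ← dbase_locSec p hz X]
  exact vert_dbase p hz _

theorem locSec_self (p : M) {z : E × E} (hz : z ∈ dom E p) :
    locSec p (fun u => u.2) z = z.2 := by
  refine (dbase_isInvertible p hz).injective ((dbase_locSec p hz _).trans ?_)
  have h := param_eq p hz
  exact congrArg (fun v : TM E M => (v.2 : E)) h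

theorem loc_liouville (p : M) {z : E × E} (hz : z ∈ dom E p) :
    loc p liouville z = (0, z.2) := by
  rw [← locSec_self p hz]
  exact loc_vert p hz _

theorem locSec_proj (p : M) {z : E × E} (hz : z ∈ dom E p) (ξ : ∀ v : TM E M, TT v) :
    locSec p (fun u => proj u (ξ u)) z = (loc p ξ z).1 := by
  refine (dbase_isInvertible p hz).injective ((dbase_locSec p hz _).trans ?_)
  rw [← dparam_loc p hz ξ]
  exact proj_dparam p hz _

theorem loc_vertEndo (p : M) {z : E × E} (hz : z ∈ dom E p) (ξ : ∀ v : TM E M, TT v) :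
    loc p (fun u => vertEndo u (ξ u)) z = (0, (loc p ξ z).1) := by
  rw [← locSec_proj p hz]
  exact loc_vert p hz _

end BundleCharts

section LocalFields

variable {E : Type*} [NormedAddCommGroup E] [NormedSpace ℝ E] [FiniteDimensional ℝ E]
  {M : Type*} [TopologicalSpace M] [ChartedSpace E M] [IsManifold 𝓘(ℝ, E) ∞ M]

/-! ### Smoothness and brackets in coordinates -/

/-- The vector field on the domain of a bundle chart of `TM` with a given coordinate
representation. -/
def push (p : M) (σ : E × E → E × E) : ∀ v : TM E M, TT v :=
  mpullback 𝓘(ℝ, E).tangent 𝓘(ℝ, E × E) (coord p) σ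

theorem mfderiv_coord_dparam (p : M) {z : E × E} (hz : z ∈ dom E p) (ζ : E × E) :
    (mfderiv 𝓘(ℝ, E).tangent 𝓘(ℝ, E × E) (coord p) (param p z) (dparam p z ζ) : E × E) = ζ := by
  have h := mfderiv_extChartAt_comp_mfderivWithin_extChartAt_symm (I := 𝓘(ℝ, E).tangent)
    (x := (⟨p, 0⟩ : TM E M)) (y := z) (by rwa [extChartAt_TM_target])
  rw [ModelWithCorners.range_eq_univ, mfderivWithin_univ] at h
  exact congrArg (fun L => L ζ) h

theorem mfderiv_coord_isInvertible (p : M) {v : TM E M} (hv : v.proj ∈ (chartAt E p).source) :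
    (mfderiv 𝓘(ℝ, E).tangent 𝓘(ℝ, E × E) (coord p) v).IsInvertible :=
  isInvertible_mfderiv_extChartAt (by rwa [extChartAt_TM_source])

theorem param_mem_source (p : M) {z : E × E} (hz : z ∈ dom E p) :
    (param p z).proj ∈ (chartAt E p).source :=
  (chartAt E p).map_target hz

theorem push_param (p : M) {z : E × E} (hz : z ∈ dom E p) (σ : E × E → E × E) :
    push p σ (param p z) = dparam p z (σ z) := by
  refine (mfderiv_coord_isInvertible p (param_mem_source p hz)).injective ?_
  refine Eq.trans ?_ (mfderiv_coord_dparam p hz (σ z)).symm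
  refine ((mfderiv_coord_isInvertible p (param_mem_source p hz)).self_apply_inverse _).trans ?_
  exact congrArg σ (coord_param p hz)

theorem loc_push (p : M) {z : E × E} (hz : z ∈ dom E p) (σ : E × E → E × E) :
    loc p (push p σ) z = σ z :=
  (loc_eq_iff p hz _ _).2 (push_param p hz σ)

theorem loc_congr (p : M) {z : E × E} {ξ η : ∀ v : TM E M, TT v}
    (h : ξ (param p z) = η (param p z)) : loc p ξ z = loc p η z :=
  congrArg (fun a => (dparam p z).inverse a) h

theorem push_loc (p : M) {v : TM E M} (hv : v.proj ∈ (chartAt E p).source)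
    (ξ : ∀ v : TM E M, TT v) : push p (loc p ξ) v = ξ v := by
  have h := push_param p (coord_mem_dom p hv) (loc p ξ)
  rw [dparam_loc p (coord_mem_dom p hv), param_coord p hv] at h
  exact h

theorem source_mem_nhds (p : M) {v : TM E M} (hv : v.proj ∈ (chartAt E p).source) :
    {u : TM E M | u.proj ∈ (chartAt E p).source} ∈ 𝓝 v := by
  have h := (isOpen_extChartAt_source (I := 𝓘(ℝ, E).tangent) (⟨p, 0⟩ : TM E M))
  rw [extChartAt_TM_source] at h
  exact h.mem_nhds hv

theorem contDiffAt_loc (p : M) {z : E × E} (hz : z ∈ dom E p) {ξ : ∀ v : TM E M, TT v} {k : ℕ∞}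
    (hξ : ContMDiffAt 𝓘(ℝ, E).tangent 𝓘(ℝ, E).tangent.tangent k
      (fun v => (⟨v, ξ v⟩ : TangentBundle 𝓘(ℝ, E).tangent (TM E M))) (param p z)) :
    ContDiffAt ℝ k (loc p ξ) z := by
  have : CompleteSpace E := FiniteDimensional.complete ℝ E
  refine contMDiffAt_vectorSpace_iff_contDiffAt.1 ?_
  exact hξ.mpullback_vectorField_preimage (contMDiffAt_param p hz) (dparam_isInvertible p hz)
    (by exact_mod_cast le_top)

theorem contMDiffAt_push (p : M) {v : TM E M} (hv : v.proj ∈ (chartAt E p).source)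
    {σ : E × E → E × E} {k : ℕ∞} (hσ : ContDiffAt ℝ k σ (coord p v)) :
    ContMDiffAt 𝓘(ℝ, E).tangent 𝓘(ℝ, E).tangent.tangent k
      (fun v => (⟨v, push p σ v⟩ : TangentBundle 𝓘(ℝ, E).tangent (TM E M))) v := by
  have : CompleteSpace E := FiniteDimensional.complete ℝ E
  exact (contMDiffAt_vectorSpace_iff_contDiffAt.2 hσ).mpullback_vectorField_preimage (contMDiffAt_coord p hv)
    (mfderiv_coord_isInvertible p hv) (by exact_mod_cast le_top)

theorem contMDiffAt_of_loc (p : M) {v : TM E M} (hv : v.proj ∈ (chartAt E p).source)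
    {ξ : ∀ v : TM E M, TT v} {k : ℕ∞} (hξ : ContDiffAt ℝ k (loc p ξ) (coord p v)) :
    ContMDiffAt 𝓘(ℝ, E).tangent 𝓘(ℝ, E).tangent.tangent k
      (fun v => (⟨v, ξ v⟩ : TangentBundle 𝓘(ℝ, E).tangent (TM E M))) v := by
  refine (contMDiffAt_push p hv hξ).congr_of_eventuallyEq ?_
  filter_upwards [source_mem_nhds p hv] with u hu
  rw [push_loc p hu]

theorem IsVectorFieldOn.contDiffAt_loc {k : ℕ∞} {ξ : ∀ v : TM E M, TT v}
    (hξ : IsVectorFieldOn k ξ (slit E M)) (p : M) {z : E × E} (hz : z ∈ slitDom E p) :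
    ContDiffAt ℝ k (loc p ξ) z :=
  SprayFinsler.contDiffAt_loc p hz.1
    (hξ.contMDiffAt (isOpen_slit.mem_nhds ((param_mem_slit_iff p hz.1).2 hz.2)))

theorem coord_mem_slitDom (p : M) {v : TM E M} (hv : v.proj ∈ (chartAt E p).source)
    (hv0 : v ∈ slit E M) : coord p v ∈ slitDom E p :=
  ⟨coord_mem_dom p hv, (param_mem_slit_iff p (coord_mem_dom p hv)).1 (by rwa [param_coord p hv])⟩

theorem isVectorFieldOn_slit {k : ℕ∞} {ξ : ∀ v : TM E M, TT v}
    (h : ∀ (p : M), ∀ z ∈ slitDom E p, ContDiffAt ℝ k (loc p ξ) z) :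
    IsVectorFieldOn k ξ (slit E M) := fun v hv =>
  (contMDiffAt_of_loc v.proj (mem_chart_source E _)
    (h v.proj _ (coord_mem_slitDom _ (mem_chart_source E _) hv))).contMDiffWithinAt

theorem isVectorFieldOn_univ {k : ℕ∞} {ξ : ∀ v : TM E M, TT v}
    (h : ∀ (p : M), ∀ z ∈ dom E p, ContDiffAt ℝ k (loc p ξ) z) :
    IsVectorFieldOn k ξ univ := fun v _ =>
  (contMDiffAt_of_loc v.proj (mem_chart_source E _)
    (h v.proj _ (coord_mem_dom _ (mem_chart_source E _)))).contMDiffWithinAt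

/-- Naturality of the Lie bracket under pullback by the local diffeomorphism `param p`, followed by
the vector space formula. Only `C^1` regularity is asked, so that it also applies to sprays on the
zero section. -/
theorem loc_bracket (p : M) {z : E × E} (hz : z ∈ dom E p) {ξ η : ∀ v : TM E M, TT v}
    (hξ : ContDiffAt ℝ 1 (loc p ξ) z) (hη : ContDiffAt ℝ 1 (loc p η) z) :
    loc p (bracket ξ η) z =
      fderiv ℝ (loc p η) z (loc p ξ z) - fderiv ℝ (loc p ξ) z (loc p η z) := by
  have : CompleteSpace E := FiniteDimensional.complete ℝ E
  have : IsManifold 𝓘(ℝ, E).tangent (minSmoothness ℝ 2) (TM E M) := by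
    rw [minSmoothness_of_isRCLikeNormedField]; infer_instance
  have key : ∀ {ζ : ∀ v : TM E M, TT v}, ContDiffAt ℝ 1 (loc p ζ) z →
      MDifferentiableAt 𝓘(ℝ, E).tangent 𝓘(ℝ, E).tangent.tangent
        (fun v => (⟨v, ζ v⟩ : TangentBundle 𝓘(ℝ, E).tangent (TM E M))) (param p z) := by
    intro ζ hζ
    refine (contMDiffAt_of_loc (k := 1) p (param_mem_source p hz) ?_).mdifferentiableAt (by simp)
    rwa [coord_param p hz]
  have h := mpullback_mlieBracket (I := 𝓘(ℝ, E × E)) (n := ∞) (key hξ) (key hη)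
    (contMDiffAt_param p hz) (by
      rw [minSmoothness_of_isRCLikeNormedField]
      exact WithTop.coe_le_coe.2 (le_top : (2 : ℕ∞) ≤ ⊤))
  have h2 := mlieBracketWithin_eq_lieBracketWithin (𝕜 := ℝ) (V := loc p ξ) (W := loc p η)
    (s := univ)
  have h3 := mlieBracketWithin_univ (I := 𝓘(ℝ, E × E)) (V := loc p ξ) (W := loc p η)
  rw [lieBracketWithin_univ] at h2
  exact h.trans (congrFun (h3.symm.trans h2) z)

theorem bracket_center (p : M) (y : E) {ξ η : ∀ v : TM E M, TT v}
    (hξ : ContDiffAt ℝ 1 (loc p ξ) (center p y)) (hη : ContDiffAt ℝ 1 (loc p η) (center p y)) :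
    (bracket ξ η ⟨p, y⟩ : E × E) =
      fderiv ℝ (loc p η) (center p y) (loc p ξ (center p y))
        - fderiv ℝ (loc p ξ) (center p y) (loc p η (center p y)) := by
  rw [← loc_bracket p (center_mem_dom p y) hξ hη, loc_center]

/-! ### Extension of vector fields -/

/-- The Hausdorff property enters here: the compact support of a bump function in a chart must be
closed in `M` for its extension by zero to be smooth. -/
theorem exists_smoothBumpFunction_tsupport_subset [T2Space M] (p q : M)
    (hq : q ∈ (chartAt E p).source) :
    ∃ φ : M → ℝ, ContMDiff 𝓘(ℝ, E) 𝓘(ℝ, ℝ) ∞ φ ∧ φ =ᶠ[𝓝 q] 1 ∧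
      tsupport φ ⊆ (chartAt E p).source := by
  obtain ⟨φ, -, h⟩ := (SmoothBumpFunction.nhds_basis_tsupport (I := 𝓘(ℝ, E)) q).mem_iff.1
    ((chartAt E p).open_source.mem_nhds hq)
  exact ⟨φ, φ.contMDiff (I := 𝓘(ℝ, E)), φ.eventuallyEq_one, h⟩

/-- Every vector field given in a bundle chart agrees near a given point with a vector field on
the slit tangent manifold. -/
theorem exists_isVectorFieldOn_loc_eventuallyEq [T2Space M] (p : M) {z : E × E} (hz : z ∈ dom E p)
    {σ : E × E → E × E} (hσ : ∀ z ∈ slitDom E p, ContDiffAt ℝ ∞ σ z) :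
    ∃ η : ∀ v : TM E M, TT v, IsVectorFieldOn ⊤ η (slit E M) ∧
      ∀ᶠ z' in 𝓝 z, loc p η z' = σ z' := by
  obtain ⟨φ, hφ, hφ1, hφs⟩ := exists_smoothBumpFunction_tsupport_subset (E := E) p (param p z).proj
    (param_mem_source p hz)
  refine ⟨fun v => φ v.proj • push p σ v, fun v hv => ?_, ?_⟩
  · refine ContMDiffAt.contMDiffWithinAt ?_
    by_cases h : v.proj ∈ (chartAt E p).source
    · exact (hφ.comp (Bundle.contMDiff_proj (IB := 𝓘(ℝ, E)) (TangentSpace 𝓘(ℝ, E))) v).smul_section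
        (contMDiffAt_push (k := ⊤) p h (hσ _ (coord_mem_slitDom p h hv)))
    · have h0 : ∀ᶠ u : TM E M in 𝓝 v, φ u.proj = 0 := by
        have h1 : ∀ᶠ q in 𝓝 v.proj, φ q = 0 :=
          notMem_tsupport_iff_eventuallyEq.1 fun h' => h (hφs h')
        exact ((FiberBundle.continuous_proj E (TangentSpace 𝓘(ℝ, E) : M → Type _)).continuousAt (x := v)).eventually h1
      refine (Bundle.contMDiff_zeroSection ℝ (TangentSpace 𝓘(ℝ, E).tangent) v).congr_of_eventuallyEq ?_
      filter_upwards [h0] with u hu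
      rw [hu, zero_smul]
      rfl
  · have h1 : ContinuousAt (fun z' => (param p z').proj) z :=
      ((FiberBundle.continuous_proj E (TangentSpace 𝓘(ℝ, E) : M → Type _)).continuousAt (x := param p z)).comp
        (contMDiffAt_param p hz).continuousAt
    filter_upwards [h1.eventually hφ1, (isOpen_dom p).mem_nhds hz] with z' h2 h3
    rw [loc_eq_iff p h3, h2, Pi.one_apply, one_smul, push_param p h3]

/-- Every vector field that is constant in a chart agrees near a given point with a vector field
on `M`. -/
theorem exists_isVectorField_eventuallyEq [T2Space M] (p : M) {x₀ : E}
    (hx₀ : x₀ ∈ (chartAt E p).target) (w : E) :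
    ∃ X : ∀ q : M, T E q, IsVectorField X ∧
      ∀ᶠ x in 𝓝 x₀, X ((chartAt E p).symm x) = dbase p x w := by
  have : CompleteSpace E := FiniteDimensional.complete ℝ E
  obtain ⟨φ, hφ, hφ1, hφs⟩ := exists_smoothBumpFunction_tsupport_subset (E := E) p
    ((chartAt E p).symm x₀) ((chartAt E p).map_target hx₀)
  refine ⟨φ • mpullback 𝓘(ℝ, E) 𝓘(ℝ, E) (extChartAt 𝓘(ℝ, E) p) (fun _ => w), ?_, ?_⟩
  · refine hφ.contMDiffOn.smul_section_of_tsupport (chartAt E p).open_source hφs fun q hq => ?_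
    refine ContMDiffAt.contMDiffWithinAt ?_
    have h1 : ContDiffAt ℝ ∞ (fun _ : E => w) (extChartAt 𝓘(ℝ, E) p q) := contDiffAt_const
    exact (contMDiffAt_vectorSpace_iff_contDiffAt.2 h1).mpullback_vectorField_preimage
      (contMDiffAt_extChartAt' (n := ∞) hq) (isInvertible_mfderiv_extChartAt (by simpa only [mfld_simps] using hq))
      (by exact_mod_cast le_top)
  · have h0 : ∀ᶠ x in 𝓝 x₀, φ ((chartAt E p).symm x) = 1 :=
      ((chartAt E p).continuousAt_symm hx₀).eventually hφ1
    filter_upwards [h0, (chartAt E p).open_target.mem_nhds hx₀] with x h2 h3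
    have h4 := mfderiv_extChartAt_comp_mfderivWithin_extChartAt_symm (I := 𝓘(ℝ, E))
      (x := p) (y := x) (by simpa only [mfld_simps] using h3)
    rw [ModelWithCorners.range_eq_univ, mfderivWithin_univ] at h4
    have h5 : mfderiv 𝓘(ℝ, E) 𝓘(ℝ, E) (extChartAt 𝓘(ℝ, E) p) ((chartAt E p).symm x) (dbase p x w) = w :=
      congrArg (fun L => L w) h4
    have h6 := isInvertible_mfderiv_extChartAt (I := 𝓘(ℝ, E)) (x := p) (y := (chartAt E p).symm x)
      (by simpa only [mfld_simps] using (chartAt E p).map_target h3)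
    rw [Pi.smul_apply']
    rw [h2, one_smul]
    refine h6.injective (Eq.trans ?_ h5.symm)
    exact h6.self_apply_inverse _

end LocalFields

/-! ### Finsler energies on an open set of a vector space -/

section Calculus
variable {E : Type*} [NormedAddCommGroup E] [NormedSpace ℝ E]

/-- Serves to differentiate identities that are known only on a single fibre `x = z.1`: these still
determine the vertical derivatives. -/
theorem fderiv_vertical_eq_of_eventuallyEq {G : Type*} [NormedAddCommGroup G] [NormedSpace ℝ G]
    {f : E × E → G} {g : E → G} {g' : E →L[ℝ] G} {z : E × E}
    (hf : DifferentiableAt ℝ f z) (hg : HasFDerivAt g g' z.2)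
    (h : ∀ᶠ y in 𝓝 z.2, f (z.1, y) = g y) (w : E) :
    fderiv ℝ f z (0, w) = g' w := by
  have h1 : HasFDerivAt (fun y => f (z.1, y))
      ((fderiv ℝ f z).comp (ContinuousLinearMap.inr ℝ E E)) z.2 :=
    HasFDerivAt.comp z.2 hf.hasFDerivAt (hasFDerivAt_prodMk_right z.1 z.2)
  have h2 := h1.unique (hg.congr_of_eventuallyEq h)
  exact congrArg (fun L => L w) h2

/-- The energy of a Finsler function in coordinates. -/
structure IsRegularEnergy (U : Set E) (e : E × E → ℝ) : Prop where
  isOpen : IsOpen U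
  contDiffAt : ∀ z : E × E, z.1 ∈ U → z.2 ≠ 0 → ContDiffAt ℝ ∞ e z
  homogeneous : ∀ z : E × E, z.1 ∈ U → ∀ t : ℝ, 0 < t → e (z.1, t • z.2) = t ^ 2 * e z
  nondegenerate : ∀ z : E × E, z.1 ∈ U → z.2 ≠ 0 → ∀ a : E,
    (∀ b : E, fderiv ℝ (fderiv ℝ e) z (0, a) (0, b) = 0) → a = 0

/-- The equation `i_ξ d d_J e = - de` at the point `z`. -/
def IsEulerLagrangeVector (e : E × E → ℝ) (z ξ : E × E) : Prop :=
  ∀ η : E × E, fderiv ℝ (fderiv ℝ e) z ξ (0, η.1) - fderiv ℝ (fderiv ℝ e) z η (0, ξ.1)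
    = - fderiv ℝ e z η

namespace IsRegularEnergy
variable {U : Set E} {e : E × E → ℝ} {z : E × E} (h : IsRegularEnergy U e)
  (hz : z.1 ∈ U) (hz0 : z.2 ≠ 0)

include h hz in
theorem eventually_fst_mem : ∀ᶠ z' : E × E in 𝓝 z, z'.1 ∈ U :=
  continuous_fst.continuousAt.eventually_mem (h.isOpen.mem_nhds hz)

include h hz hz0

theorem eventually_mem : ∀ᶠ z' : E × E in 𝓝 z, z'.1 ∈ U ∧ z'.2 ≠ 0 :=
  (h.eventually_fst_mem hz).and
    (continuous_snd.continuousAt.eventually_mem (isOpen_compl_singleton.mem_nhds hz0))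

theorem differentiableAt : DifferentiableAt ℝ e z :=
  (h.contDiffAt z hz hz0).differentiableAt (by simp)

theorem contDiffAt_fderiv : ContDiffAt ℝ ∞ (fderiv ℝ e) z :=
  (h.contDiffAt z hz hz0).fderiv_right (by exact_mod_cast le_top)

theorem contDiffAt_fderiv_fderiv : ContDiffAt ℝ ∞ (fderiv ℝ (fderiv ℝ e)) z :=
  (h.contDiffAt_fderiv hz hz0).fderiv_right (by exact_mod_cast le_top)

theorem hasFDerivAt_fderiv : HasFDerivAt (fderiv ℝ e) (fderiv ℝ (fderiv ℝ e) z) z :=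
  ((h.contDiffAt_fderiv hz hz0).differentiableAt (by simp)).hasFDerivAt

theorem fderiv_fderiv_symm (ζ η : E × E) :
    fderiv ℝ (fderiv ℝ e) z ζ η = fderiv ℝ (fderiv ℝ e) z η ζ :=
  (h.contDiffAt z hz hz0).isSymmSndFDerivAt (by
    simp only [minSmoothness_of_isRCLikeNormedField]
    exact WithTop.coe_le_coe.2 (le_top : (2 : ℕ∞) ≤ ⊤)) ζ η

/-- Euler's relation, from differentiating `e (x, t y) = t² e (x, y)` at `t = 1`. -/
theorem fderiv_vertical_self : fderiv ℝ e z (0, z.2) = 2 * e z := by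
  have h1 : HasDerivAt (fun t : ℝ => ((z.1, t • z.2) : E × E)) ((0, (1:ℝ) • z.2) : E × E) 1 :=
    (hasDerivAt_const (1 : ℝ) z.1).prodMk ((hasDerivAt_id (1 : ℝ)).smul_const z.2)
  have h2 : HasFDerivAt e (fderiv ℝ e z) ((fun t : ℝ => ((z.1, t • z.2) : E × E)) 1) := by
    simpa only [one_smul] using (h.differentiableAt hz hz0).hasFDerivAt
  have h3 := h2.comp_hasDerivAt (1 : ℝ) h1
  have h4 : HasDerivAt (fun t : ℝ => t ^ 2 * e z) ((2 * (1:ℝ)) * e z) 1 := by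
    simpa using (hasDerivAt_pow 2 (1:ℝ)).mul_const (e z)
  have h5 : e ∘ (fun t : ℝ => ((z.1, t • z.2) : E × E)) =ᶠ[𝓝 1] fun t : ℝ => t ^ 2 * e z := by
    filter_upwards [lt_mem_nhds (zero_lt_one' ℝ)] with t ht
    exact h.homogeneous z hz t ht
  have h6 := h3.unique (h4.congr_of_eventuallyEq h5)
  simpa using h6

/-- Derivative of Euler's relation along `η`; the last term appears because the direction `(0, z.2)`
varies with `z`. -/
theorem fderiv_fderiv_vertical_self (η : E × E) :
    fderiv ℝ (fderiv ℝ e) z η (0, z.2) = 2 * fderiv ℝ e z η - fderiv ℝ e z (0, η.2) := by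
  have h1 : HasFDerivAt (fun z : E × E => ((0, z.2) : E × E)) 
      ((0 : E × E →L[ℝ] E).prod (ContinuousLinearMap.snd ℝ E E)) z :=
    (hasFDerivAt_const (0 : E) z).prodMk hasFDerivAt_snd
  have h2 := (h.hasFDerivAt_fderiv hz hz0).clm_apply h1
  have h3 := (h.differentiableAt hz hz0).hasFDerivAt.const_mul 2
  have h4 : (fun z : E × E => fderiv ℝ e z (0, z.2)) =ᶠ[𝓝 z] fun z => 2 * e z := by
    filter_upwards [h.eventually_mem hz hz0] with z' hz'
    exact h.fderiv_vertical_self hz'.1 hz'.2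
  have h5 := congrArg (fun L => L η) (h2.unique (h3.congr_of_eventuallyEq h4))
  have h6 : fderiv ℝ e z (0, η.2) + fderiv ℝ (fderiv ℝ e) z η (0, z.2) = 2 * fderiv ℝ e z η := by
    simpa using h5
  linarith

/-- If `De` vanished at `z`, the differentiated Euler relation would put `z.2 ≠ 0` in the kernel of
the metric. This is what forces a Finsler function to be nonzero on nonzero vectors. -/
theorem fderiv_ne_zero : fderiv ℝ e z ≠ 0 := by
  intro h0
  refine hz0 (h.nondegenerate z hz hz0 z.2 fun b => ?_)
  rw [h.fderiv_fderiv_symm hz hz0, h.fderiv_fderiv_vertical_self hz hz0, h0]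
  simp

/-- Vertical test vectors `(0, b)` yield the second-order condition, by nondegeneracy; horizontal
ones `(w, 0)` yield the Euler-Lagrange equation. -/
theorem isEulerLagrangeVector_iff (ξ : E × E) :
    IsEulerLagrangeVector e z ξ ↔
      ξ.1 = z.2 ∧ ∀ w : E, fderiv ℝ (fderiv ℝ e) z ξ (0, w) = fderiv ℝ e z (w, 0) := by
  have key : ∀ η : E × E, fderiv ℝ e z η = fderiv ℝ e z (η.1, 0) + fderiv ℝ e z (0, η.2) := by
    intro η
    rw [← map_add]
    simp
  constructor
  · intro hξ
    have h1 : ξ.1 = z.2 := by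
      -- Both `D²e((0, b), (0, ξ.1))` and `D²e((0, b), (0, z.2))` equal `De(0, b)`: the first by
      -- hypothesis, the second by Euler's relation. Their difference says that `ξ.1 - z.2` is
      -- metrically orthogonal to every `b`.
      refine sub_eq_zero.1 (h.nondegenerate z hz hz0 _ fun b => ?_)
      have h2 := hξ (0, b)
      have h3 := h.fderiv_fderiv_vertical_self hz hz0 (0, b)
      have h4 : ((0, ξ.1 - z.2) : E × E) = (0, ξ.1) - (0, z.2) := by simp
      have h5 : fderiv ℝ (fderiv ℝ e) z ξ (0, ((0, b) : E × E).1) = 0 :=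
        map_zero (fderiv ℝ (fderiv ℝ e) z ξ)
      rw [h.fderiv_fderiv_symm hz hz0, h4, map_sub, h3]
      rw [h5] at h2
      simp only at h2 ⊢
      linarith
    refine ⟨h1, fun w => ?_⟩
    have h2 := hξ (w, 0)
    rw [h1, h.fderiv_fderiv_vertical_self hz hz0] at h2
    have h5 : fderiv ℝ e z (0, ((w, 0) : E × E).2) = 0 := map_zero (fderiv ℝ e z)
    rw [h5] at h2
    simp only at h2
    linarith
  · rintro ⟨h1, h2⟩ η
    rw [h1, h.fderiv_fderiv_vertical_self hz hz0, h2, key η]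
    ring

/-- Two solutions share the first component, so their difference is vertical and lies in the kernel
of the metric. -/
theorem isEulerLagrangeVector_unique {ξ ξ' : E × E} (hξ : IsEulerLagrangeVector e z ξ)
    (hξ' : IsEulerLagrangeVector e z ξ') : ξ = ξ' := by
  rw [h.isEulerLagrangeVector_iff hz hz0] at hξ hξ'
  refine Prod.ext (hξ.1.trans hξ'.1.symm) (sub_eq_zero.1 (h.nondegenerate z hz hz0 _ fun b => ?_))
  have h4 : ((0, ξ.2 - ξ'.2) : E × E) = ξ - ξ' := by
    refine Prod.ext ?_ rfl
    simp [hξ.1, hξ'.1]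
  rw [h4, map_sub, sub_apply, hξ.2, hξ'.2, sub_self]

omit hz hz0 in
/-- The energy is conserved along the horizontal directions of the spray that it determines. -/
theorem fderiv_horizontal_eq_zero {s : E × E → E} {x : E} (hx : x ∈ U)
    (hs : ∀ y : E, y ≠ 0 → DifferentiableAt ℝ s (x, y))
    (hEL : ∀ y : E, y ≠ 0 → IsEulerLagrangeVector e (x, y) (y, s (x, y)))
    {y : E} (hy : y ≠ 0) (w : E) :
    fderiv ℝ e (x, y) (w, (1 / 2 : ℝ) • fderiv ℝ s (x, y) (0, w)) = 0 := by
  -- Conservation of energy along the spray: the Euler-Lagrange equation at `w = y` and the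
  -- differentiated Euler relation compute the same number `D²e(S, (0, y))`.
  have h0 : ∀ y : E, y ≠ 0 → fderiv ℝ e (x, y) (y, s (x, y)) = 0 := by
    intro y hy
    have h1 := ((h.isEulerLagrangeVector_iff (z := (x, y)) hx hy _).1 (hEL y hy)).2 y
    have h2 := h.fderiv_fderiv_vertical_self (z := (x, y)) hx hy (y, s (x, y))
    have h3 : ((y, s (x, y)) : E × E) = (y, 0) + (0, s (x, y)) := by simp
    have h4 : fderiv ℝ e (x, y) (y, s (x, y)) = 
        fderiv ℝ e (x, y) (y, 0) + fderiv ℝ e (x, y) (0, s (x, y)) := by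
      rw [← map_add, ← h3]
    simp only at h2
    linarith
  have h1 : HasFDerivAt (fun z : E × E => ((z.2, s z) : E × E)) 
      ((ContinuousLinearMap.snd ℝ E E).prod (fderiv ℝ s (x, y))) (x, y) :=
    hasFDerivAt_snd.prodMk (hs y hy).hasFDerivAt
  have h2 := (h.hasFDerivAt_fderiv (z := (x, y)) hx hy).clm_apply h1
  have h3 := fderiv_vertical_eq_of_eventuallyEq h2.differentiableAt
    (hasFDerivAt_const (0 : ℝ) y) (by
      filter_upwards [isOpen_compl_singleton.mem_nhds hy] with y' hy'
      exact h0 y' hy') w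
  -- Vertical derivative along `w` of the conservation law `De(y, s) = 0`.
  have h4 : fderiv ℝ e (x, y) (w, fderiv ℝ s (x, y) (0, w))
      + fderiv ℝ (fderiv ℝ e) (x, y) (0, w) (y, s (x, y)) = 0 := by
    rw [h2.fderiv] at h3
    simpa using h3
  have h5 := ((h.isEulerLagrangeVector_iff (z := (x, y)) hx hy _).1 (hEL y hy)).2 w
  rw [h.fderiv_fderiv_symm (z := (x, y)) hx hy, h5, ← map_add] at h4
  have h6 : ((w, fderiv ℝ s (x, y) (0, w)) : E × E) + (w, 0) =
      (2 : ℝ) • (w, (1 / 2 : ℝ) • fderiv ℝ s (x, y) (0, w)) := by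
    refine Prod.ext ?_ ?_
    · simp [two_smul]
    · simp [smul_smul]
  rw [h6, map_smul] at h4
  simpa using h4

omit hz hz0 in
/-- A spray whose horizontal directions conserve the energy is determined by the energy. -/
theorem isEulerLagrangeVector_of_fderiv_horizontal_eq_zero {s : E × E → E} {x : E} (hx : x ∈ U)
    (hs : ∀ y : E, y ≠ 0 → DifferentiableAt ℝ s (x, y))
    (hs2 : ∀ y : E, y ≠ 0 → fderiv ℝ s (x, y) (0, y) = (2 : ℝ) • s (x, y))
    (hcons : ∀ y : E, y ≠ 0 → ∀ w : E,
      fderiv ℝ e (x, y) (w, (1 / 2 : ℝ) • fderiv ℝ s (x, y) (0, w)) = 0)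
    {y : E} (hy : y ≠ 0) : IsEulerLagrangeVector e (x, y) (y, s (x, y)) := by
  -- At `w = y` the horizontal vector is the spray itself, since `½ ∂_y s = s`.
  have h0 : ∀ y : E, y ≠ 0 → fderiv ℝ e (x, y) (y, s (x, y)) = 0 := by
    intro y hy
    have h1 := hcons y hy y
    rwa [hs2 y hy, smul_smul, one_div, inv_mul_cancel₀ two_ne_zero, one_smul] at h1
  refine (h.isEulerLagrangeVector_iff (z := (x, y)) hx hy _).2 ⟨rfl, fun w => ?_⟩
  have h1 : HasFDerivAt (fun z : E × E => ((z.2, s z) : E × E)) 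
      ((ContinuousLinearMap.snd ℝ E E).prod (fderiv ℝ s (x, y))) (x, y) :=
    hasFDerivAt_snd.prodMk (hs y hy).hasFDerivAt
  have h2 := (h.hasFDerivAt_fderiv (z := (x, y)) hx hy).clm_apply h1
  have h3 := fderiv_vertical_eq_of_eventuallyEq h2.differentiableAt
    (hasFDerivAt_const (0 : ℝ) y) (by
      filter_upwards [isOpen_compl_singleton.mem_nhds hy] with y' hy'
      exact h0 y' hy') w
  have h4 : fderiv ℝ e (x, y) (w, fderiv ℝ s (x, y) (0, w))
      + fderiv ℝ (fderiv ℝ e) (x, y) (0, w) (y, s (x, y)) = 0 := by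
    rw [h2.fderiv] at h3
    simpa using h3
  have h6 : ((w, fderiv ℝ s (x, y) (0, w)) : E × E) + (w, 0) =
      (2 : ℝ) • (w, (1 / 2 : ℝ) • fderiv ℝ s (x, y) (0, w)) := by
    refine Prod.ext ?_ ?_
    · simp [two_smul]
    · simp [smul_smul]
  -- The two arguments add up to twice a horizontal vector; combined with `h4` this turns the
  -- differentiated conservation law into the Euler-Lagrange equation.
  have h7 : fderiv ℝ e (x, y) (w, fderiv ℝ s (x, y) (0, w)) + fderiv ℝ e (x, y) (w, 0) = 0 := by
    rw [← map_add, h6, map_smul, hcons y hy w, smul_zero]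
  rw [h.fderiv_fderiv_symm (z := (x, y)) hx hy]
  linarith

end IsRegularEnergy

end Calculus

section Calculus
variable {E : Type*} [NormedAddCommGroup E] [NormedSpace ℝ E]

/-! ### Positively homogeneous maps of degree two -/

/-- The map `z ↦ (z.1, t z.2)`. -/
def fibreScale (t : ℝ) : (E × E) →L[ℝ] (E × E) :=
  (ContinuousLinearMap.fst ℝ E E).prod (t • ContinuousLinearMap.snd ℝ E E)

@[simp] theorem fibreScale_apply (t : ℝ) (z : E × E) : fibreScale t z = (z.1, t • z.2) := rfl

theorem fderiv_fibreScale {G : Type*} [NormedAddCommGroup G] [NormedSpace ℝ G] {f g : E × E → G}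
    {t : ℝ} {z : E × E} (hf : DifferentiableAt ℝ f (fibreScale t z))
    (h : ∀ᶠ z' in 𝓝 z, f (fibreScale t z') = g z') (ζ : E × E) :
    fderiv ℝ f (fibreScale t z) (fibreScale t ζ) = fderiv ℝ g z ζ := by
  have h1 : HasFDerivAt (f ∘ fibreScale t) ((fderiv ℝ f (fibreScale t z)).comp (fibreScale t)) z :=
    HasFDerivAt.comp z hf.hasFDerivAt (ContinuousLinearMap.hasFDerivAt (fibreScale (E := E) t))
  have h2 : g =ᶠ[𝓝 z] f ∘ fibreScale t := h.mono fun z' hz' => hz'.symm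
  rw [h2.fderiv_eq, h1.fderiv]
  rfl

/-- Euler's relation once more, for vector-valued maps and with points of the zero section allowed.
-/
theorem fderiv_vertical_of_homogeneous_two {G : Type*} [NormedAddCommGroup G] [NormedSpace ℝ G]
    {f : E × E → G} {z : E × E} (hf : DifferentiableAt ℝ f z)
    (h : ∀ t : ℝ, 0 < t → f (z.1, t • z.2) = t ^ 2 • f z) :
    fderiv ℝ f z (0, z.2) = (2 : ℝ) • f z := by
  have h1 : HasDerivAt (fun t : ℝ => ((z.1, t • z.2) : E × E)) ((0, (1:ℝ) • z.2) : E × E) 1 :=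
    (hasDerivAt_const (1 : ℝ) z.1).prodMk ((hasDerivAt_id (1 : ℝ)).smul_const z.2)
  have h2 : HasFDerivAt f (fderiv ℝ f z) ((fun t : ℝ => ((z.1, t • z.2) : E × E)) 1) := by
    simpa only [one_smul] using hf.hasFDerivAt
  have h3 := h2.comp_hasDerivAt (1 : ℝ) h1
  have h4 : HasDerivAt (fun t : ℝ => t ^ 2 • f z) ((2 * (1:ℝ)) • f z) 1 := by
    simpa using (hasDerivAt_pow 2 (1:ℝ)).smul_const (f z)
  have h5 : f ∘ (fun t : ℝ => ((z.1, t • z.2) : E × E)) =ᶠ[𝓝 1] fun t : ℝ => t ^ 2 • f z := by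
    filter_upwards [lt_mem_nhds (zero_lt_one' ℝ)] with t ht
    exact h t ht
  have h6 := h3.unique (h4.congr_of_eventuallyEq h5)
  simpa using h6

/-- A map that is positively homogeneous of degree two along the fibres and smooth off the zero
section is of class `C^1`. -/
theorem contDiffAt_one_of_homogeneous_two [FiniteDimensional ℝ E] {U : Set E} (hU : IsOpen U)
    {s : E × E → E}
    (hs : ∀ z : E × E, z.1 ∈ U → z.2 ≠ 0 → ContDiffAt ℝ 1 s z)
    (h0 : ∀ x ∈ U, s (x, 0) = 0)
    (h : ∀ z : E × E, z.1 ∈ U → z.2 ≠ 0 → ∀ t : ℝ, 0 < t → s (z.1, t • z.2) = t ^ 2 • s z)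
    {z : E × E} (hz : z.1 ∈ U) : ContDiffAt ℝ 1 s z := by
  by_cases hz0 : z.2 ≠ 0
  · exact hs z hz hz0
  push Not at hz0
  obtain ⟨x, y⟩ := z
  simp only at hz hz0
  subst hz0
  obtain ⟨r, hr, hrU⟩ := Metric.nhds_basis_closedBall.mem_iff.1 (hU.mem_nhds hz)
  -- Homogeneity reduces all estimates near `(x, 0)` to unit vectors over a small closed ball, a
  -- compact set in finite dimension on which `s` and its derivative are bounded.
  set K : Set (E × E) := Metric.closedBall x r ×ˢ Metric.sphere (0 : E) 1 with hK
  have hKc : IsCompact K := (isCompact_closedBall x r).prod (isCompact_sphere 0 1)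
  have hKU : ∀ z ∈ K, z.1 ∈ U ∧ z.2 ≠ 0 := by
    rintro z ⟨h1, h2⟩
    refine ⟨hrU h1, fun h3 => ?_⟩
    rw [h3] at h2
    simp at h2
  obtain ⟨C₁, hC₁⟩ := hKc.exists_bound_of_continuousOn (f := s) fun z hz =>
    (hs z (hKU z hz).1 (hKU z hz).2).continuousAt.continuousWithinAt
  obtain ⟨C₂, hC₂⟩ := hKc.exists_bound_of_continuousOn (f := fderiv ℝ s) fun z hz =>
    ((hs z (hKU z hz).1 (hKU z hz).2).fderiv_right (m := 0) (by simp)).continuousAt.continuousWithinAt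
  set C := max (max C₁ C₂) 0 with hC
  have hC0 : 0 ≤ C := le_max_right _ _
  have unit : ∀ z : E × E, z.1 ∈ Metric.closedBall x r → z.2 ≠ 0 →
      ((z.1, ‖z.2‖⁻¹ • z.2) : E × E) ∈ K := by
    intro z h1 h2
    refine ⟨h1, ?_⟩
    simp [norm_smul, h2]
  have resc : ∀ z : E × E, z.2 ≠ 0 → fibreScale ‖z.2‖ ((z.1, ‖z.2‖⁻¹ • z.2) : E × E) = z := by
    intro z h2
    refine Prod.ext rfl ?_
    simp [smul_smul, h2]
  have bound₁ : ∀ z : E × E, z.1 ∈ Metric.closedBall x r → ‖s z‖ ≤ C * ‖z.2‖ ^ 2 := by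
    intro z h1
    by_cases h2 : z.2 = 0
    · have h3 : z = (z.1, 0) := Prod.ext rfl h2
      have : s z = 0 := by
        rw [h3]
        exact h0 z.1 (hrU h1)
      rw [this, norm_zero]
      positivity
    · have hk := unit z h1 h2
      have h3 := h _ (hKU _ hk).1 (hKU _ hk).2 ‖z.2‖ (norm_pos_iff.2 h2)
      have h4 := resc z h2
      rw [fibreScale_apply] at h4
      rw [h4] at h3
      rw [h3, norm_smul, norm_pow, norm_norm, mul_comm]
      exact mul_le_mul_of_nonneg_right ((hC₁ _ hk).trans ((le_max_left _ _).trans (le_max_left _ _)))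
        (by positivity)
  -- Base derivatives of `s` scale like `‖y‖²` and fibre derivatives like `‖y‖`; the restriction
  -- `‖y‖ ≤ 1` makes `‖y‖` dominate both.
  have bound₂ : ∀ z : E × E, z.1 ∈ Metric.closedBall x r → z.2 ≠ 0 → ‖z.2‖ ≤ 1 →
      ‖fderiv ℝ s z‖ ≤ C * ‖z.2‖ := by
    intro z h1 h2 h3
    have hk := unit z h1 h2
    have hp : 0 < ‖z.2‖ := norm_pos_iff.2 h2
    refine ContinuousLinearMap.opNorm_le_bound _ (by positivity) fun ζ => ?_
    have hd : DifferentiableAt ℝ s (fibreScale ‖z.2‖ ((z.1, ‖z.2‖⁻¹ • z.2) : E × E)) := by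
      rw [resc z h2]
      exact (hs z (hrU h1) h2).differentiableAt (by simp)
    have hev : ∀ᶠ z' in 𝓝 ((z.1, ‖z.2‖⁻¹ • z.2) : E × E),
        s (fibreScale ‖z.2‖ z') = ‖z.2‖ ^ 2 • s z' := by
      have e1 : ∀ᶠ z' : E × E in 𝓝 ((z.1, ‖z.2‖⁻¹ • z.2) : E × E), z'.1 ∈ U :=
        continuous_fst.continuousAt.eventually_mem (hU.mem_nhds (hKU _ hk).1)
      have e2 : ∀ᶠ z' : E × E in 𝓝 ((z.1, ‖z.2‖⁻¹ • z.2) : E × E), z'.2 ∈ ({0}ᶜ : Set E) :=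
        continuous_snd.continuousAt.eventually_mem (isOpen_compl_singleton.mem_nhds (hKU _ hk).2)
      filter_upwards [e1, e2] with z' h4 h5
      exact h z' h4 h5 _ hp
    have h4 := fderiv_fibreScale hd hev ((ζ.1, ‖z.2‖⁻¹ • ζ.2) : E × E)
    have h5 : fibreScale ‖z.2‖ ((ζ.1, ‖z.2‖⁻¹ • ζ.2) : E × E) = ζ := by
      refine Prod.ext rfl ?_
      simp [smul_smul, h2]
    rw [h5, resc z h2, fderiv_fun_const_smul ((hs _ (hKU _ hk).1 (hKU _ hk).2).differentiableAt (by simp))]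
      at h4
    rw [h4, smul_apply, norm_smul, norm_pow, norm_norm]
    have h6 : ‖((ζ.1, ‖z.2‖⁻¹ • ζ.2) : E × E)‖ ≤ ‖z.2‖⁻¹ * ‖ζ‖ := by
      rw [Prod.norm_def]
      refine max_le ?_ ?_
      · have : 1 ≤ ‖z.2‖⁻¹ := (one_le_inv₀ hp).2 h3
        calc ‖ζ.1‖ ≤ ‖ζ‖ := norm_fst_le ζ
          _ = 1 * ‖ζ‖ := (one_mul _).symm
          _ ≤ _ := mul_le_mul_of_nonneg_right this (norm_nonneg _)
      · rw [norm_smul, norm_inv, norm_norm]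
        exact mul_le_mul_of_nonneg_left (norm_snd_le ζ) (by positivity)
    have h7 : ‖fderiv ℝ s ((z.1, ‖z.2‖⁻¹ • z.2) : E × E)‖ ≤ C :=
      (hC₂ _ hk).trans ((le_max_right _ _).trans (le_max_left _ _))
    calc ‖z.2‖ ^ 2 * ‖fderiv ℝ s ((z.1, ‖z.2‖⁻¹ • z.2) : E × E) ((ζ.1, ‖z.2‖⁻¹ • ζ.2) : E × E)‖
        ≤ ‖z.2‖ ^ 2 * (C * (‖z.2‖⁻¹ * ‖ζ‖)) := by
          refine mul_le_mul_of_nonneg_left ?_ (by positivity)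
          exact (ContinuousLinearMap.le_opNorm _ _).trans
            (mul_le_mul h7 h6 (norm_nonneg _) hC0)
      _ = C * ‖z.2‖ * ‖ζ‖ := by
          field_simp
  have hball : ∀ x' ∈ Metric.ball x r, Metric.closedBall x r ∈ 𝓝 x' := fun x' hx' =>
    Filter.mem_of_superset (Metric.isOpen_ball.mem_nhds hx') Metric.ball_subset_closedBall
  -- The quadratic bound on `s` makes its derivative vanish along the zero section.
  have hder0 : ∀ x' ∈ Metric.ball x r, HasFDerivAt s (0 : (E × E) →L[ℝ] E) (x', 0) := by
    intro x' hx'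
    rw [hasFDerivAt_iff_isLittleO_nhds_zero]
    have hO : (fun ζ : E × E => s ((x', 0) + ζ) - s (x', 0) - (0 : (E × E) →L[ℝ] E) ζ) =O[𝓝 0]
        fun ζ : E × E => ‖ζ‖ ^ 2 := by
      refine Asymptotics.IsBigO.of_bound C ?_
      have e1 : ∀ᶠ ζ : E × E in 𝓝 0, x' + ζ.1 ∈ Metric.closedBall x r := by
        have : ContinuousAt (fun ζ : E × E => x' + ζ.1) 0 := by fun_prop
        exact this.eventually_mem (by simpa using hball x' hx')
      filter_upwards [e1] with ζ h1
      have h2 := bound₁ ((x', 0) + ζ) h1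
      rw [h0 x' (hrU (Metric.ball_subset_closedBall hx')), sub_zero, zero_apply,
        sub_zero]
      refine h2.trans ?_
      rw [norm_pow, norm_norm]
      refine mul_le_mul_of_nonneg_left ?_ hC0
      have : ((x', 0) + ζ : E × E).2 = ζ.2 := by simp
      rw [this]
      exact pow_le_pow_left₀ (norm_nonneg _) (norm_snd_le ζ) 2
    refine hO.trans_isLittleO ?_
    have := (Asymptotics.isLittleO_norm_pow_id (E' := E × E) one_lt_two)
    exact this
  have hdiff : ∀ z' : E × E, z'.1 ∈ Metric.ball x r → DifferentiableAt ℝ s z' := by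
    intro z' hz'
    by_cases h2 : z'.2 = 0
    · have h3 : z' = (z'.1, 0) := Prod.ext rfl h2
      rw [h3]
      exact (hder0 z'.1 hz').differentiableAt
    · exact (hs z' (hrU (Metric.ball_subset_closedBall hz')) h2).differentiableAt (by simp)
  have hnorm : ∀ z' : E × E, z'.1 ∈ Metric.ball x r → ‖z'.2‖ ≤ 1 →
      ‖fderiv ℝ s z'‖ ≤ C * ‖z'.2‖ := by
    intro z' hz' h1
    by_cases h2 : z'.2 = 0
    · have h3 : z' = (z'.1, 0) := Prod.ext rfl h2
      rw [h3, (hder0 z'.1 hz').fderiv]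
      simp
    · exact bound₂ z' (Metric.ball_subset_closedBall hz') h2 h1
  have hopen : IsOpen {z' : E × E | z'.1 ∈ Metric.ball x r} :=
    Metric.isOpen_ball.preimage continuous_fst
  -- On the zero section, continuity of the derivative is the squeeze `‖Ds‖ ≤ C ‖y‖ → 0`.
  have hcont : ContinuousOn (fderiv ℝ s) {z' : E × E | z'.1 ∈ Metric.ball x r} := by
    intro z' hz'
    refine ContinuousAt.continuousWithinAt ?_
    by_cases h2 : z'.2 = 0
    · have h3 : z' = (z'.1, 0) := Prod.ext rfl h2
      have h4 : fderiv ℝ s z' = 0 := by rw [h3, (hder0 z'.1 hz').fderiv]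
      rw [ContinuousAt, h4, tendsto_zero_iff_norm_tendsto_zero]
      have e1 : ∀ᶠ ζ : E × E in 𝓝 z', ‖fderiv ℝ s ζ‖ ≤ C * ‖ζ.2‖ := by
        have e2 : ∀ᶠ ζ : E × E in 𝓝 z', ‖ζ.2‖ < 1 := by
          have : ContinuousAt (fun ζ : E × E => ‖ζ.2‖) z' := by fun_prop
          exact this.eventually_lt_const (by simp [h2])
        filter_upwards [hopen.mem_nhds hz', e2] with ζ h5 h6
        exact hnorm ζ h5 h6.le
      have e3 : Filter.Tendsto (fun ζ : E × E => C * ‖ζ.2‖) (𝓝 z') (𝓝 0) := by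
        have : ContinuousAt (fun ζ : E × E => C * ‖ζ.2‖) z' := by fun_prop
        have h7 := this.tendsto
        rwa [h2, norm_zero, mul_zero] at h7
      exact squeeze_zero' (Filter.Eventually.of_forall fun _ => norm_nonneg _) e1 e3
    · exact ((hs z' (hrU (Metric.ball_subset_closedBall hz')) h2).fderiv_right (m := 0)
        (by simp)).continuousAt
  have hfin : ContDiffOn ℝ 1 s {z' : E × E | z'.1 ∈ Metric.ball x r} := by
    have h1 : (1 : WithTop ℕ∞) = 0 + 1 := (zero_add 1).symm
    rw [h1, contDiffOn_succ_iff_fderiv_of_isOpen hopen]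
    refine ⟨fun z' hz' => (hdiff z' hz').differentiableWithinAt, by simp, ?_⟩
    exact contDiffOn_zero.2 hcont
  exact hfin.contDiffAt (hopen.mem_nhds (Metric.mem_ball_self hr))

/-! ### The spray coefficients of an energy -/

/-- The metric tensor of an energy. -/
def metric (e : E × E → ℝ) (z : E × E) : E →L[ℝ] E →L[ℝ] ℝ :=
  ((ContinuousLinearMap.compL ℝ E (E × E) ℝ).flip (ContinuousLinearMap.inr ℝ E E)).comp
    ((fderiv ℝ (fderiv ℝ e) z).comp (ContinuousLinearMap.inr ℝ E E))

/-- The 1-form on the fibre that is dual to the spray coefficients. -/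
def sprayForm (e : E × E → ℝ) (z : E × E) : E →L[ℝ] ℝ :=
  (fderiv ℝ e z).comp (ContinuousLinearMap.inl ℝ E E)
    - (fderiv ℝ (fderiv ℝ e) z (z.2, 0)).comp (ContinuousLinearMap.inr ℝ E E)

open Classical in
/-- The vertical component of the canonical spray of an energy. -/
def sprayCoeff (e : E × E → ℝ) (z : E × E) : E :=
  if z.2 = 0 then 0 else (metric e z).inverse (sprayForm e z)

@[simp] theorem metric_apply (e : E × E → ℝ) (z : E × E) (a b : E) :
    metric e z a b = fderiv ℝ (fderiv ℝ e) z (0, a) (0, b) := rfl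

@[simp] theorem sprayForm_apply (e : E × E → ℝ) (z : E × E) (w : E) :
    sprayForm e z w = fderiv ℝ e z (w, 0) - fderiv ℝ (fderiv ℝ e) z (z.2, 0) (0, w) := rfl

@[simp] theorem sprayCoeff_zero (e : E × E → ℝ) (x : E) : sprayCoeff e (x, 0) = 0 := if_pos rfl

namespace IsRegularEnergy
variable [FiniteDimensional ℝ E] {U : Set E} {e : E × E → ℝ} {z : E × E} (h : IsRegularEnergy U e)
  (hz : z.1 ∈ U) (hz0 : z.2 ≠ 0)
include h hz hz0

/-- Nondegeneracy gives only injectivity; equality of the dimensions of `E` and its dual makes it an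
isomorphism, so `inverse` in `sprayCoeff` is a genuine inverse. -/
theorem exists_metric_equiv : ∃ L : E ≃L[ℝ] (E →L[ℝ] ℝ), (L : E →L[ℝ] E →L[ℝ] ℝ) = metric e z := by
  have hinj : Function.Injective ((metric e z : E →L[ℝ] E →L[ℝ] ℝ) : E →ₗ[ℝ] E →L[ℝ] ℝ) := by
    refine (injective_iff_map_eq_zero _).2 fun a ha => h.nondegenerate z hz hz0 a fun b => ?_
    exact congrArg (fun L : E →L[ℝ] ℝ => L b) ha
  have hfr : Module.finrank ℝ E = Module.finrank ℝ (E →L[ℝ] ℝ) := by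
    rw [← (LinearMap.toContinuousLinearMap (𝕜 := ℝ) (E := E) (F' := ℝ)).finrank_eq]
    exact (Subspace.dual_finrank_eq (K := ℝ) (V := E)).symm
  refine ⟨(LinearEquiv.ofInjectiveOfFinrankEq _ hinj hfr).toContinuousLinearEquiv, ?_⟩
  ext a b
  rfl

theorem isEulerLagrangeVector_sprayCoeff : IsEulerLagrangeVector e z (z.2, sprayCoeff e z) := by
  refine (h.isEulerLagrangeVector_iff hz hz0 _).2 ⟨rfl, fun w => ?_⟩
  obtain ⟨L, hL⟩ := h.exists_metric_equiv hz hz0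
  have h1 : metric e z (sprayCoeff e z) = sprayForm e z := by
    rw [sprayCoeff, if_neg hz0, ← hL, ContinuousLinearMap.inverse_equiv]
    exact L.apply_symm_apply _
  have h2 := congrArg (fun L : E →L[ℝ] ℝ => L w) h1
  simp only [metric_apply, sprayForm_apply] at h2
  have h3 : ((z.2, sprayCoeff e z) : E × E) = (z.2, 0) + (0, sprayCoeff e z) := by simp
  rw [h3, map_add, add_apply, h2]
  ring

/-- Inversion is smooth near an invertible operator, and the metric and `sprayForm` are smooth off
the zero section. -/
theorem contDiffAt_sprayCoeff : ContDiffAt ℝ ∞ (sprayCoeff e) z := by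
  obtain ⟨L, hL⟩ := h.exists_metric_equiv hz hz0
  have : CompleteSpace E := FiniteDimensional.complete ℝ E
  have h0 : ContDiffAt ℝ ∞ (fun z' => (metric e z').inverse (sprayForm e z')) z := by
    have h1 : ContDiffAt ℝ ∞ (metric e) z :=
      contDiffAt_const.clm_comp ((h.contDiffAt_fderiv_fderiv hz hz0).clm_comp contDiffAt_const)
    have h2 : ContDiffAt ℝ ∞ (fun z' => (metric e z').inverse) z := by
      refine ContDiffAt.comp z (g := ContinuousLinearMap.inverse) ?_ h1
      rw [← hL]
      exact contDiffAt_map_inverse L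
    have h3 : ContDiffAt ℝ ∞ (sprayForm e) z :=
      ((h.contDiffAt_fderiv hz hz0).clm_comp contDiffAt_const).sub
        (((h.contDiffAt_fderiv_fderiv hz hz0).clm_apply
          (contDiffAt_snd.prodMk contDiffAt_const)).clm_comp contDiffAt_const)
    exact h2.clm_apply h3
  refine h0.congr_of_eventuallyEq ?_
  filter_upwards [h.eventually_mem hz hz0] with z' hz'
  rw [sprayCoeff, if_neg hz'.2]

omit hz hz0 in
-- By uniqueness it suffices that `(t y, t² s)` solves the Euler-Lagrange equation at `(x, t y)`.
theorem sprayCoeff_smul {z : E × E} (hz : z.1 ∈ U) (hz0 : z.2 ≠ 0) (t : ℝ) (ht : 0 < t) :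
    sprayCoeff e (z.1, t • z.2) = t ^ 2 • sprayCoeff e z := by
  have htz : (fibreScale t z).2 ≠ 0 := smul_ne_zero ht.ne' hz0
  have d1 : ∀ z : E × E, z.1 ∈ U → z.2 ≠ 0 → ∀ ζ,
      fderiv ℝ e (fibreScale t z) (fibreScale t ζ) = t ^ 2 * fderiv ℝ e z ζ := by
    intro z hz hz0 ζ
    have htz : (fibreScale t z).2 ≠ 0 := smul_ne_zero ht.ne' hz0
    rw [fderiv_fibreScale (g := fun z' => t ^ 2 * e z') (h.differentiableAt (z := fibreScale t z) hz htz),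
      fderiv_const_mul (h.differentiableAt hz hz0)]
    · rfl
    · filter_upwards [h.eventually_fst_mem hz] with z' hz'
      exact h.homogeneous z' hz' t ht
  have d2 : ∀ ζ η, fderiv ℝ (fderiv ℝ e) (fibreScale t z) (fibreScale t ζ) (fibreScale t η) =
      t ^ 2 * fderiv ℝ (fderiv ℝ e) z ζ η := by
    intro ζ η
    have a1 : HasFDerivAt (fun z' => fderiv ℝ e z' (fibreScale t η)) _ (fibreScale t z) :=
      (h.hasFDerivAt_fderiv (z := fibreScale t z) hz htz).clm_apply (hasFDerivAt_const _ _)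
    have a2 : HasFDerivAt (fun z' => fderiv ℝ e z' η) _ z :=
      (h.hasFDerivAt_fderiv hz hz0).clm_apply (hasFDerivAt_const _ _)
    have a3 := fderiv_fibreScale (t := t) (z := z) (g := fun z' => t ^ 2 * fderiv ℝ e z' η)
      a1.differentiableAt (by
        filter_upwards [h.eventually_mem hz hz0] with z' hz'
        exact d1 z' hz'.1 hz'.2 η) ζ
    rw [fderiv_const_mul a2.differentiableAt, a1.fderiv, smul_apply, a2.fderiv] at a3
    simpa using a3
  have key : IsEulerLagrangeVector e (fibreScale t z) (t • z.2, t ^ 2 • sprayCoeff e z) := by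
    refine (h.isEulerLagrangeVector_iff (z := fibreScale t z) hz htz _).2 ⟨rfl, fun w => ?_⟩
    -- The candidate is `t` times the image of the solution at `z` under the scaling, so `d1` and
    -- `d2` transport the equation from `z`.
    have b1 : ((t • z.2, t ^ 2 • sprayCoeff e z) : E × E) =
        t • fibreScale t (z.2, sprayCoeff e z) := by
      refine Prod.ext rfl ?_
      simp [smul_smul, pow_two]
    have b2 : ((0, w) : E × E) = fibreScale t (0, t⁻¹ • w) := by
      refine Prod.ext rfl ?_
      simp [smul_smul, ht.ne']
    have b3 : ((w, 0) : E × E) = fibreScale t (w, 0) := by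
      refine Prod.ext rfl ?_
      simp
    have b4 := ((h.isEulerLagrangeVector_iff hz hz0 _).1
      (h.isEulerLagrangeVector_sprayCoeff hz hz0)).2 (t⁻¹ • w)
    have b5 : ((t⁻¹ • w, 0) : E × E) = t⁻¹ • ((w, 0) : E × E) := by simp
    rw [b1, b2, map_smul, smul_apply, d2, b4, b3, d1 z hz hz0, b5, map_smul]
    simp only [smul_eq_mul]
    field_simp
  have := h.isEulerLagrangeVector_unique (z := fibreScale t z) hz htz
    (h.isEulerLagrangeVector_sprayCoeff (z := fibreScale t z) hz htz) key
  exact congrArg Prod.snd this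

omit hz hz0 in
theorem contDiffAt_one_sprayCoeff {z : E × E} (hz : z.1 ∈ U) : ContDiffAt ℝ 1 (sprayCoeff e) z :=
  contDiffAt_one_of_homogeneous_two h.isOpen
    (fun z hz hz0 => (h.contDiffAt_sprayCoeff hz hz0).of_le (by exact_mod_cast le_top))
    (fun x _ => sprayCoeff_zero e x) (fun z hz hz0 t ht => h.sprayCoeff_smul hz hz0 t ht) hz

omit hz hz0 in
theorem fderiv_sprayCoeff_vertical_self {z : E × E} (hz : z.1 ∈ U) :
    fderiv ℝ (sprayCoeff e) z (0, z.2) = (2 : ℝ) • sprayCoeff e z := by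
  refine fderiv_vertical_of_homogeneous_two
    ((h.contDiffAt_one_sprayCoeff hz).differentiableAt (by simp)) fun t ht => ?_
  by_cases hz0 : z.2 = 0
  · have h1 : z = (z.1, 0) := Prod.ext rfl hz0
    rw [hz0, smul_zero, h1, sprayCoeff_zero, smul_zero]
  · exact h.sprayCoeff_smul hz hz0 t ht

end IsRegularEnergy
end Calculus

section FinslerCoordinates

variable {E : Type*} [NormedAddCommGroup E] [NormedSpace ℝ E] [FiniteDimensional ℝ E]
  {M : Type*} [TopologicalSpace M] [ChartedSpace E M] [IsManifold 𝓘(ℝ, E) ∞ M]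

/-! ### Finsler functions in coordinates -/

theorem dirDeriv_param (p : M) {z : E × E} (hz : z ∈ dom E p) {f : TM E M → ℝ}
    (hf : DifferentiableAt ℝ (f ∘ param p) z) (ξ : ∀ v : TM E M, TT v) :
    dirDeriv f (param p z) (ξ (param p z)) = fderiv ℝ (f ∘ param p) z (loc p ξ z) := by
  rw [← dparam_loc p hz ξ]
  refine dirDeriv_dparam p hz ?_ _
  have h1 : DifferentiableAt ℝ (f ∘ param p) (coord p (param p z)) := by rwa [coord_param p hz]
  have h2 := h1.mdifferentiableAt.comp (param p z)
    ((contMDiffAt_coord p (param_mem_source p hz)).mdifferentiableAt (by simp))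
  refine h2.congr_of_eventuallyEq ?_
  filter_upwards [source_mem_nhds p (param_mem_source p hz)] with u hu
  simp only [Function.comp_apply, param_coord p hu]

theorem dirDeriv_param_vector (p : M) {z : E × E} (hz : z ∈ dom E p) {f : TM E M → ℝ}
    (hf : DifferentiableAt ℝ (f ∘ param p) z) (ζ : E × E) :
    dirDeriv f (param p z) (dparam p z ζ) = fderiv ℝ (f ∘ param p) z ζ := by
  have h := dirDeriv_param p hz hf (push p fun _ => ζ)
  rwa [push_param p hz, loc_push p hz] at h

theorem param_smul (p : M) {z : E × E} (hz : z ∈ dom E p) (t : ℝ) :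
    param p (z.1, t • z.2) = ⟨(param p z).proj, t • (param p z).2⟩ := by
  rw [param_eq p hz, param_eq p (z := (z.1, t • z.2)) hz]
  exact congrArg (fun a : E => (⟨(chartAt E p).symm z.1, a⟩ : TM E M)) ((dbase p z.1).map_smul t z.2)

namespace IsFinslerFunction
variable {F : TM E M → ℝ} (hF : IsFinslerFunction F)
include hF

theorem contDiffAt_param (p : M) {z : E × E} (hz : z ∈ slitDom E p) :
    ContDiffAt ℝ ∞ (F ∘ param p) z :=
  ((hF.smooth.contMDiffAt (isOpen_slit.mem_nhds ((param_mem_slit_iff p hz.1).2 hz.2))).comp z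
    (contMDiffAt_param p hz.1)).contDiffAt

theorem contDiffAt_energy_param (p : M) {z : E × E} (hz : z ∈ slitDom E p) :
    ContDiffAt ℝ ∞ (energy F ∘ param p) z :=
  ((hF.contDiffAt_param p hz).pow 2).div_const 2

/-- `param p` is linear on fibres, so iterated line derivatives along a fibre are second derivatives
in the `y` variable. -/
theorem metricTensor_param (p : M) {z : E × E} (hz : z ∈ slitDom E p) (a b : E) :
    metricTensor F (param p z) (dbase p z.1 a) (dbase p z.1 b) =
      fderiv ℝ (fderiv ℝ (energy F ∘ param p)) z (0, a) (0, b) := by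
  set e := energy F ∘ param p with he
  have hline : ∀ (y c : E), HasDerivAt (fun t : ℝ => ((z.1, y + t • c) : E × E)) (0, c) 0 := by
    intro y c
    have h4 := (hasDerivAt_const (0 : ℝ) z.1).prodMk
      (((hasDerivAt_id (0 : ℝ)).smul_const c).const_add y)
    rwa [one_smul] at h4
  have hE : ∀ y : E, energy F ⟨(param p z).proj, dbase p z.1 y⟩ = e (z.1, y) := by
    intro y
    have := param_eq p (z := (z.1, y)) hz.1
    rw [he, Function.comp_apply, this]
    rfl
  have h1 : ∀ y : E, y ≠ 0 → lineDeriv ℝ (fun u' : T E (param p z).proj =>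
      energy F ⟨(param p z).proj, u'⟩) (dbase p z.1 y) (dbase p z.1 b) = fderiv ℝ e (z.1, y) (0, b) := by
    intro y hy
    have hd : HasFDerivAt e (fderiv ℝ e (z.1, y)) ((fun t : ℝ => ((z.1, y + t • b) : E × E)) 0) := by
      simpa only [zero_smul, add_zero] using ((hF.contDiffAt_energy_param p
        (z := (z.1, y)) ⟨hz.1, hy⟩).differentiableAt (by simp)).hasFDerivAt
    have h2 := (hd.comp_hasDerivAt (0 : ℝ) (hline y b)).deriv
    rw [← h2]
    refine congrArg (fun f => deriv f (0 : ℝ)) (funext fun t => ?_)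
    rw [Function.comp_apply, ← hE, map_add, map_smul]
    rfl
  have hd : HasFDerivAt (fun z' => fderiv ℝ e z' (0, b))
      ((fderiv ℝ e z).comp (0 : E × E →L[ℝ] E × E) + (fderiv ℝ (fderiv ℝ e) z).flip (0, b))
      ((fun t : ℝ => ((z.1, z.2 + t • a) : E × E)) 0) := by
    have h3 : HasFDerivAt (fderiv ℝ e) (fderiv ℝ (fderiv ℝ e) z) z :=
      (((hF.contDiffAt_energy_param p hz).fderiv_right (m := ∞)
        (by exact_mod_cast le_top)).differentiableAt (by simp)).hasFDerivAt
    simpa only [zero_smul, add_zero] using h3.clm_apply (hasFDerivAt_const ((0, b) : E × E) z)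
  have h4 := (hd.comp_hasDerivAt (0 : ℝ) (hline z.2 a)).deriv
  -- The inner derivative is computed only away from the zero section, which suffices because the
  -- outer one is local at `t = 0`.
  have h5 : ∀ᶠ t : ℝ in 𝓝 0, z.2 + t • a ≠ 0 := by
    have : ContinuousAt (fun t : ℝ => z.2 + t • a) 0 := by fun_prop
    exact this.eventually_mem (isOpen_compl_singleton.mem_nhds (by simpa using hz.2))
  have h6 : (fun t : ℝ => lineDeriv ℝ (fun u' : T E (param p z).proj =>
      energy F ⟨(param p z).proj, u'⟩) ((param p z).2 + t • (show T E (param p z).proj from dbase p z.1 a))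
        (dbase p z.1 b)) =ᶠ[𝓝 0] fun t => fderiv ℝ e (z.1, z.2 + t • a) (0, b) := by
    filter_upwards [h5] with t ht
    rw [← h1 _ ht, map_add, map_smul]
    have h7 : ((param p z).2 : E) = dbase p z.1 z.2 :=
      congrArg (fun v : TM E M => (v.2 : E)) (param_eq p hz.1)
    exact congrArg (fun c : T E (param p z).proj => lineDeriv ℝ (fun u' : T E (param p z).proj =>
      energy F ⟨(param p z).proj, u'⟩) (c + t • (show T E (param p z).proj from dbase p z.1 a)) (dbase p z.1 b)) h7
  refine (h6.deriv_eq.trans h4).trans ?_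
  simp

theorem isRegularEnergy (p : M) : IsRegularEnergy (chartAt E p).target (energy F ∘ param p) where
  isOpen := (chartAt E p).open_target
  contDiffAt z hz hz0 := hF.contDiffAt_energy_param p ⟨hz, hz0⟩
  homogeneous z hz t ht := by
    simp only [Function.comp_apply, energy]
    rw [param_smul p hz, hF.homogeneous t _ ht.le]
    ring
  nondegenerate z hz hz0 a h := by
    refine (dbase_isInvertible p hz).injective (Eq.trans ?_ (map_zero _).symm)
    refine hF.nondegenerate (param p z) ((param_mem_slit_iff p hz).2 hz0) _ fun w₂ => ?_
    obtain ⟨b, rfl⟩ := (dbase_isInvertible p hz).surjective w₂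
    exact (hF.metricTensor_param p ⟨hz, hz0⟩ a b).trans (h b)

theorem fderiv_energy_param (p : M) {z : E × E} (hz : z ∈ slitDom E p) (ζ : E × E) :
    fderiv ℝ (energy F ∘ param p) z ζ = F (param p z) * fderiv ℝ (F ∘ param p) z ζ := by
  have h1 := ((((hF.contDiffAt_param p hz).differentiableAt (by simp)).hasFDerivAt.pow 2).mul_const
    ((2 : ℝ)⁻¹))
  have h2 : energy F ∘ param p = fun z => (F ∘ param p) z ^ 2 * 2⁻¹ := rfl
  rw [h2, h1.fderiv]
  simp only [Nat.cast_ofNat, smul_apply, smul_eq_mul, Function.comp_apply, nsmul_eq_mul]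
  ring

/-- At a zero of `F` the identity `de = F dF` would give `de = 0`, contrary to `fderiv_ne_zero`. -/
theorem apply_param_ne_zero (p : M) {z : E × E} (hz : z ∈ slitDom E p) : F (param p z) ≠ 0 := by
  intro h0
  refine (hF.isRegularEnergy p).fderiv_ne_zero hz.1 hz.2 ?_
  refine ContinuousLinearMap.ext fun ζ => ?_
  rw [hF.fderiv_energy_param p hz, h0, zero_mul]
  rfl

/-- Since `de = F dF` with `F ≠ 0`, conserving `F` and conserving the energy are the same condition.
-/
theorem dirDeriv_param_eq_zero_iff (p : M) {z : E × E} (hz : z ∈ slitDom E p) (ζ : E × E) :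
    dirDeriv F (param p z) (dparam p z ζ) = 0 ↔ fderiv ℝ (energy F ∘ param p) z ζ = 0 := by
  rw [dirDeriv_param_vector p hz.1 ((hF.contDiffAt_param p hz).differentiableAt (by simp)),
    hF.fderiv_energy_param p hz, mul_eq_zero, or_iff_right (hF.apply_param_ne_zero p hz)]

/-! ### The Euler-Lagrange equation in coordinates -/

theorem dJ_param (p : M) {z : E × E} (hz : z ∈ slitDom E p) (η : ∀ v : TM E M, TT v) :
    dJ (energy F) (param p z) (η (param p z)) =
      fderiv ℝ (energy F ∘ param p) z (0, (loc p η z).1) := by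
  rw [← loc_vertEndo p hz.1]
  exact dirDeriv_param p hz.1 ((hF.contDiffAt_energy_param p hz).differentiableAt (by simp))
    (fun u => vertEndo u (η u))

theorem dirDeriv_dJ_param (p : M) {z : E × E} (hz : z ∈ slitDom E p) {ξ η : ∀ v : TM E M, TT v}
    (hη : DifferentiableAt ℝ (loc p η) z) :
    dirDeriv (fun u => dJ (energy F) u (η u)) (param p z) (ξ (param p z)) =
      fderiv ℝ (fderiv ℝ (energy F ∘ param p)) z (loc p ξ z) (0, (loc p η z).1) +
        fderiv ℝ (energy F ∘ param p) z (0, (fderiv ℝ (loc p η) z (loc p ξ z)).1) := by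
  have h1 : (fun u => dJ (energy F) u (η u)) ∘ param p =ᶠ[𝓝 z]
      fun z' => fderiv ℝ (energy F ∘ param p) z' (0, (loc p η z').1) := by
    filter_upwards [(isOpen_slitDom p).mem_nhds hz] with z' hz'
    exact hF.dJ_param p hz' η
  have h2 := ((hF.isRegularEnergy p).hasFDerivAt_fderiv hz.1 hz.2).clm_apply
    ((hasFDerivAt_const (0 : E) z).prodMk (HasFDerivAt.fst hη.hasFDerivAt))
  have h3 := h2.congr_of_eventuallyEq h1
  rw [dirDeriv_param p hz.1 h3.differentiableAt, h3.fderiv, add_comm]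
  simp

/-- The terms that differentiate `ξ` and `η` cancel against the bracket term, so only the values of
the fields at the point remain. -/
theorem extDerivOneForm_dJ_param (p : M) {z : E × E} (hz : z ∈ slitDom E p)
    {ξ η : ∀ v : TM E M, TT v} (hξ : ContDiffAt ℝ 1 (loc p ξ) z) (hη : ContDiffAt ℝ 1 (loc p η) z) :
    extDerivOneForm (dJ (energy F)) ξ η (param p z) =
      fderiv ℝ (fderiv ℝ (energy F ∘ param p)) z (loc p ξ z) (0, (loc p η z).1) -
        fderiv ℝ (fderiv ℝ (energy F ∘ param p)) z (loc p η z) (0, (loc p ξ z).1) := by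
  unfold extDerivOneForm
  rw [hF.dirDeriv_dJ_param p hz (hη.differentiableAt (by simp)),
    hF.dirDeriv_dJ_param p hz (hξ.differentiableAt (by simp)), hF.dJ_param p hz,
    loc_bracket p hz.1 hξ hη]
  have : ((0, (fderiv ℝ (loc p η) z (loc p ξ z) - fderiv ℝ (loc p ξ) z (loc p η z)).1) : E × E) =
      (0, (fderiv ℝ (loc p η) z (loc p ξ z)).1) - (0, (fderiv ℝ (loc p ξ) z (loc p η z)).1) := by
    simp
  rw [this, map_sub]
  ring

/-- By tensoriality only the value of `η` at the point matters, and every value is attained by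
cutting off a field that is constant in the chart. -/
theorem euler_lagrange_iff [T2Space M] (p : M) {z : E × E} (hz : z ∈ slitDom E p)
    {ξ : ∀ v : TM E M, TT v} (hξ : ContDiffAt ℝ 1 (loc p ξ) z) :
    (∀ η : ∀ v : TM E M, TT v, IsVectorFieldOn ⊤ η (slit E M) →
      extDerivOneForm (dJ (energy F)) ξ η (param p z)
        = - dirDeriv (energy F) (param p z) (η (param p z))) ↔
      IsEulerLagrangeVector (energy F ∘ param p) z (loc p ξ z) := by
  have key : ∀ η : ∀ v : TM E M, TT v, IsVectorFieldOn ⊤ η (slit E M) →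
      (extDerivOneForm (dJ (energy F)) ξ η (param p z)
        = - dirDeriv (energy F) (param p z) (η (param p z)) ↔
      fderiv ℝ (fderiv ℝ (energy F ∘ param p)) z (loc p ξ z) (0, (loc p η z).1) -
        fderiv ℝ (fderiv ℝ (energy F ∘ param p)) z (loc p η z) (0, (loc p ξ z).1) =
        - fderiv ℝ (energy F ∘ param p) z (loc p η z)) := by
    intro η hη
    rw [hF.extDerivOneForm_dJ_param p hz hξ
      ((hη.contDiffAt_loc p hz).of_le (by exact_mod_cast le_top)),
      dirDeriv_param p hz.1 ((hF.contDiffAt_energy_param p hz).differentiableAt (by simp))]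
  constructor
  · intro h ζ
    obtain ⟨η, hη, hη'⟩ := exists_isVectorFieldOn_loc_eventuallyEq p hz.1 (σ := fun _ => ζ)
      fun _ _ => contDiffAt_const
    have h1 := (key η hη).1 (h η hη)
    rwa [hη'.self_of_nhds] at h1
  · exact fun h η hη => (key η hη).2 (h _)

end IsFinslerFunction

end FinslerCoordinates

section Connections

variable {E : Type*} [NormedAddCommGroup E] [NormedSpace ℝ E] [FiniteDimensional ℝ E]
  {M : Type*} [TopologicalSpace M] [ChartedSpace E M] [IsManifold 𝓘(ℝ, E) ∞ M]

/-! ### Sections along the projection in coordinates -/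

theorem dbase_coord_snd (p : M) {v : TM E M} (hv : v.proj ∈ (chartAt E p).source) :
    (dbase p (chartAt E p v.proj) (coord p v).2 : E) = v.2 := by
  have h1 := (param_eq p (coord_mem_dom p hv)).symm.trans (param_coord p hv)
  exact congrArg (fun u : TM E M => (u.2 : E)) h1

/-- Expresses the coefficient of a section through the smooth chart of `TM` instead of a pointwise
inverse, from which smoothness is immediate. -/
theorem locSec_eq_coord (p : M) {z : E × E} (hz : z ∈ dom E p) (X : ∀ v : TM E M, T E v.proj) :
    locSec p X z = (coord p ⟨(param p z).proj, X (param p z)⟩).2 := by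
  refine (dbase_isInvertible p hz).injective ((dbase_locSec p hz X).trans ?_)
  have h := dbase_coord_snd p (v := ⟨(param p z).proj, X (param p z)⟩) (param_mem_source p hz)
  have h2 : chartAt E p (param p z).proj = z.1 := (chartAt E p).right_inv hz
  exact h.symm.trans (congrArg
    (fun x => (dbase p x (coord p ⟨(param p z).proj, X (param p z)⟩).2 : E)) h2)

theorem IsSectionAlong.contDiffAt_locSec {X : ∀ v : TM E M, T E v.proj} (hX : IsSectionAlong X)
    (p : M) {z : E × E} (hz : z ∈ slitDom E p) : ContDiffAt ℝ ∞ (locSec p X) z := by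
  have h1 := hX.contMDiffAt (isOpen_slit.mem_nhds ((param_mem_slit_iff p hz.1).2 hz.2))
  have h2 := (contMDiffAt_coord p (v := ⟨(param p z).proj, X (param p z)⟩)
    (param_mem_source p hz.1)).comp (param p z) h1
  have h3 := (h2.comp z (contMDiffAt_param p hz.1)).contDiffAt.snd
  refine h3.congr_of_eventuallyEq ?_
  filter_upwards [(isOpen_dom p).mem_nhds hz.1] with z' hz'
  exact locSec_eq_coord p hz' X

theorem IsVectorField.isSectionAlong {X : ∀ p : M, T E p} (hX : IsVectorField X) :
    IsSectionAlong fun v : TM E M => X v.proj :=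
  (hX.comp (Bundle.contMDiff_proj (IB := 𝓘(ℝ, E)) (TangentSpace 𝓘(ℝ, E)))).contMDiffOn

/-- The coordinate representation of a vector field on `M`. -/
def locBase (p : M) (X : ∀ p : M, T E p) (x : E) : E :=
  (coord p (⟨(chartAt E p).symm x, X ((chartAt E p).symm x)⟩ : TM E M)).2

theorem locSec_base (p : M) {z : E × E} (hz : z ∈ dom E p) (X : ∀ p : M, T E p) :
    locSec p (fun v => X v.proj) z = locBase p X z.1 :=
  locSec_eq_coord p hz _

theorem locBase_eq_iff (p : M) {x : E} (hx : x ∈ (chartAt E p).target) (X : ∀ p : M, T E p)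
    (w : E) : locBase p X x = w ↔ X ((chartAt E p).symm x) = dbase p x w := by
  rw [← locSec_base p (z := (x, 0)) hx X]
  have h := dbase_locSec p (z := (x, 0)) hx (fun v => X v.proj)
  refine ⟨fun h' => ?_, fun h' => ?_⟩
  · rw [← h']
    exact h.symm
  · exact (dbase_isInvertible p hx).injective (h.trans h')

theorem locBase_center (p : M) (X : ∀ p : M, T E p) :
    locBase p X (chartAt E p p) = (X p : E) := by
  have h := locSec_base p (center_mem_dom p 0) X
  exact h.symm.trans (locSec_center p 0 _)

theorem IsVectorField.contDiffAt_locBase {X : ∀ p : M, T E p} (hX : IsVectorField X) (p : M)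
    {x : E} (hx : x ∈ (chartAt E p).target) : ContDiffAt ℝ ∞ (locBase p X) x := by
  have h1 : ContMDiffAt 𝓘(ℝ, E) 𝓘(ℝ, E) ∞ (chartAt E p).symm x :=
    (contMDiffOn_chart_symm (I := 𝓘(ℝ, E)) (n := ∞) (x := p)).contMDiffAt
      ((chartAt E p).open_target.mem_nhds hx)
  have h2 := (hX ((chartAt E p).symm x)).comp x h1
  exact (((contMDiffAt_coord p (v := ⟨(chartAt E p).symm x, X ((chartAt E p).symm x)⟩)
    ((chartAt E p).map_target hx)).comp x h2).contDiffAt).snd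

theorem IsVectorField.completeLift_center {X : ∀ p : M, T E p} (hX : IsVectorField X) (p : M)
    (y : E) : (completeLift X ⟨p, y⟩ : E × E) =
      ((X p : E), fderiv ℝ (locBase p X) (chartAt E p p) y) := by
  refine Prod.ext rfl ?_
  have hd : MDifferentiableAt 𝓘(ℝ, E) 𝓘(ℝ, E).tangent (fun p => (⟨p, X p⟩ : TM E M)) p :=
    hX.mdifferentiable (by simp) _
  have h1 : ContMDiffAt 𝓘(ℝ, E) 𝓘(ℝ, E) ∞ (chartAt E p).symm (chartAt E p p) :=
    (contMDiffOn_chart_symm (I := 𝓘(ℝ, E)) (n := ∞) (x := p)).contMDiffAt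
      ((chartAt E p).open_target.mem_nhds (mem_chart_target E p))
  have h2 := (hX ((chartAt E p).symm (chartAt E p p))).comp (chartAt E p p) h1
  have h3 : DifferentiableAt ℝ
      (fun x => coord p (⟨(chartAt E p).symm x, X ((chartAt E p).symm x)⟩ : TM E M))
      (chartAt E p p) :=
    ((contMDiffAt_coord p (v := ⟨(chartAt E p).symm (chartAt E p p), 
      X ((chartAt E p).symm (chartAt E p p))⟩)
    ((chartAt E p).map_target (mem_chart_target E p))).comp (chartAt E p p) h2).contDiffAt.differentiableAt
      (by simp)
  have h4 : (mfderiv 𝓘(ℝ, E) 𝓘(ℝ, E).tangent (fun p => (⟨p, X p⟩ : TM E M)) p y : E × E) =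
      fderiv ℝ (fun x => coord p (⟨(chartAt E p).symm x, X ((chartAt E p).symm x)⟩ : TM E M))
        (chartAt E p p) y := by
    rw [hd.mfderiv, ModelWithCorners.range_eq_univ, fderivWithin_univ]
    rfl
  have h5 := congrArg Prod.snd h4
  refine h5.trans ?_
  exact congrArg (fun L : E →L[ℝ] E => L y) (h3.hasFDerivAt.snd.fderiv).symm

/-! ### Sprays in coordinates -/

/-- The coefficients of a second order vector field. -/
def locSpray (p : M) (S : ∀ v : TM E M, TT v) (z : E × E) : E := (loc p S z).2

theorem loc_semispray (p : M) {z : E × E} (hz : z ∈ dom E p) {S : ∀ v : TM E M, TT v}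
    (hS : vertEndo (param p z) (S (param p z)) = liouville (param p z)) :
    loc p S z = (z.2, locSpray p S z) := by
  refine Prod.ext ?_ rfl
  have h1 := loc_vertEndo p hz S
  rw [loc_congr p hS, loc_liouville p hz] at h1
  exact (congrArg Prod.snd h1).symm

theorem hasFDerivAt_loc_vLift_center {X : ∀ p : M, T E p} (hX : IsVectorField X) (p : M) (y : E) :
    HasFDerivAt (loc p (vLift X)) ((0 : E × E →L[ℝ] E).prod
      ((fderiv ℝ (locBase p X) (chartAt E p p)).comp (ContinuousLinearMap.fst ℝ E E)))
      (center p y) ∧ ContDiffAt ℝ ∞ (loc p (vLift X)) (center p y) := by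
  have h0 : loc p (vLift X) =ᶠ[𝓝 (center p y)] fun z => (0, locBase p X z.1) := by
    filter_upwards [(isOpen_dom p).mem_nhds (center_mem_dom p y)] with z hz
    rw [← locSec_base p hz]
    exact loc_vert p hz _
  have h1 := hX.contDiffAt_locBase p (mem_chart_target E p)
  constructor
  · refine HasFDerivAt.congr_of_eventuallyEq ?_ h0
    have h2 : HasFDerivAt (fun z : E × E => locBase p X z.1) _ (center p y) :=
      HasFDerivAt.comp (center p y) (f := Prod.fst) (h1.differentiableAt (by simp)).hasFDerivAt
        hasFDerivAt_fst
    exact (hasFDerivAt_const (0 : E) (center p y)).prodMk h2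
  · refine ContDiffAt.congr_of_eventuallyEq ?_ h0
    exact contDiffAt_const.prodMk (ContDiffAt.comp (center p y) (f := Prod.fst) h1 contDiffAt_fst)

theorem fderiv_loc_semispray (p : M) {z : E × E} {S : ∀ v : TM E M, TT v}
    (hS : ∀ᶠ z' in 𝓝 z, loc p S z' = (z'.2, locSpray p S z')) (hS1 : ContDiffAt ℝ 1 (loc p S) z)
    (ζ : E × E) : fderiv ℝ (loc p S) z ζ = (ζ.2, fderiv ℝ (locSpray p S) z ζ) := by
  have hd := (hS1.differentiableAt (by simp)).hasFDerivAt
  have h1 : HasFDerivAt (locSpray p S) _ z := hd.snd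
  have h2 := (hasFDerivAt_snd (𝕜 := ℝ) (p := z)).prodMk h1
  have h3 := h2.congr_of_eventuallyEq hS
  have h4 := congrArg (fun L => L ζ) (hd.unique h3)
  rw [h1.fderiv]
  exact h4

/-- With `X^c = (X, DX y)` and `[X^v, S] = (X, ∂_X s) - (0, DX y)`, the derivatives of `X` cancel in
the sum. This is where the coefficient `½ ∂s` comes from. -/
theorem horizontal_lift_center {X : ∀ p : M, T E p} (hX : IsVectorField X) (p : M) (y : E)
    {S : ∀ v : TM E M, TT v}
    (hS : ∀ᶠ z' in 𝓝 (center p y), loc p S z' = (z'.2, locSpray p S z'))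
    (hS1 : ContDiffAt ℝ 1 (loc p S) (center p y)) :
    ((1 / 2 : ℝ) • (completeLift X ⟨p, y⟩ + bracket (vLift X) S ⟨p, y⟩) : E × E) =
      (locBase p X (chartAt E p p), (1 / 2 : ℝ) •
        fderiv ℝ (locSpray p S) (center p y) (0, locBase p X (chartAt E p p))) := by
  obtain ⟨h1, h2⟩ := hasFDerivAt_loc_vLift_center hX p y
  have h3 := bracket_center p y (h2.of_le (by exact_mod_cast le_top)) hS1
  have h4 : loc p (vLift X) (center p y) = (0, locBase p X (chartAt E p p)) := by
    rw [loc_center, locBase_center]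
    exact vert_eq_mk _ _
  have h6 := hX.completeLift_center p y
  rw [← locBase_center p X] at h6
  rw [h4, fderiv_loc_semispray p hS hS1, h1.fderiv, hS.self_of_nhds] at h3
  have half_add : ∀ a b c : E, (1 / 2 : ℝ) • (((a, b) : E × E) + ((a, c) - (0, b))) =
      (a, (1 / 2 : ℝ) • c) := by
    intro a b c
    refine Prod.ext ?_ ?_
    · simp [← two_smul ℝ, smul_smul]
    · simp
  exact (congrArg₂ (fun a b : E × E => (1 / 2 : ℝ) • (a + b)) h6 h3).trans (half_add _ _ _)

theorem hasFDerivAt_loc_liouville (p : M) {z : E × E} (hz : z ∈ dom E p) :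
    HasFDerivAt (loc p liouville) ((0 : E × E →L[ℝ] E).prod (ContinuousLinearMap.snd ℝ E E)) z ∧
      ContDiffAt ℝ ∞ (loc p (liouville (E := E) (M := M))) z := by
  have h0 : loc p (liouville (E := E) (M := M)) =ᶠ[𝓝 z] fun z => (0, z.2) := by
    filter_upwards [(isOpen_dom p).mem_nhds hz] with z hz
    exact loc_liouville p hz
  exact ⟨HasFDerivAt.congr_of_eventuallyEq
    ((hasFDerivAt_const (0 : E) z).prodMk hasFDerivAt_snd) h0,
    ContDiffAt.congr_of_eventuallyEq (contDiffAt_const.prodMk contDiffAt_snd) h0⟩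

theorem loc_bracket_liouville (p : M) {z : E × E} (hz : z ∈ dom E p) {S : ∀ v : TM E M, TT v}
    (hS : ∀ᶠ z' in 𝓝 z, loc p S z' = (z'.2, locSpray p S z'))
    (hS1 : ContDiffAt ℝ 1 (loc p S) z) :
    loc p (bracket liouville S) z =
      (z.2, fderiv ℝ (locSpray p S) z (0, z.2) - locSpray p S z) := by
  obtain ⟨h1, h2⟩ := hasFDerivAt_loc_liouville p hz
  rw [loc_bracket p hz (h2.of_le (by exact_mod_cast le_top)) hS1, loc_liouville p hz, h1.fderiv,
    fderiv_loc_semispray p hS hS1, hS.self_of_nhds]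
  refine Prod.ext ?_ ?_
  · simp
  · simp

/-- The first components of `[C, S]` and `S` always agree; the second reads `∂_y s - s = s`, Euler's
relation of degree two. -/
theorem bracket_liouville_eq_iff (p : M) {z : E × E} (hz : z ∈ dom E p) {S : ∀ v : TM E M, TT v}
    (hS : ∀ᶠ z' in 𝓝 z, loc p S z' = (z'.2, locSpray p S z'))
    (hS1 : ContDiffAt ℝ 1 (loc p S) z) :
    bracket liouville S (param p z) = S (param p z) ↔
      fderiv ℝ (locSpray p S) z (0, z.2) = (2 : ℝ) • locSpray p S z := by
  rw [← dparam_loc p hz S, ← loc_eq_iff p hz, loc_bracket_liouville p hz hS hS1, hS.self_of_nhds,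
    Prod.mk_right_inj, sub_eq_iff_eq_add, two_smul]

/-! ### Ehresmann connections in coordinates -/

/-- The coefficients of an Ehresmann connection. -/
def locConn (p : M) (H : FibreLinearMap E M) (z : E × E) : E →L[ℝ] E :=
  LinearMap.toContinuousLinearMap
    { toFun := fun w => ((dparam p z).inverse (H (param p z) (dbase p z.1 w))).2
      map_add' := fun a b => by
        have h : (dbase p z.1 (a + b) : T E (param p z).proj) =
          (show T E (param p z).proj from dbase p z.1 a) +
            (show T E (param p z).proj from dbase p z.1 b) := map_add (dbase p z.1) a b
        rw [h, map_add, map_add]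
        rfl
      map_smul' := fun c a => by
        have h : (dbase p z.1 (c • a) : T E (param p z).proj) =
          c • (show T E (param p z).proj from dbase p z.1 a) := map_smul (dbase p z.1) c a
        rw [h, map_smul, map_smul]
        rfl }

theorem locConn_apply (p : M) (H : FibreLinearMap E M) (z : E × E) (w : E) :
    locConn p H z w = ((dparam p z).inverse (H (param p z) (dbase p z.1 w))).2 := rfl

/-- The map `v ↦ (v, X v)` into the pull-back bundle. -/
theorem IsSectionAlong.contMDiffOn_pullback {X : ∀ v : TM E M, T E v.proj} (hX : IsSectionAlong X) :
    ContMDiffOn 𝓘(ℝ, E).tangent (𝓘(ℝ, E).tangent.prod 𝓘(ℝ, E)) ∞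
      (fun v => (⟨v, X v⟩ : PullbackTM E M)) (slit E M) := by
  intro v hv
  refine Bundle.contMDiffWithinAt_totalSpace.2 ⟨contMDiffWithinAt_id, ?_⟩
  exact (Bundle.contMDiffWithinAt_totalSpace.1 (hX v hv)).2

namespace IsEhresmannConnection
variable {H : FibreLinearMap E M} (hH : IsEhresmannConnection H)
include hH

theorem apply_dbase (p : M) {z : E × E} (hz : z ∈ dom E p) (w : E) :
    H (param p z) (dbase p z.1 w) = dparam p z (w, locConn p H z w) := by
  have h1 := (dparam_isInvertible p hz).self_apply_inverse (H (param p z) (dbase p z.1 w))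
  have h2 := hH.splits (param p z) (dbase p z.1 w)
  rw [← h1, proj_dparam p hz] at h2
  have h3 := (dbase_isInvertible p hz).injective h2
  rw [← h1, locConn_apply]
  exact congrArg (dparam p z) (Prod.ext h3 rfl)

theorem loc_apply (p : M) {z : E × E} (hz : z ∈ dom E p) (X : ∀ v : TM E M, T E v.proj) :
    loc p (fun u => H u (X u)) z = (locSec p X z, locConn p H z (locSec p X z)) := by
  rw [loc_eq_iff p hz, ← hH.apply_dbase p hz]
  exact congrArg (H (param p z)) (dbase_locSec p hz X).symm

theorem isVectorFieldOn_apply {X : ∀ v : TM E M, T E v.proj} (hX : IsSectionAlong X) :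
    IsVectorFieldOn ⊤ (fun u => H u (X u)) (slit E M) :=
  hH.smooth.comp hX.contMDiffOn_pullback fun _ hv => hv

/-- An operator-valued map on a finite-dimensional space is smooth once its values on fixed vectors
are; these are components of `H` applied to vector fields constant in the chart. -/
theorem contDiffAt_locConn [T2Space M] (p : M) {z : E × E} (hz : z ∈ slitDom E p) :
    ContDiffAt ℝ ∞ (locConn p H) z := by
  have hs : ContDiffOn ℝ ∞ (locConn p H) (slitDom E p) := by
    refine contDiffOn_clm_apply.2 fun w z hz => ContDiffAt.contDiffWithinAt ?_
    obtain ⟨X, hX, hX1⟩ := exists_isVectorField_eventuallyEq p hz.1 w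
    have h1 := (hH.isVectorFieldOn_apply hX.isSectionAlong).contDiffAt_loc p hz
    refine h1.snd.congr_of_eventuallyEq ?_
    filter_upwards [(isOpen_dom p).mem_nhds hz.1,
      continuous_fst.continuousAt.eventually hX1] with z' h2 h3
    rw [hH.loc_apply p h2, locSec_base p h2, (locBase_eq_iff p h2 X w).2 h3]
  exact hs.contDiffAt ((isOpen_slitDom p).mem_nhds hz)

theorem apply_center (p : M) (y w : E) :
    (H ⟨p, y⟩ w : E × E) = (w, locConn p H (center p y) w) := by
  have h1 := hH.apply_dbase p (center_mem_dom p y) w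
  have h2 : (H (param p (center p y)) (dbase p (chartAt E p p) w) : E × E) =
      (w, locConn p H (center p y) w) := h1.trans (dparam_center p y _)
  have h3 : (H (param p (center p y)) (dbase p (chartAt E p p) w) : E × E) =
      (H (param p (center p y)) (show E from w) : E × E) :=
    congrArg (fun a : E => (H (param p (center p y)) a : E × E)) (dbase_center p w)
  exact (congrArg (fun v => (H v (show E from w) : E × E)) (param_center p y)).symm.trans
    (h3.symm.trans h2)

/-- The coefficients at centres suffice: on the zero section every Ehresmann connection is
prescribed by `zero_section`. -/
theorem ext_on_slit {H' : FibreLinearMap E M} (hH' : IsEhresmannConnection H')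
    (h : ∀ (p : M) (y : E), y ≠ 0 → locConn p H (center p y) = locConn p H' (center p y)) :
    H = H' := by
  funext v
  obtain ⟨p, y⟩ := v
  ext w
  by_cases hy : (y : E) = 0
  · obtain rfl : y = 0 := hy
    rw [hH.zero_section, hH'.zero_section]
  · refine (hH.apply_center p y w).trans (Eq.trans ?_ (hH'.apply_center p y w).symm)
    rw [h p y hy]

end IsEhresmannConnection

/-- `horizontal_lift_center` handles one vector field; fields constant near `p` realize every `w`.
-/
theorem isAssociatedConnection_iff [T2Space M] {H : FibreLinearMap E M}
    (hH : IsEhresmannConnection H) {S : ∀ v : TM E M, TT v} (hS : ∀ v, vertEndo v (S v) = liouville v)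
    (hS1 : IsVectorFieldOn ⊤ S (slit E M)) :
    IsAssociatedConnection S H ↔ ∀ (p : M) (y : E), y ≠ 0 → ∀ w : E,
      locConn p H (center p y) w = (1 / 2 : ℝ) • fderiv ℝ (locSpray p S) (center p y) (0, w) := by
  have hloc : ∀ (p : M) (y : E), ∀ᶠ z' in 𝓝 (center p y), loc p S z' = (z'.2, locSpray p S z') := by
    intro p y
    filter_upwards [(isOpen_dom p).mem_nhds (center_mem_dom p y)] with z' hz'
    exact loc_semispray p hz' (hS _)
  have key : ∀ {X : ∀ p : M, T E p}, IsVectorField X → ∀ (p : M) (y : E), y ≠ 0 →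
      (H ⟨p, y⟩ (X p) = (1 / 2 : ℝ) • (completeLift X ⟨p, y⟩ + bracket (vLift X) S ⟨p, y⟩) ↔
        locConn p H (center p y) (locBase p X (chartAt E p p)) =
        (1 / 2 : ℝ) • fderiv ℝ (locSpray p S) (center p y) (0, locBase p X (chartAt E p p))) := by
    intro X hX p y hy
    have h1 := horizontal_lift_center hX p y (hloc p y)
      ((hS1.contDiffAt_loc p (center_mem_slitDom p hy)).of_le (by exact_mod_cast le_top))
    have h2 := hH.apply_center p y (X p)
    rw [← locBase_center p X] at h2
    constructor
    · intro h
      exact congrArg Prod.snd (h2.symm.trans ((congrArg (fun a : E => (H ⟨p, y⟩ a : E × E))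
        (locBase_center p X)).trans (h.trans h1)))
    · intro h
      rw [h] at h2
      exact (congrArg (fun a : E => (H ⟨p, y⟩ a : E × E))
        (locBase_center p X)).symm.trans (h2.trans h1.symm)
  constructor
  · intro h p y hy w
    obtain ⟨X, hX, hX1⟩ := exists_isVectorField_eventuallyEq p (mem_chart_target E p) w
    have h1 := (locBase_eq_iff p (mem_chart_target E p) X w).2 hX1.self_of_nhds
    have h2 := (key hX p y hy).1 (h.horizontal_lift X hX ⟨p, y⟩ hy)
    rwa [h1] at h2
  · intro h
    refine ⟨hH, fun X hX v hv => ?_⟩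
    obtain ⟨p, y⟩ := v
    exact (key hX p y hv).2 (h p y hv _)

end Connections

section CanonicalSpray

variable {E : Type*} [NormedAddCommGroup E] [NormedSpace ℝ E] [FiniteDimensional ℝ E]
  {M : Type*} [TopologicalSpace M] [ChartedSpace E M] [IsManifold 𝓘(ℝ, E) ∞ M]

/-! ### Existence and uniqueness of the canonical spray -/

theorem exists_eq_mk (v : TM E M) : ∃ (p : M) (y : E), v = ⟨p, y⟩ := ⟨v.proj, v.2, rfl⟩

/-- The canonical spray of a Finsler function. -/
def canonicalSpray (F : TM E M → ℝ) (v : TM E M) : TT v :=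
  (((v.2 : E), sprayCoeff (energy F ∘ param v.proj) (center v.proj v.2)) : E × E)

namespace IsFinslerFunction
variable [T2Space M] {F : TM E M → ℝ} (hF : IsFinslerFunction F)
include hF

theorem isEulerLagrangeVector_center {S : ∀ v : TM E M, TT v} {p : M} {y : E} (hy : y ≠ 0)
    (hS : ContDiffAt ℝ 1 (loc p S) (center p y))
    (h : ∀ η : ∀ v : TM E M, TT v, IsVectorFieldOn ⊤ η (slit E M) →
      extDerivOneForm (dJ (energy F)) S η ⟨p, y⟩ = - dirDeriv (energy F) ⟨p, y⟩ (η ⟨p, y⟩)) :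
    IsEulerLagrangeVector (energy F ∘ param p) (center p y) (S ⟨p, y⟩) := by
  have h1 := hF.euler_lagrange_iff p (center_mem_slitDom p hy) hS
  rw [param_center] at h1
  have h2 := h1.1 h
  rwa [loc_center] at h2

/-- A pointwise uniqueness statement: the intrinsic equation at one vector fixes the value there. It
yields both uniqueness of the canonical spray and its chart independence. -/
theorem eq_canonicalSpray_of_euler_lagrange {S : ∀ v : TM E M, TT v} {p : M} {y : E} (hy : y ≠ 0)
    (hS : ContDiffAt ℝ 1 (loc p S) (center p y))
    (h : ∀ η : ∀ v : TM E M, TT v, IsVectorFieldOn ⊤ η (slit E M) →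
      extDerivOneForm (dJ (energy F)) S η ⟨p, y⟩ = - dirDeriv (energy F) ⟨p, y⟩ (η ⟨p, y⟩)) :
    S ⟨p, y⟩ = canonicalSpray F ⟨p, y⟩ :=
  (hF.isRegularEnergy p).isEulerLagrangeVector_unique (z := center p y) (mem_chart_target E p) hy
    (hF.isEulerLagrangeVector_center hy hS h)
    ((hF.isRegularEnergy p).isEulerLagrangeVector_sprayCoeff (z := center p y)
      (mem_chart_target E p) hy)

/-- `canonicalSpray` uses a different chart at each foot point, so its form in a fixed chart needs
proof. The field built in the chart at `p` solves the intrinsic equation, hence agrees with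
`canonicalSpray` by uniqueness; on the zero section both vanish. -/
theorem loc_canonicalSpray (p : M) {z : E × E} (hz : z ∈ dom E p) :
    loc p (canonicalSpray F) z = (z.2, sprayCoeff (energy F ∘ param p) z) := by
  by_cases hz0 : z.2 = 0
  · have h1 : z = (z.1, 0) := Prod.ext rfl hz0
    rw [h1, sprayCoeff_zero, loc_eq_iff p (by exact hz)]
    refine Eq.trans ?_ (map_zero _).symm
    have h2 : ((param p (z.1, 0)).2 : E) = 0 := by
      have h3 := congrArg (fun v : TM E M => (v.2 : E)) (param_eq p (z := (z.1, 0)) hz)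
      exact h3.trans (map_zero (dbase p z.1))
    have h4 : ∀ v : TM E M, (v.2 : E) = 0 → canonicalSpray F v = 0 := by
      intro v h5
      obtain ⟨q, y, rfl⟩ := exists_eq_mk v
      obtain rfl : y = 0 := h5
      exact Prod.ext rfl (sprayCoeff_zero _ _)
    exact h4 _ h2
  · have hz' : z ∈ slitDom E p := ⟨hz, hz0⟩
    set σ : E × E → E × E := fun z => (z.2, sprayCoeff (energy F ∘ param p) z) with hσ
    have hσs : ContDiffAt ℝ 1 σ z :=
      contDiffAt_snd.prodMk ((hF.isRegularEnergy p).contDiffAt_one_sprayCoeff hz)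
    have h1 : loc p (push p σ) =ᶠ[𝓝 z] σ := by
      filter_upwards [(isOpen_dom p).mem_nhds hz] with z' hz'
      exact loc_push p hz' σ
    have h2 := (hF.euler_lagrange_iff p hz' (hσs.congr_of_eventuallyEq h1)).2 (by
      rw [loc_push p hz]
      exact (hF.isRegularEnergy p).isEulerLagrangeVector_sprayCoeff hz hz0)
    have h3 : push p σ (param p z) = canonicalSpray F (param p z) := by
      have h5 : ((param p z).2 : E) ≠ 0 := (param_mem_slit_iff p hz).2 hz0
      refine hF.eq_canonicalSpray_of_euler_lagrange (p := (param p z).proj) (y := (param p z).2) h5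
        ?_ h2
      refine contDiffAt_loc (k := 1) _ (center_mem_dom _ _) ?_
      have h6 : param (param p z).proj (center (E := E) (param p z).proj (param p z).2) =
        param p z := param_center _ _
      rw [h6]
      refine contMDiffAt_push p (param_mem_source p hz) ?_
      rwa [coord_param p hz]
    rw [← loc_congr p h3, loc_push p hz]

theorem isSpray_canonicalSpray : IsSpray (canonicalSpray F) where
  smooth := isVectorFieldOn_slit fun p z hz => by
    refine (contDiffAt_snd.prodMk ((hF.isRegularEnergy p).contDiffAt_sprayCoeff hz.1 hz.2)
      ).congr_of_eventuallyEq ?_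
    filter_upwards [(isOpen_dom p).mem_nhds hz.1] with z' hz'
    exact hF.loc_canonicalSpray p hz'
  semispray v := by
    unfold vertEndo liouville
    rw [proj_eq_fst]
    rfl
  contDiff_one := isVectorFieldOn_univ fun p z hz => by
    refine (contDiffAt_snd.prodMk ((hF.isRegularEnergy p).contDiffAt_one_sprayCoeff hz)
      ).congr_of_eventuallyEq ?_
    filter_upwards [(isOpen_dom p).mem_nhds hz] with z' hz'
    exact hF.loc_canonicalSpray p hz'
  homogeneous v := by
    obtain ⟨p, y, rfl⟩ := exists_eq_mk v
    have hz := center_mem_dom p y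
    have h0 : loc p (canonicalSpray F) =ᶠ[𝓝 (center p y)]
        fun z => (z.2, sprayCoeff (energy F ∘ param p) z) := by
      filter_upwards [(isOpen_dom p).mem_nhds hz] with z' hz'
      exact hF.loc_canonicalSpray p hz'
    have h1 : locSpray p (canonicalSpray F) =ᶠ[𝓝 (center p y)] sprayCoeff (energy F ∘ param p) :=
      h0.fun_comp Prod.snd
    have h2 := bracket_liouville_eq_iff p hz (S := canonicalSpray F)
      (h0.mono fun z' h' => Prod.ext (by rw [h']) rfl)
      ((contDiffAt_snd.prodMk ((hF.isRegularEnergy p).contDiffAt_one_sprayCoeff hz)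
        ).congr_of_eventuallyEq h0)
    rw [param_center] at h2
    rw [h2, h1.fderiv_eq, h1.self_of_nhds]
    exact (hF.isRegularEnergy p).fderiv_sprayCoeff_vertical_self hz

theorem isCanonicalSpray_canonicalSpray : IsCanonicalSpray F (canonicalSpray F) where
  zero_section p := Prod.ext rfl (sprayCoeff_zero _ _)
  smooth := hF.isSpray_canonicalSpray.smooth
  euler_lagrange η hη v hv := by
    obtain ⟨p, y, rfl⟩ := exists_eq_mk v
    have h1 := hF.euler_lagrange_iff p (center_mem_slitDom p hv)
      ((hF.isSpray_canonicalSpray.smooth.contDiffAt_loc p (center_mem_slitDom p hv)).of_le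
        (by exact_mod_cast le_top))
    rw [param_center] at h1
    refine h1.2 ?_ η hη
    rw [hF.loc_canonicalSpray p (center_mem_dom p y)]
    exact (hF.isRegularEnergy p).isEulerLagrangeVector_sprayCoeff (z := center p y)
      (mem_chart_target E p) hv

theorem eq_canonicalSpray {S : ∀ v : TM E M, TT v} (hS : IsCanonicalSpray F S) :
    S = canonicalSpray F := by
  funext v
  obtain ⟨p, y, rfl⟩ := exists_eq_mk v
  by_cases hy : y = 0
  · subst hy
    exact (hS.zero_section p).trans (hF.isCanonicalSpray_canonicalSpray.zero_section p).symm
  · exact hF.eq_canonicalSpray_of_euler_lagrange hy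
      ((hS.smooth.contDiffAt_loc p (center_mem_slitDom p hy)).of_le (by exact_mod_cast le_top))
      fun η hη => hS.euler_lagrange η hη _ hy

end IsFinslerFunction

/-! ### The Ehresmann connection associated to a spray -/

/-- The horizontal projection `(1 - [J, S]) / 2` applied to a vector field. -/
def horizontalPart (S ξ : ∀ v : TM E M, TT v) (v : TM E M) : TT v :=
  (1 / 2 : ℝ) • (ξ v + bracket (fun u => vertEndo u (ξ u)) S v - vertEndo v (bracket ξ S v))

/-- The derivatives of `ξ` and its vertical component cancel. The operator is intrinsic and its
value depends only on the first component of `ξ` at the point, which allows comparison between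
charts. -/
theorem loc_horizontalPart (p : M) {z : E × E} (hz : z ∈ dom E p) {S ξ : ∀ v : TM E M, TT v}
    (hS : ∀ᶠ z' in 𝓝 z, loc p S z' = (z'.2, locSpray p S z'))
    (hS1 : ContDiffAt ℝ 1 (loc p S) z) (hξ : ContDiffAt ℝ 1 (loc p ξ) z) :
    loc p (horizontalPart S ξ) z =
      ((loc p ξ z).1, (1 / 2 : ℝ) • fderiv ℝ (locSpray p S) z (0, (loc p ξ z).1)) := by
  have h0 : loc p (horizontalPart S ξ) z = (1 / 2 : ℝ) • (loc p ξ z +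
      loc p (bracket (fun u => vertEndo u (ξ u)) S) z -
        loc p (fun v => vertEndo v (bracket ξ S v)) z) := by
    unfold loc
    simp only [mpullback_apply, horizontalPart, map_smul, map_add, map_sub]
    rfl
  have h1 : loc p (fun u => vertEndo u (ξ u)) =ᶠ[𝓝 z] fun z => (0, (loc p ξ z).1) := by
    filter_upwards [(isOpen_dom p).mem_nhds hz] with z' hz'
    exact loc_vertEndo p hz' ξ
  have h2 : HasFDerivAt (fun z => ((0, (loc p ξ z).1) : E × E)) _ z :=
    (hasFDerivAt_const (0 : E) z).prodMk (hξ.differentiableAt (by simp)).hasFDerivAt.fst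
  rw [h0, loc_vertEndo p hz, loc_bracket p hz ((contDiffAt_const.prodMk hξ.fst).congr_of_eventuallyEq h1)
    hS1, loc_bracket p hz hξ hS1, h1.fderiv_eq, h1.self_of_nhds, h2.fderiv,
    fderiv_loc_semispray p hS hS1, fderiv_loc_semispray p hS hS1, hS.self_of_nhds]
  refine Prod.ext ?_ ?_
  · simp [← two_smul ℝ, smul_smul]
  · simp

open Classical in
/-- The vertical coefficients of the connection that is associated to a spray. -/
def connCoeff (S : ∀ v : TM E M, TT v) (v : TM E M) : E →L[ℝ] E :=
  if (v.2 : E) = 0 then 0 else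
    (1 / 2 : ℝ) • (fderiv ℝ (locSpray v.proj S) (center v.proj v.2)).comp
      (ContinuousLinearMap.inr ℝ E E)

theorem connCoeff_mk (S : ∀ v : TM E M, TT v) (p : M) {y : E} (hy : y ≠ 0) :
    connCoeff S ⟨p, y⟩ = (1 / 2 : ℝ) • (fderiv ℝ (locSpray p S) (center p y)).comp
      (ContinuousLinearMap.inr ℝ E E) := if_neg hy

/-- The Ehresmann connection that is associated to a spray. -/
def associatedConnection (S : ∀ v : TM E M, TT v) : FibreLinearMap E M := fun v =>
  (LinearMap.id.prod (connCoeff S v : E →ₗ[ℝ] E) : E →ₗ[ℝ] E × E)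

theorem mfderiv_zeroSection (p : M) (w : E) :
    (mfderiv 𝓘(ℝ, E) 𝓘(ℝ, E).tangent (fun q : M => (⟨q, 0⟩ : TM E M)) p w : E × E) = (w, 0) := by
  have hd : MDifferentiableAt 𝓘(ℝ, E) 𝓘(ℝ, E).tangent (fun q : M => (⟨q, 0⟩ : TM E M)) p :=
    (Bundle.contMDiff_zeroSection (n := 1) ℝ (TangentSpace 𝓘(ℝ, E))).mdifferentiable (by simp) p
  have h4 : (mfderiv 𝓘(ℝ, E) 𝓘(ℝ, E).tangent (fun q : M => (⟨q, 0⟩ : TM E M)) p w : E × E) =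
      fderiv ℝ (fun x => coord p (⟨(chartAt E p).symm x, 0⟩ : TM E M)) (chartAt E p p) w := by
    rw [hd.mfderiv, ModelWithCorners.range_eq_univ, fderivWithin_univ]
    rfl
  have h5 : (fun x => coord p (⟨(chartAt E p).symm x, 0⟩ : TM E M)) =ᶠ[𝓝 (chartAt E p p)]
      fun x => (x, 0) := by
    filter_upwards [(chartAt E p).open_target.mem_nhds (mem_chart_target E p)] with x hx
    have h6 := param_eq p (z := (x, 0)) hx
    rw [map_zero] at h6
    rw [← h6, coord_param p (by exact hx)]
  rw [h4, h5.fderiv_eq, (hasFDerivAt_prodMk_left (𝕜 := ℝ) (chartAt E p p) (0 : E)).fderiv]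
  rfl

/-- Chart independence of the pointwise definition: `horizontalPart` of one field `ξ` is evaluated
at the same vector in the chart at `p` and in the chart at its foot point `q`. -/
theorem associatedConnection_apply_dbase {S : ∀ v : TM E M, TT v}
    (hS : ∀ v, vertEndo v (S v) = liouville v) (hS1 : IsVectorFieldOn ⊤ S (slit E M))
    (p : M) {z : E × E} (hz : z ∈ slitDom E p) (w : E) :
    associatedConnection S (param p z) (dbase p z.1 w) =
      dparam p z (w, (1 / 2 : ℝ) • fderiv ℝ (locSpray p S) z (0, w)) := by
  have hloc : ∀ (p : M) {z : E × E}, z ∈ dom E p →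
      ∀ᶠ z' in 𝓝 z, loc p S z' = (z'.2, locSpray p S z') := by
    intro p z hz
    filter_upwards [(isOpen_dom p).mem_nhds hz] with z' hz'
    exact loc_semispray p hz' (hS _)
  have hS1' : ∀ (p : M) {z : E × E}, z ∈ slitDom E p → ContDiffAt ℝ 1 (loc p S) z := fun p z hz =>
    (hS1.contDiffAt_loc p hz).of_le (by exact_mod_cast le_top)
  set ξ : ∀ v : TM E M, TT v := push p fun _ => (w, 0) with hξ
  have hξ1 : ContDiffAt ℝ 1 (loc p ξ) z := by
    refine (contDiffAt_const (c := ((w, 0) : E × E))).congr_of_eventuallyEq ?_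
    filter_upwards [(isOpen_dom p).mem_nhds hz.1] with z' hz'
    exact loc_push p hz' _
  have h1 := loc_horizontalPart p hz.1 (hloc p hz.1) (hS1' p hz) hξ1
  rw [loc_push p hz.1, loc_eq_iff p hz.1] at h1
  rw [← h1]
  have hy : ((param p z).2 : E) ≠ 0 := (param_mem_slit_iff p hz.1).2 hz.2
  set q := (param p z).proj with hq
  set y : E := (param p z).2 with hy'
  have hξ2 : ContDiffAt ℝ 1 (loc q ξ) (center q y) := by
    refine contDiffAt_loc (k := 1) _ (center_mem_dom _ _) ?_
    rw [param_center]
    refine contMDiffAt_push p (param_mem_source p hz.1) ?_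
    exact contDiffAt_const
  have h2 := loc_horizontalPart q (center_mem_dom q y) (hloc q (center_mem_dom q y))
    (hS1' q (center_mem_slitDom q hy)) hξ2
  have h3 : (loc q ξ (center q y)).1 = (dbase p z.1 w : E) := by
    rw [loc_center]
    have h4 := proj_dparam p hz.1 ((w, 0) : E × E)
    rw [← push_param p hz.1 (fun _ => (w, 0)), proj_eq_fst] at h4
    exact h4
  rw [h3, loc_center] at h2
  refine Eq.trans ?_ h2.symm
  refine Prod.ext rfl ?_
  change connCoeff S (param p z) (dbase p z.1 w) = _
  refine (congrArg (fun L : E →L[ℝ] E => L (dbase p z.1 w : E)) (connCoeff_mk S q hy)).trans ?_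
  rfl

/-! ### Smoothness of a connection from its coefficients -/

theorem trivializationAt_dparam (p : M) {z : E × E} (hz : z ∈ dom E p) {v : TM E M}
    (hv : v.proj = p) (ζ : E × E) :
    (trivializationAt (E × E) (TangentSpace 𝓘(ℝ, E).tangent : TM E M → Type _) v
      ⟨param p z, dparam p z ζ⟩).2 = ζ := by
  subst hv
  have hs : param v.proj z ∈ (chartAt (ModelProd E E) v).source :=
    (TangentBundle.mem_chart_source_iff _ _).2 (param_mem_source v.proj hz)
  have h1 := TangentBundle.continuousLinearMapAt_trivializationAt (I := 𝓘(ℝ, E).tangent) hs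
  have h2 := congrArg (fun L => L (dparam v.proj z ζ)) h1
  refine Eq.trans ?_ (h2.trans (mfderiv_coord_dparam v.proj hz ζ))
  have hb : param v.proj z ∈ (trivializationAt (E × E)
      (TangentSpace 𝓘(ℝ, E).tangent : TM E M → Type _) v).baseSet := hs
  simp only [Bundle.Trivialization.continuousLinearMapAt_apply,
    Bundle.Trivialization.coe_linearMapAt_of_mem _ hb]

/-- In the trivializations at a point of the pull-back bundle, `H` reads `(x, y, w) ↦ (w, Γ(x, y)
w)`, smooth because `Γ` is smooth as an operator-valued map. -/
theorem contMDiffOn_of_coordinates {H : FibreLinearMap E M} {Γ : M → E × E → E →L[ℝ] E}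
    (h : ∀ (p : M), ∀ z ∈ slitDom E p, ∀ w : E,
      H (param p z) (dbase p z.1 w) = dparam p z (w, Γ p z w))
    (hΓ : ∀ (p : M), ∀ z ∈ slitDom E p, ContDiffAt ℝ ∞ (Γ p) z) :
    ContMDiffOn (𝓘(ℝ, E).tangent.prod 𝓘(ℝ, E)) 𝓘(ℝ, E).tangent.tangent ∞
      (fun z : PullbackTM E M =>
        (⟨z.proj, H z.proj z.2⟩ : TangentBundle 𝓘(ℝ, E).tangent (TM E M)))
      {z | z.proj ∈ slit E M} := by
  intro ζ₀ hζ₀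
  refine ContMDiffAt.contMDiffWithinAt ?_
  have hproj : ContMDiffAt (𝓘(ℝ, E).tangent.prod 𝓘(ℝ, E)) 𝓘(ℝ, E).tangent ∞
      (fun ζ : PullbackTM E M => ζ.proj) ζ₀ := Bundle.contMDiffAt_proj _
  refine Bundle.contMDiffAt_totalSpace.2 ⟨hproj, ?_⟩
  set p : M := ζ₀.proj.proj with hp
  have hp0 : ζ₀.proj.proj ∈ (chartAt E p).source := mem_chart_source E p
  have hfib : ContMDiffAt (𝓘(ℝ, E).tangent.prod 𝓘(ℝ, E)) 𝓘(ℝ, E) ∞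
      (fun ζ : PullbackTM E M => (coord p (⟨ζ.proj.proj, ζ.2⟩ : TM E M)).2) ζ₀ :=
    (Bundle.contMDiffAt_totalSpace.1 (contMDiffAt_id (x := ζ₀))).2
  have hco : ContMDiffAt (𝓘(ℝ, E).tangent.prod 𝓘(ℝ, E)) 𝓘(ℝ, E × E) ∞
      (fun ζ : PullbackTM E M => coord p ζ.proj) ζ₀ :=
    (contMDiffAt_coord p hp0).comp ζ₀ hproj
  have hΓ' : ContMDiffAt (𝓘(ℝ, E).tangent.prod 𝓘(ℝ, E)) 𝓘(ℝ, E →L[ℝ] E) ∞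
      (fun ζ : PullbackTM E M => Γ p (coord p ζ.proj)) ζ₀ :=
    (hΓ p _ (coord_mem_slitDom p hp0 hζ₀)).contMDiffAt.comp ζ₀ hco
  have hfin := hfib.prodMk_space (hΓ'.clm_apply hfib)
  refine hfin.congr_of_eventuallyEq ?_
  have hev : ∀ᶠ ζ : PullbackTM E M in 𝓝 ζ₀, 
      ζ.proj.proj ∈ (chartAt E p).source ∧ ζ.proj ∈ slit E M :=
    hproj.continuousAt.eventually
      (Filter.inter_mem (source_mem_nhds p hp0) (isOpen_slit.mem_nhds hζ₀))
  filter_upwards [hev] with ζ hζ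
  have key : ∀ (v : TM E M) (w : T E v.proj), v.proj ∈ (chartAt E p).source → v ∈ slit E M →
      (trivializationAt (E × E) (TangentSpace 𝓘(ℝ, E).tangent : TM E M → Type _) ζ₀.proj
        ⟨v, H v w⟩).2 = ((coord p (⟨v.proj, w⟩ : TM E M)).2,
          Γ p (coord p v) (coord p (⟨v.proj, w⟩ : TM E M)).2) := by
    intro v w hv hv0
    obtain ⟨z, hz, rfl⟩ : ∃ z ∈ slitDom E p, v = param p z :=
      ⟨_, coord_mem_slitDom p hv hv0, (param_coord p hv).symm⟩
    obtain ⟨a, rfl⟩ := (dbase_isInvertible p hz.1).surjective w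
    have h1 : (coord p (⟨(param p z).proj, dbase p z.1 a⟩ : TM E M)).2 = a := by
      have h2 := param_eq p (z := (z.1, a)) hz.1
      have h3 := coord_param p (z := (z.1, a)) hz.1
      rw [h2] at h3
      exact congrArg Prod.snd h3
    rw [h1, coord_param p hz.1, h p z hz]
    exact trivializationAt_dparam p hz.1 rfl _
  exact key ζ.proj ζ.2 hζ.1 hζ.2

theorem isEhresmannConnection_associatedConnection {S : ∀ v : TM E M, TT v}
    (hS : ∀ v, vertEndo v (S v) = liouville v) (hS1 : IsVectorFieldOn ⊤ S (slit E M)) :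
    IsEhresmannConnection (associatedConnection S) where
  splits v w := by
    rw [proj_eq_fst]
    rfl
  smooth := contMDiffOn_of_coordinates
    (Γ := fun p z => (1 / 2 : ℝ) • (fderiv ℝ (locSpray p S) z).comp (ContinuousLinearMap.inr ℝ E E))
    (fun p z hz w => associatedConnection_apply_dbase hS hS1 p hz w)
    (fun p z hz => ContDiffAt.const_smul _
      (ContDiffAt.clm_comp ((hS1.contDiffAt_loc p hz).snd.fderiv_right (m := ∞)
        (by exact_mod_cast le_top)) contDiffAt_const))
  zero_section p w := by
    refine Eq.trans ?_ (mfderiv_zeroSection (E := E) p w).symm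
    refine Prod.ext rfl ?_
    change connCoeff S ⟨p, 0⟩ w = 0
    rw [connCoeff, if_pos rfl]
    rfl

theorem isAssociatedConnection_associatedConnection [T2Space M] {S : ∀ v : TM E M, TT v}
    (hS : ∀ v, vertEndo v (S v) = liouville v) (hS1 : IsVectorFieldOn ⊤ S (slit E M)) :
    IsAssociatedConnection S (associatedConnection S) := by
  have hH := isEhresmannConnection_associatedConnection hS hS1
  refine (isAssociatedConnection_iff hH hS hS1).2 fun p y hy w => ?_
  have h1 := hH.apply_center p y w
  have h2 : connCoeff S ⟨p, y⟩ w = locConn p (associatedConnection S) (center p y) w :=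
    congrArg Prod.snd h1
  rw [← h2, connCoeff_mk S p hy]
  rfl

theorem IsAssociatedConnection.unique [T2Space M] {S : ∀ v : TM E M, TT v}
    (hS : ∀ v, vertEndo v (S v) = liouville v) (hS1 : IsVectorFieldOn ⊤ S (slit E M))
    {H H' : FibreLinearMap E M} (hH : IsAssociatedConnection S H)
    (hH' : IsAssociatedConnection S H') : H = H' := by
  refine hH.isEhresmannConnection.ext_on_slit hH'.isEhresmannConnection fun p y hy => ?_
  ext1 w
  rw [(isAssociatedConnection_iff hH.isEhresmannConnection hS hS1).1 hH p y hy,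
    (isAssociatedConnection_iff hH'.isEhresmannConnection hS hS1).1 hH' p y hy]

end CanonicalSpray

section CanonicalConnection

variable {E : Type*} [NormedAddCommGroup E] [NormedSpace ℝ E] [FiniteDimensional ℝ E]
  {M : Type*} [TopologicalSpace M] [ChartedSpace E M] [IsManifold 𝓘(ℝ, E) ∞ M]

/-! ### Torsion and tension in coordinates -/

namespace IsEhresmannConnection
variable [T2Space M] {H : FibreLinearMap E M} (hH : IsEhresmannConnection H)
include hH

theorem vertProj_center (p : M) (y : E) (ξ : TT (⟨p, y⟩ : TM E M)) :
    (vertProj H ⟨p, y⟩ ξ : E × E) =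
      (0, (ξ : E × E).2 - locConn p H (center p y) (ξ : E × E).1) := by
  have h1 : (H ⟨p, y⟩ (proj ⟨p, y⟩ ξ) : E × E) = (_, _) :=
    (congrArg (fun a : E => (H ⟨p, y⟩ a : E × E)) (proj_eq_fst ⟨p, y⟩ ξ)).trans
      (hH.apply_center p y (ξ : E × E).1)
  refine (congrArg (fun a : E × E => (show E × E from ξ) - a) h1).trans ?_
  exact Prod.ext (sub_self _) rfl

theorem loc_apply_eventuallyEq (p : M) {z : E × E} (hz : z ∈ dom E p)
    (X : ∀ v : TM E M, T E v.proj) :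
    loc p (fun u => H u (X u)) =ᶠ[𝓝 z] fun z => (locSec p X z, locConn p H z (locSec p X z)) := by
  filter_upwards [(isOpen_dom p).mem_nhds hz] with z' hz'
  exact hH.loc_apply p hz' X

theorem fderiv_loc_apply (p : M) {z : E × E} (hz : z ∈ slitDom E p)
    {X : ∀ v : TM E M, T E v.proj} (hX : IsSectionAlong X) (ζ : E × E) :
    fderiv ℝ (loc p (fun u => H u (X u))) z ζ = (fderiv ℝ (locSec p X) z ζ,
      locConn p H z (fderiv ℝ (locSec p X) z ζ)
        + fderiv ℝ (locConn p H) z ζ (locSec p X z)) := by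
  have h1 := ((hX.contDiffAt_locSec p hz).differentiableAt (by simp)).hasFDerivAt
  have h2 := ((hH.contDiffAt_locConn p hz).differentiableAt (by simp)).hasFDerivAt
  have h3 := h1.prodMk (h2.clm_apply h1)
  rw [(hH.loc_apply_eventuallyEq p hz.1 X).fderiv_eq, h3.fderiv]
  simp

theorem contDiffAt_loc_apply (p : M) {z : E × E} (hz : z ∈ slitDom E p)
    {X : ∀ v : TM E M, T E v.proj} (hX : IsSectionAlong X) :
    ContDiffAt ℝ 1 (loc p (fun u => H u (X u))) z :=
  ((hH.isVectorFieldOn_apply hX).contDiffAt_loc p hz).of_le (by exact_mod_cast le_top)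

/-- The derivatives of `X` disappear under the vertical projection, leaving `Γ X - (∂_y Γ) X`. -/
theorem tension_center {X : ∀ v : TM E M, T E v.proj} (hX : IsSectionAlong X) (p : M) {y : E}
    (hy : y ≠ 0) :
    (vertProj H ⟨p, y⟩ (bracket (fun u => H u (X u)) liouville ⟨p, y⟩) : E × E) =
      (0, locConn p H (center p y) (locSec p X (center p y))
        - fderiv ℝ (locConn p H) (center p y) (0, y) (locSec p X (center p y))) := by
  have hz := center_mem_slitDom p hy
  obtain ⟨h1, h2⟩ := hasFDerivAt_loc_liouville p hz.1
  have h3 := bracket_center p y (hH.contDiffAt_loc_apply p hz hX)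
    (h2.of_le (by exact_mod_cast le_top))
  rw [loc_liouville p hz.1, h1.fderiv, hH.fderiv_loc_apply p hz hX, hH.loc_apply p hz.1] at h3
  rw [hH.vertProj_center, h3]
  refine Prod.ext rfl ?_
  simp only [ContinuousLinearMap.prod_apply, zero_apply,
    ContinuousLinearMap.coe_snd', Prod.mk_sub_mk, map_sub, map_zero, center]
  abel

theorem fderiv_loc_vert (p : M) {z : E × E} (hz : z ∈ slitDom E p)
    {X : ∀ v : TM E M, T E v.proj} (hX : IsSectionAlong X) :
    (∀ ζ, fderiv ℝ (loc p (fun u => vert u (X u))) z ζ = (0, fderiv ℝ (locSec p X) z ζ)) ∧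
      ContDiffAt ℝ 1 (loc p (fun u => vert u (X u))) z := by
  have h0 : loc p (fun u => vert u (X u)) =ᶠ[𝓝 z] fun z => (0, locSec p X z) := by
    filter_upwards [(isOpen_dom p).mem_nhds hz.1] with z' hz'
    exact loc_vert p hz' X
  have h1 := hX.contDiffAt_locSec p hz
  refine ⟨fun ζ => ?_, ?_⟩
  · have h2 := (hasFDerivAt_const (𝕜 := ℝ) (0 : E) z).prodMk (h1.differentiableAt (by simp)).hasFDerivAt
    rw [h0.fderiv_eq, h2.fderiv]
    rfl
  · exact (contDiffAt_const.prodMk (h1.of_le (by exact_mod_cast le_top))).congr_of_eventuallyEq h0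

/-- The derivatives of `X` and `Y` along horizontal vectors in the first two terms are cancelled by
the base part of `[H X, H Y]`; the antisymmetrized vertical derivative of `Γ` is left. -/
theorem torsion_center {X Y : ∀ v : TM E M, T E v.proj} (hX : IsSectionAlong X)
    (hY : IsSectionAlong Y) (p : M) {y : E} (hy : y ≠ 0) :
    (vertProj H ⟨p, y⟩ (bracket (fun u => H u (X u)) (fun u => vert u (Y u)) ⟨p, y⟩)
      - vertProj H ⟨p, y⟩ (bracket (fun u => H u (Y u)) (fun u => vert u (X u)) ⟨p, y⟩)
      - vertEndo ⟨p, y⟩ (bracket (fun u => H u (X u)) (fun u => H u (Y u)) ⟨p, y⟩) : E × E) =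
      (0, fderiv ℝ (locConn p H) (center p y) (0, locSec p X (center p y)) (locSec p Y (center p y))
        - fderiv ℝ (locConn p H) (center p y) (0, locSec p Y (center p y))
          (locSec p X (center p y))) := by
  have hz := center_mem_slitDom p hy
  have key : ∀ {X Y : ∀ v : TM E M, T E v.proj}, IsSectionAlong X → IsSectionAlong Y →
      (vertProj H ⟨p, y⟩ (bracket (fun u => H u (X u)) (fun u => vert u (Y u)) ⟨p, y⟩) : E × E) =
      (0, fderiv ℝ (locSec p Y) (center p y)
          (locSec p X (center p y), locConn p H (center p y) (locSec p X (center p y)))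
        - fderiv ℝ (locConn p H) (center p y) (0, locSec p Y (center p y))
          (locSec p X (center p y))) := by
    intro X Y hX hY
    obtain ⟨h1, h2⟩ := hH.fderiv_loc_vert p hz hY
    have h3 := bracket_center p y (hH.contDiffAt_loc_apply p hz hX) h2
    rw [loc_vert p hz.1, h1, hH.fderiv_loc_apply p hz hX, hH.loc_apply p hz.1] at h3
    rw [hH.vertProj_center, h3]
    refine Prod.ext rfl ?_
    simp only [Prod.mk_sub_mk, zero_sub, map_neg]
    abel
  have h3 := bracket_center p y (hH.contDiffAt_loc_apply p hz hX)
    (hH.contDiffAt_loc_apply p hz hY)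
  rw [hH.fderiv_loc_apply p hz hX, hH.fderiv_loc_apply p hz hY, hH.loc_apply p hz.1,
    hH.loc_apply p hz.1] at h3
  have h4 : (vertEndo ⟨p, y⟩ (bracket (fun u => H u (X u)) (fun u => H u (Y u)) ⟨p, y⟩) : E × E) =
      (0, fderiv ℝ (locSec p Y) (center p y)
          (locSec p X (center p y), locConn p H (center p y) (locSec p X (center p y)))
        - fderiv ℝ (locSec p X) (center p y)
          (locSec p Y (center p y), locConn p H (center p y) (locSec p Y (center p y)))) := by
    refine (vert_eq_mk _ _).trans (Prod.ext rfl ?_)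
    exact (proj_eq_fst _ _).trans (congrArg Prod.fst h3)
  refine (congrArg₂ (fun a b : E × E => a - b)
    (congrArg₂ (fun a b : E × E => a - b) (key hX hY) (key hY hX)) h4).trans ?_
  refine Prod.ext (by simp) ?_
  simp only [Prod.mk_sub_mk]
  abel

omit hH in
theorem exists_isSectionAlong_locSec (p : M) (y w : E) :
    ∃ X : ∀ v : TM E M, T E v.proj, IsSectionAlong X ∧ locSec p X (center p y) = w := by
  obtain ⟨X, hX, hX1⟩ := exists_isVectorField_eventuallyEq p (mem_chart_target E p) w
  refine ⟨_, hX.isSectionAlong, ?_⟩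
  rw [locSec_base p (center_mem_dom p y)]
  exact (locBase_eq_iff p (mem_chart_target E p) X w).2 hX1.self_of_nhds

theorem isHomogeneous_iff : IsHomogeneous H ↔ ∀ (p : M) (y : E), y ≠ 0 → ∀ w : E,
    fderiv ℝ (locConn p H) (center p y) (0, y) w = locConn p H (center p y) w := by
  constructor
  · intro h p y hy w
    obtain ⟨X, hX, hXw⟩ := exists_isSectionAlong_locSec p y w
    have h1 := congrArg Prod.snd ((hH.tension_center hX p hy).symm.trans (h X hX ⟨p, y⟩ hy))
    rw [hXw] at h1
    exact (sub_eq_zero.1 h1).symm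
  · intro h X hX v hv
    obtain ⟨p, y, rfl⟩ := exists_eq_mk v
    refine (hH.tension_center hX p hv).trans (Prod.ext rfl ?_)
    exact sub_eq_zero.2 (h p y hv _).symm

theorem isTorsionFree_iff : IsTorsionFree H ↔ ∀ (p : M) (y : E), y ≠ 0 → ∀ a b : E,
    fderiv ℝ (locConn p H) (center p y) (0, a) b =
      fderiv ℝ (locConn p H) (center p y) (0, b) a := by
  constructor
  · intro h p y hy a b
    obtain ⟨X, hX, hXa⟩ := exists_isSectionAlong_locSec p y a
    obtain ⟨Y, hY, hYb⟩ := exists_isSectionAlong_locSec p y b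
    have h1 := congrArg Prod.snd ((hH.torsion_center hX hY p hy).symm.trans (h X Y hX hY ⟨p, y⟩ hy))
    rw [hXa, hYb] at h1
    exact sub_eq_zero.1 h1
  · intro h X Y hX hY v hv
    obtain ⟨p, y, rfl⟩ := exists_eq_mk v
    refine (hH.torsion_center hX hY p hv).trans (Prod.ext rfl ?_)
    exact sub_eq_zero.2 (h p y hv _ _)

omit [T2Space M] in
theorem isConservative_iff {F : TM E M → ℝ} (hF : IsFinslerFunction F) :
    IsConservative F H ↔ ∀ (p : M) (y : E), y ≠ 0 → ∀ w : E,
      fderiv ℝ (energy F ∘ param p) (center p y) (w, locConn p H (center p y) w) = 0 := by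
  have key : ∀ (p : M) (y : E), y ≠ 0 → ∀ w : E, (dirDeriv F ⟨p, y⟩ (H ⟨p, y⟩ w) = 0 ↔
      fderiv ℝ (energy F ∘ param p) (center p y) (w, locConn p H (center p y) w) = 0) := by
    intro p y hy w
    rw [← hF.dirDeriv_param_eq_zero_iff p (center_mem_slitDom p hy),
      ← hH.apply_dbase p (center_mem_dom p y)]
    have h1 : dirDeriv F (param p (center p y)) (H (param p (center p y)) (dbase p (chartAt E p p) w)) =
        dirDeriv F (param p (center p y)) (H (param p (center p y)) (show E from w)) :=
      congrArg (fun a : E => dirDeriv F (param p (center p y)) (H (param p (center p y)) a))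
        (dbase_center p w)
    have h2 : dirDeriv F (param p (center p y)) (H (param p (center p y)) (show E from w)) =
        dirDeriv F ⟨p, y⟩ (H ⟨p, y⟩ w) :=
      congrArg (fun v => dirDeriv F v (H v (show E from w))) (param_center p y)
    exact (h1.trans h2).symm ▸ Iff.rfl
  constructor
  · exact fun h p y hy w => (key p y hy w).1 (h ⟨p, y⟩ hy w)
  · intro h v hv w
    obtain ⟨p, y, rfl⟩ := exists_eq_mk v
    exact (key p y hv w).2 (h p y hv w)

end IsEhresmannConnection

/-! ### The criterion for Finsler variationality -/

theorem loc_semispray_eventuallyEq {S : ∀ v : TM E M, TT v}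
    (hS : ∀ v, vertEndo v (S v) = liouville v) (p : M) (y : E) :
    ∀ᶠ z' in 𝓝 (center p y), loc p S z' = (z'.2, locSpray p S z') := by
  filter_upwards [(isOpen_dom p).mem_nhds (center_mem_dom p y)] with z' hz'
  exact loc_semispray p hz' (hS _)

theorem IsFinslerFunction.isCanonicalSpray_iff [T2Space M] {F : TM E M → ℝ}
    (hF : IsFinslerFunction F) {S : ∀ v : TM E M, TT v} (h0 : ∀ p : M, S ⟨p, 0⟩ = 0)
    (hS : ∀ v, vertEndo v (S v) = liouville v) (hS1 : IsVectorFieldOn ⊤ S (slit E M)) :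
    IsCanonicalSpray F S ↔ ∀ (p : M) (y : E), y ≠ 0 →
      IsEulerLagrangeVector (energy F ∘ param p) (center p y) (y, locSpray p S (center p y)) := by
  have key : ∀ (p : M) (y : E), y ≠ 0 → ((∀ η : ∀ v : TM E M, TT v, IsVectorFieldOn ⊤ η (slit E M) →
      extDerivOneForm (dJ (energy F)) S η ⟨p, y⟩ = - dirDeriv (energy F) ⟨p, y⟩ (η ⟨p, y⟩)) ↔
      IsEulerLagrangeVector (energy F ∘ param p) (center p y) (y, locSpray p S (center p y))) := by
    intro p y hy
    have h1 := hF.euler_lagrange_iff p (center_mem_slitDom p hy)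
      ((hS1.contDiffAt_loc p (center_mem_slitDom p hy)).of_le (by exact_mod_cast le_top))
    rwa [param_center, (loc_semispray_eventuallyEq hS p y).self_of_nhds] at h1
  constructor
  · exact fun h p y hy => (key p y hy).1 fun η hη => h.euler_lagrange η hη _ hy
  · intro h
    refine ⟨h0, hS1, fun η hη v hv => ?_⟩
    obtain ⟨p, y, rfl⟩ := exists_eq_mk v
    exact (key p y hv).2 (h p y hv) η hη

theorem fderiv_locSpray_vertical_self {S : ∀ v : TM E M, TT v} (hS : IsSpray S) (p : M) (y : E) :
    fderiv ℝ (locSpray p S) (center p y) (0, y) = (2 : ℝ) • locSpray p S (center p y) := by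
  have h1 := bracket_liouville_eq_iff p (center_mem_dom p y)
    (loc_semispray_eventuallyEq hS.semispray p y)
    (contDiffAt_loc (k := 1) p (center_mem_dom p y) (hS.contDiff_one.contMDiffAt Filter.univ_mem))
  exact h1.1 (hS.homogeneous _)

/-- Euler's relation at `y = 0` reads `0 = 2 s`. The `C^1` condition on sprays makes it available
there. -/
theorem IsSpray.apply_zero {S : ∀ v : TM E M, TT v} (hS : IsSpray S) (p : M) : S ⟨p, 0⟩ = 0 := by
  have h1 := fderiv_locSpray_vertical_self hS p 0
  have h2 := (loc_semispray_eventuallyEq hS.semispray p 0).self_of_nhds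
  have h3 : fderiv ℝ (locSpray p S) (center p 0) ((0, 0) : E × E) = 0 := map_zero _
  rw [h3] at h1
  have h4 : locSpray p S (center p 0) = 0 := (smul_eq_zero.1 h1.symm).resolve_left two_ne_zero
  rw [h4] at h2
  exact (loc_center p 0 S).symm.trans h2

theorem IsVectorFieldOn.contDiffAt_locSpray {S : ∀ v : TM E M, TT v}
    (hS : IsVectorFieldOn ⊤ S (slit E M)) (p : M) {y : E} (hy : y ≠ 0) :
    ContDiffAt ℝ ∞ (locSpray p S) (center p y) :=
  (hS.contDiffAt_loc p (center_mem_slitDom p hy)).snd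

/-- A spray is the canonical spray of a Finsler function if and only if the associated connection
is conservative. -/
theorem IsFinslerFunction.isCanonicalSpray_iff_isConservative [T2Space M] {F : TM E M → ℝ}
    (hF : IsFinslerFunction F) {S : ∀ v : TM E M, TT v} {H : FibreLinearMap E M} (hS : IsSpray S)
    (hH : IsAssociatedConnection S H) : IsCanonicalSpray F S ↔ IsConservative F H := by
  rw [hF.isCanonicalSpray_iff hS.apply_zero hS.semispray hS.smooth,
    hH.isEhresmannConnection.isConservative_iff hF]
  have h1 := (isAssociatedConnection_iff hH.isEhresmannConnection hS.semispray hS.smooth).1 hH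
  have hd : ∀ (p : M) (y : E), y ≠ 0 → DifferentiableAt ℝ (locSpray p S) (chartAt E p p, y) :=
    fun p y hy => (hS.smooth.contDiffAt_locSpray p hy).differentiableAt (by simp)
  constructor
  · intro h p y hy w
    rw [h1 p y hy]
    exact (hF.isRegularEnergy p).fderiv_horizontal_eq_zero (mem_chart_target E p) (hd p) (h p) hy w
  · intro h p y hy
    refine (hF.isRegularEnergy p).isEulerLagrangeVector_of_fderiv_horizontal_eq_zero
      (mem_chart_target E p) (hd p) (fun y _ => fderiv_locSpray_vertical_self hS p y)
      (fun y hy w => ?_) hy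
    have h2 := h p y hy w
    rwa [h1 p y hy] at h2

/-! ### The canonical connection -/

/-- The equation `Γ w = ½ ∂_w s` is at hand on the whole punctured fibre over `p`, so it may be
differentiated vertically. -/
theorem IsAssociatedConnection.fderiv_locConn_vertical [T2Space M] {S : ∀ v : TM E M, TT v}
    {H : FibreLinearMap E M} (hH : IsAssociatedConnection S H)
    (hS : ∀ v, vertEndo v (S v) = liouville v) (hS1 : IsVectorFieldOn ⊤ S (slit E M)) (p : M)
    {y : E} (hy : y ≠ 0) (a b : E) :
    fderiv ℝ (locConn p H) (center p y) (0, a) b =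
      (1 / 2 : ℝ) • fderiv ℝ (fderiv ℝ (locSpray p S)) (center p y) (0, a) (0, b) := by
  have h1 := (isAssociatedConnection_iff hH.isEhresmannConnection hS hS1).1 hH
  have h2 : HasFDerivAt (fun y => fderiv ℝ (locSpray p S) (center p y))
      ((fderiv ℝ (fderiv ℝ (locSpray p S)) (center p y)).comp (ContinuousLinearMap.inr ℝ E E)) y :=
    HasFDerivAt.comp y ((((hS1.contDiffAt_locSpray p hy).fderiv_right (m := ∞)
      (by exact_mod_cast le_top)).differentiableAt (by simp)).hasFDerivAt)
      (hasFDerivAt_prodMk_right _ _)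
  have h3 := (h2.clm_apply (hasFDerivAt_const ((0, b) : E × E) y)).const_smul (1 / 2 : ℝ)
  have h4 := ((hH.isEhresmannConnection.contDiffAt_locConn p (center_mem_slitDom p hy)
    ).differentiableAt (by simp)).hasFDerivAt.clm_apply (hasFDerivAt_const b (center p y))
  have h5 := fderiv_vertical_eq_of_eventuallyEq h4.differentiableAt h3 (by
    filter_upwards [isOpen_compl_singleton.mem_nhds hy] with y' hy'
    exact h1 p y' hy' b) a
  rw [h4.fderiv] at h5
  simpa using h5

/-- Derivative of `∂_y s = 2 s` along `w`: the left side gives `∂_w s + D²s((0, w), (0, y))`, the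
right side `2 ∂_w s`. -/
theorem fderiv_fderiv_locSpray_vertical_self {S : ∀ v : TM E M, TT v} (hS : IsSpray S) (p : M)
    {y : E} (hy : y ≠ 0) (w : E) :
    fderiv ℝ (fderiv ℝ (locSpray p S)) (center p y) (0, w) (0, y) =
      fderiv ℝ (locSpray p S) (center p y) (0, w) := by
  have h0 := hS.smooth.contDiffAt_locSpray p hy
  have h1 := ((h0.fderiv_right (m := ∞) (by exact_mod_cast le_top)).differentiableAt
    (by simp)).hasFDerivAt
  have h2 := h1.clm_apply ((hasFDerivAt_const (0 : E) (center p y)).prodMk hasFDerivAt_snd)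
  have h3 : HasFDerivAt (fun y => (2 : ℝ) • locSpray p S (center p y)) _ y :=
    (HasFDerivAt.comp y (h0.differentiableAt (by simp)).hasFDerivAt
      (hasFDerivAt_prodMk_right (chartAt E p p) y)).const_smul (2 : ℝ)
  have h5 := fderiv_vertical_eq_of_eventuallyEq h2.differentiableAt h3
    (Filter.Eventually.of_forall fun y' => fderiv_locSpray_vertical_self hS p y') w
  rw [h2.fderiv] at h5
  have h6 : fderiv ℝ (locSpray p S) (center p y) (0, w)
      + fderiv ℝ (fderiv ℝ (locSpray p S)) (center p y) (0, w) (0, y)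
      = (2 : ℝ) • fderiv ℝ (locSpray p S) (center p y) (0, w) := by
    simpa [center] using h5
  rw [two_smul] at h6
  exact add_left_cancel h6

/-- The vertical derivative of `Γ` is half the fibre Hessian of `s`, which is symmetric. -/
theorem IsAssociatedConnection.isTorsionFree [T2Space M] {S : ∀ v : TM E M, TT v}
    {H : FibreLinearMap E M} (hH : IsAssociatedConnection S H) (hS : IsSpray S) :
    IsTorsionFree H := by
  refine hH.isEhresmannConnection.isTorsionFree_iff.2 fun p y hy a b => ?_
  rw [hH.fderiv_locConn_vertical hS.semispray hS.smooth p hy,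
    hH.fderiv_locConn_vertical hS.semispray hS.smooth p hy]
  congr 1
  exact (hS.smooth.contDiffAt_locSpray p hy).isSymmSndFDerivAt (by
    simp only [minSmoothness_of_isRCLikeNormedField]
    exact WithTop.coe_le_coe.2 (le_top : (2 : ℕ∞) ≤ ⊤)) _ _

/-- By symmetry `(∂_y Γ) w = (∂_w Γ) y = ½ D²s((0, w), (0, y)) = ½ ∂_w s = Γ w`. -/
theorem IsAssociatedConnection.isHomogeneous [T2Space M] {S : ∀ v : TM E M, TT v}
    {H : FibreLinearMap E M} (hH : IsAssociatedConnection S H) (hS : IsSpray S) :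
    IsHomogeneous H := by
  refine hH.isEhresmannConnection.isHomogeneous_iff.2 fun p y hy w => ?_
  rw [hH.isEhresmannConnection.isTorsionFree_iff.1 (hH.isTorsionFree hS) p y hy,
    hH.fderiv_locConn_vertical hS.semispray hS.smooth p hy,
    fderiv_fderiv_locSpray_vertical_self hS p hy,
    (isAssociatedConnection_iff hH.isEhresmannConnection hS.semispray hS.smooth).1 hH p y hy]

theorem IsFinslerFunction.isCanonicalConnection_associatedConnection [T2Space M] {F : TM E M → ℝ}
    (hF : IsFinslerFunction F) :
    IsCanonicalConnection F (associatedConnection (canonicalSpray F)) :=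
  ⟨canonicalSpray F, hF.isSpray_canonicalSpray, hF.isCanonicalSpray_canonicalSpray,
    isAssociatedConnection_associatedConnection hF.isSpray_canonicalSpray.semispray
      hF.isSpray_canonicalSpray.smooth⟩

theorem IsFinslerFunction.existsUnique_isCanonicalConnection [T2Space M] {F : TM E M → ℝ}
    (hF : IsFinslerFunction F) : ∃! H : FibreLinearMap E M, IsCanonicalConnection F H := by
  refine ⟨_, hF.isCanonicalConnection_associatedConnection, ?_⟩
  rintro H ⟨S, hS, hSF, hH⟩
  obtain rfl := hF.eq_canonicalSpray hSF
  exact hH.unique hS.semispray hS.smooth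
    (isAssociatedConnection_associatedConnection hS.semispray hS.smooth)

theorem isSectionAlong_self : IsSectionAlong fun v : TM E M => v.2 := contMDiffOn_id

/-- A torsion-free, homogeneous and conservative Ehresmann connection is the canonical
connection. -/
theorem IsFinslerFunction.isCanonicalConnection_of_isTorsionFree [T2Space M] {F : TM E M → ℝ}
    (hF : IsFinslerFunction F) {H : FibreLinearMap E M} (hH : IsEhresmannConnection H)
    (ht : IsTorsionFree H) (hh : IsHomogeneous H) (hc : IsConservative F H) :
    IsCanonicalConnection F H := by
  rw [hH.isTorsionFree_iff] at ht
  rw [hH.isHomogeneous_iff] at hh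
  rw [hH.isConservative_iff hF] at hc
  -- The only possible spray: if `H` is associated to a spray `S`, then `Γ y = ½ ∂_y s = s`.
  set S : ∀ v : TM E M, TT v := fun v => H v v.2 with hSdef
  have hS1 : IsVectorFieldOn ⊤ S (slit E M) := hH.isVectorFieldOn_apply isSectionAlong_self
  have hS : ∀ v, vertEndo v (S v) = liouville v := fun v => congrArg (vert v) (hH.splits v v.2)
  have h0 : ∀ p : M, S ⟨p, 0⟩ = 0 := fun p => map_zero (H ⟨p, 0⟩)
  have hsp : ∀ (p : M) {z : E × E}, z ∈ dom E p → locSpray p S z = locConn p H z z.2 := by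
    intro p z hz
    have h1 : loc p S z = _ := hH.loc_apply p hz fun v => v.2
    rw [locSec_self p hz] at h1
    show (loc p S z).2 = _
    rw [h1]
  have hder : ∀ (p : M) (y : E), y ≠ 0 → ∀ w : E,
      fderiv ℝ (locSpray p S) (center p y) (0, w) = (2 : ℝ) • locConn p H (center p y) w := by
    intro p y hy w
    have h1 := ((hH.contDiffAt_locConn p (center_mem_slitDom p hy)).differentiableAt
      (by simp)).hasFDerivAt.clm_apply (hasFDerivAt_snd (𝕜 := ℝ))
    have h2 : locSpray p S =ᶠ[𝓝 (center p y)] fun z => locConn p H z z.2 := by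
      filter_upwards [(isOpen_dom p).mem_nhds (center_mem_dom p y)] with z hz
      exact hsp p hz
    have h3 : fderiv ℝ (locSpray p S) (center p y) (0, w) =
        locConn p H (center p y) w + fderiv ℝ (locConn p H) (center p y) (0, w) y := by
      rw [h2.fderiv_eq, h1.fderiv]
      simp [center]
    -- Torsion-freeness exchanges `(∂_w Γ) y` for `(∂_y Γ) w`, which homogeneity identifies with `Γ
    -- w`.
    rw [h3, ht p y hy w y, hh p y hy w, two_smul]
  have hassoc : IsAssociatedConnection S H := by
    refine (isAssociatedConnection_iff hH hS hS1).2 fun p y hy w => ?_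
    rw [hder p y hy, smul_smul]
    norm_num
  have hcan : IsCanonicalSpray F S := by
    refine (hF.isCanonicalSpray_iff h0 hS hS1).2 fun p y hy => ?_
    refine (hF.isRegularEnergy p).isEulerLagrangeVector_of_fderiv_horizontal_eq_zero
      (mem_chart_target E p)
      (fun y hy => (hS1.contDiffAt_locSpray p hy).differentiableAt (by simp))
      (fun y hy => ?_) (fun y hy w => ?_) hy
    · exact (hder p y hy y).trans (congrArg _ (hsp p (center_mem_dom p y)).symm)
    · have h1 := hder p y hy w
      have h2 := hc p y hy w
      have h3 : (1 / 2 : ℝ) • fderiv ℝ (locSpray p S) (center p y) (0, w) =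
          locConn p H (center p y) w := by
        rw [h1, smul_smul]
        norm_num
      rw [← h3] at h2
      exact h2
  refine ⟨S, ?_, hcan, hassoc⟩
  -- The `C^1` condition across the zero section and `[C, S] = S` need no separate check: `S`
  -- coincides with the canonical spray, for which both are known.
  rw [hF.eq_canonicalSpray hcan]
  exact hF.isSpray_canonicalSpray

end CanonicalConnection

end SprayFinsler

end

/-! ### The theorem -/

theorem mainTheorem10
    {E : Type*} [NormedAddCommGroup E] [NormedSpace ℝ E] [FiniteDimensional ℝ E]
    (hE : 2 ≤ Module.finrank ℝ E)
    {M : Type*} [TopologicalSpace M] [T2Space M] [SecondCountableTopology M] [ConnectedSpace M]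
    [ChartedSpace E M] [IsManifold 𝓘(ℝ, E) ∞ M]
    (F : SprayFinsler.TM E M → ℝ) (hF : SprayFinsler.IsFinslerFunction F) :
    -- a spray is the canonical spray of `F` iff `dF ∘ H = 0` for the connection `H` it generates
    (∀ (S : ∀ v : SprayFinsler.TM E M, SprayFinsler.TT v) (H : SprayFinsler.FibreLinearMap E M),
      SprayFinsler.IsSpray S → SprayFinsler.IsAssociatedConnection S H →
        (SprayFinsler.IsCanonicalSpray F S ↔ SprayFinsler.IsConservative F H)) ∧
    -- the canonical connection exists, and it is the only torsion-free, homogeneous Ehresmann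
    -- connection with `dF ∘ H = 0`
    (∃! H : SprayFinsler.FibreLinearMap E M, SprayFinsler.IsCanonicalConnection F H) ∧
    (∀ H : SprayFinsler.FibreLinearMap E M, SprayFinsler.IsEhresmannConnection H →
      (SprayFinsler.IsCanonicalConnection F H ↔
        SprayFinsler.IsTorsionFree H ∧ SprayFinsler.IsHomogeneous H ∧
          SprayFinsler.IsConservative F H)) := by
  refine ⟨fun S H hS hH => hF.isCanonicalSpray_iff_isConservative hS hH,
    hF.existsUnique_isCanonicalConnection, fun H hH => ⟨?_, ?_⟩⟩
  · rintro ⟨S, hS, hSF, hSH⟩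
    exact ⟨hSH.isTorsionFree hS, hSH.isHomogeneous hS,
      (hF.isCanonicalSpray_iff_isConservative hS hSH).1 hSF⟩
  · rintro ⟨ht, hh, hc⟩
    exact hF.isCanonicalConnection_of_isTorsionFree hH ht hh hc
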